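/- **Setting.** Let $\mathcal X$ be a measurable space and $\mathcal C$ a class of measurable functions $f:\mathcal X\to\{\pm1\}$. Hypotheses are given by descriptions $h$ from a measurable space, with jointly measurable evaluation $(h,x)\mapsto h(x)\in\{\pm1\}$. A randomized algorithm $\mathcal A$ receives $m$ labeled training examples $(x,f(x))$, $x\sim D_1$, and $n$ unlabeled test examples $x\sim D_0$ (all independent), and answers REJECT, or ACCEPT with a hypothesis $h$. It is a (distribution-free) *$(\varepsilon,\delta)$-TDS learner* for $\mathcal C$ if for all probability distributions $D_1,D_0$ on $\mathcal X$ and all $f\in\mathcal C$, with probability at least $1-\delta$: if $\mathcal A$ accepts then $\Pr_{x\sim D_0}[f(x)\ne h(x)]\le\varepsilon$; and if $D_1=D_0$ then $\mathcal A$ accepts. A *PQ learner* for $\mathcal C$ with error and rejection rate $\eta$ and failure probability $\delta$ is a randomized algorithm with access to labeled examples from $D_1$ and unlabeled ones from $D_0$ that, for all $D_1,D_0$ and $f\in\mathcal C$, outputs with probability at least $1-\delta$ a (randomized) hypothesis $\hat h:\mathcal X\to\{\pm1\}$ and selector $\hat g:\mathcal X\to\{0,1\}$ with $\Pr_{x\sim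 D_0}[f(x)\ne\hat h(x),\ \hat g(x)=1]\le\eta$ and $\Pr_{x\sim D_1}[\hat g(x)=0]\le\eta$, where the probabilities include the randomness of evaluating $\hat h,\hat g$. **Theorem.** Let $\varepsilon,\delta\in(0,1)$, and let $\mathcal A$ be an $(\varepsilon,0.01)$-TDS learner for $\mathcal C$ with total sample complexity $m_{\mathcal A}=m+n\ge1$ and running time at most $T_{\mathcal A}\ge1$ per run. Then the algorithm $\mathrm{TDSboost}$ below, with its constants $c_1$ sufficiently large and $c$ sufficiently large depending on $c_1$, is a PQ learner for $\mathcal C$ with error and rejection rate $K\varepsilon$ and failure probability $\delta$, where $K$ is an absolute constant. In every run it makes at most $\mathrm{poly}(m_{\mathcal A},\frac1\varepsilon,\log\frac1\delta)$ calls to $\mathcal A$, draws at most $\mathrm{poly}(m_{\mathcal A},\frac1\varepsilon,\log\frac1\delta)$ examples from $D_1$ and $D_0$, and takes time at most $T_{\mathcal A}\cdot\mathrm{poly}(m_{\mathcal A},\frac1\varepsilon,\log\frac1\delta)$. The polynomials depend only on $c$ and $c_1$. A call to $\mathcal A$, with fresh internal randomness, is charged $T_{\mathcal A}$; drawing an example,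 tossing a coin of given bias and performing an elementary operation are charged $1$ each. **The algorithm** $\mathrm{TDSboost}$. All counts are rounded up. Put $T=c\,m_{\mathcal A}^2\log\frac1\varepsilon$, $\delta'=\frac{\delta}{cT^{10}}$, $r=c\log\frac T{\varepsilon\delta}$, $p_{\min}=\frac{3\varepsilon}{4T(T+1)}$, $\gamma_1=\frac{\varepsilon}{4T(T+1)}$, $\gamma_2=\frac1{c\,m_{\mathcal A}}$. A *$(\gamma,\delta')$-estimate* of a probability is the empirical frequency in $\lceil\log(2/\delta')/(2\gamma^2)\rceil$ independent trials. The algorithm builds a branching program with nodes $(i,t)$, $1\le i\le t\le T$. Each node has a label in $\{0,1\}$, a hypothesis $h_{i,t}$ (initially $\equiv1$) and a randomized routing function (initially $\perp$: the node is a leaf). The label of $(i,T)$ is initially $\mathbb 1\{i\ge T/2\}$, other labels are initially $0$. For $t=1,\dots,T$ and $i=1,\dots,t$: 1. Compute $(\gamma_1,\delta')$-estimates $\hat p^b$ ($b=0,1$) of the probability that $x\sim D_b$, routed from $(1,1)$, reaches $(i,t)$. If $t<T$ and $\hat p^1<p_{\min}$, set the label of $(i,t)$ to $0$; otherwise, if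 $t<T$ and $\hat p^0<p_{\min}$, set it to $1$. In both cases go to the next node. 2. Let $G^b$ be $D_b$ conditioned on reaching $(i,t)$, sampled by rejection sampling with at most $\lceil r/p_{\min}\rceil$ tested draws (if all fail, one further draw is used untested). Compute a $(0.01,\delta')$-estimate $\hat a$ of the probability that $\mathcal A$ accepts on training examples from $G^1$ (with labels) and test examples from $G^0$. If $\hat a\ge0.95$, set the label to $1$, run $\mathcal A$ in this way $r$ times, let $h_{i,t}$ be the majority vote of the hypotheses of the accepting runs, and go to the next node. 3. If $t<T$, run $\mathrm{GetWeakDistinguisher}(G^1,G^0,\delta')$. If it fails, the node stays a leaf. If it returns $W$, compute a $(\gamma_2,\delta')$-estimate $\hat q$ of $\Pr[W(x)=1]$ for $x\sim\frac12G^1+\frac12G^0$, and let the routing function send $x$ to $(i+\hat w,t+1)$, where $\hat w=W(x)$ with probability $\frac1{1+2|1/2-\hat q|}$ and otherwise $\hat w=\mathbb 1\{\hat q<\frac12\}$. To evaluate $\hat h,\hat g$ at $x$, route $x$ from $(1,1)$ to a leaf $N$; $\hat h(x)=h_N(x)$ and $\hat g(x)$ is the label of $N$. $\mathrm{GetWeakDistinguisher}(G^1,G^0,\delta')$.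 (i) Up to $c_1\log\frac1{\delta'}$ times: draw a labeled set $S$ of $m$ examples from $G^1$ and compute the mean, over $c\log\frac1{\delta'}$ trials with fresh $U^b\sim (G^b)^n$, of $\mathbb 1\{\mathcal A(S,U^1)\text{ accepts}\}-\mathbb 1\{\mathcal A(S,U^0)\text{ accepts}\}$; stop with $S$ once the mean is at least $0.004$. If no $S$ is found, fail. (ii) For $i=1,\dots,n$, up to $c_1n\log\frac1{\delta'}$ times: draw $b_1,\dots,b_{i-1}\sim G^0$ and $a_{i+1},\dots,a_n\sim G^1$, let $W(x)=\mathbb 1\{\mathcal A(S,(b_1,\dots,b_{i-1},x,a_{i+1},\dots,a_n))\text{ accepts}\}$ (a fresh run for each evaluation), and return $W$ if the mean of $W(x^1)-W(x^0)$ over $c\,n^2\log\frac n{\delta'}$ trials with fresh $x^b\sim G^b$ is at least $\frac1{5000n}$. If nothing is returned, fail. -/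

import Mathlib

open MeasureTheory ProbabilityTheory
open scoped ENNReal unitInterval

universe u v w z

noncomputable section

namespace TDS

/-! ## Learners

A domain `X` is a measurable space and `{±1}` is encoded as `Bool` (`true` is `+1`, `false` is `-1`).
A learner outputs *descriptions* of hypotheses: elements of a measurable space `H` together with an
evaluation map `ev : H → X → Bool`, `ev h x` being the value at `x` of the hypothesis that `h`
describes. -/

/-- The answer of a TDS learner: `Sum.inl ()` is REJECT, `Sum.inr h` is ACCEPT with hypothesis `h`. -/
abbrev Answer (H : Type v) : Type v := Unit ⊕ H

/-- Does the answer say ACCEPT? -/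
def Answer.accepts {H : Type v} (r : Answer H) : Bool := r.isRight

/-- A (randomized) TDS algorithm that uses `m` labeled training examples and `n` unlabeled test
examples: a kernel from the samples to the answer.  (An algorithm that uses at most that many
examples ignores the others.) -/
abbrev Learner (X : Type u) (H : Type v) [MeasurableSpace X] [MeasurableSpace H] (m n : ℕ) :
    Type (max u v) :=
  Kernel ((Fin m → X × Bool) × (Fin n → X)) (Answer H)

/-- The distribution `D` labeled by `f`: the law of `(x, f x)` for `x ∼ D`. -/
def labeled {X : Type u} [MeasurableSpace X] (D : Measure X) (f : X → Bool) : Measure (X × Bool) :=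
  D.map fun x => (x, f x)

/-- The law of the answer of `A` on `m` independent training examples from `D₁` labeled by `f` and
`n` independent unlabeled test examples from `D₀`. -/
def answerLaw {X : Type u} {H : Type v} [MeasurableSpace X] [MeasurableSpace H] {m n : ℕ}
    (A : Learner X H m n) (D₁ D₀ : Measure X) (f : X → Bool) : Measure (Answer H) :=
  ((Measure.pi fun _ : Fin m => labeled D₁ f).prod (Measure.pi fun _ : Fin n => D₀)).bind A

/-- `A` is a distribution-free TDS learner for the concept class `C` up to error `ε` with probability
of failure `δ`: whatever the training distribution `D₁` (labeled by some `f ∈ C`) and the test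
distribution `D₀`, with probability at least `1 - δ` one has *soundness* (upon acceptance the
hypothesis has test error at most `ε`) and *completeness* (if `D₁ = D₀` then `A` accepts). -/
def IsTDSLearner {X : Type u} {H : Type v} [MeasurableSpace X] [MeasurableSpace H] {m n : ℕ}
    (ev : H → X → Bool) (C : Set (X → Bool)) (A : Learner X H m n) (ε δ : ℝ) : Prop :=
  ∀ (D₁ D₀ : Measure X) [IsProbabilityMeasure D₁] [IsProbabilityMeasure D₀], ∀ f ∈ C,
    ENNReal.ofReal (1 - δ) ≤ answerLaw A D₁ D₀ f
      {r | (∀ h, r = Sum.inr h → D₀ {x | f x ≠ ev h x} ≤ ENNReal.ofReal ε) ∧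
           (D₁ = D₀ → r.accepts = true)}

/-! ## Randomized programs with sample access and black-box access to a TDS learner -/

/-- The charged operations of a program. -/
inductive Op
  | step | flip | train | test | call

/-- Randomized programs with result in `α`.  A program can return, perform one elementary step, flip
a coin of given bias, draw a labeled training example, draw an unlabeled test example, and run the
TDS learner on samples `S`, `U` of its choice (each run uses fresh internal randomness).  The program
has no other access to the distributions, to the target concept or to the learner. -/
inductive Prog (X : Type u) (H : Type v) (m n : ℕ) (α : Type w) : Type (max u v w)
  | ret (a : α) : Prog X H m n α
  | step (p : Prog X H m n α) : Prog X H m n α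
  | flip (q : I) (k : Bool → Prog X H m n α) : Prog X H m n α
  | train (k : X × Bool → Prog X H m n α) : Prog X H m n α
  | test (k : X → Prog X H m n α) : Prog X H m n α
  | call (S : Fin m → X × Bool) (U : Fin n → X) (k : Answer H → Prog X H m n α) : Prog X H m n α

namespace Prog

variable {X : Type u} {H : Type v} {m n : ℕ} {α : Type w} {β : Type z}

/-- Sequential composition. -/
def bind : Prog X H m n α → (α → Prog X H m n β) → Prog X H m n β
  | ret a, g => g a
  | step p, g => step (p.bind g)
  | flip q k, g => flip q fun b => (k b).bind g
  | train k, g => train fun s => (k s).bind g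
  | test k, g => test fun x => (k x).bind g
  | call S U k, g => call S U fun r => (k r).bind g

/-- `c` elementary steps, then `p`. -/
def steps : ℕ → Prog X H m n α → Prog X H m n α
  | 0, p => p
  | c + 1, p => step (steps c p)

/-- The worst case, over all outcomes of the random choices, of the total charge of a run, when
operation `o` is charged `c o`. -/
def cost (c : Op → ℕ) : Prog X H m n α → ℕ∞
  | ret _ => 0
  | step p => c .step + cost c p
  | flip _ k => c .flip + ⨆ b, cost c (k b)
  | train k => c .train + ⨆ s, cost c (k s)
  | test k => c .test + ⨆ x, cost c (k x)
  | call _ _ k => c .call + ⨆ r, cost c (k r)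

/-- Number of runs of the TDS learner. -/
def numCalls (p : Prog X H m n α) : ℕ∞ :=
  p.cost fun | .call => 1 | _ => 0

/-- Number of examples drawn from the training and the test distribution. -/
def numSamples (p : Prog X H m n α) : ℕ∞ :=
  p.cost fun | .train => 1 | .test => 1 | _ => 0

/-- Running time, when one run of the TDS learner takes time `TA` and every other operation takes
unit time. -/
def time (TA : ℕ) (p : Prog X H m n α) : ℕ∞ :=
  p.cost fun | .call => TA | _ => 1

/-- Expectation of `F` at the result of the program, when training examples are drawn from `D₁` and
labeled by `f`, test examples are drawn from `D₀` and the TDS learner is `A`. -/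
def expect [MeasurableSpace X] [MeasurableSpace H] (A : Learner X H m n) (D₁ D₀ : Measure X)
    (f : X → Bool) : Prog X H m n α → (α → ℝ≥0∞) → ℝ≥0∞
  | ret a, F => F a
  | step p, F => expect A D₁ D₀ f p F
  | flip q k, F => ENNReal.ofReal (q : ℝ) * expect A D₁ D₀ f (k true) F +
      ENNReal.ofReal (1 - (q : ℝ)) * expect A D₁ D₀ f (k false) F
  | train k, F => ∫⁻ x, expect A D₁ D₀ f (k (x, f x)) F ∂D₁
  | test k, F => ∫⁻ x, expect A D₁ D₀ f (k x) F ∂D₀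
  | call S U k, F => ∫⁻ r, expect A D₁ D₀ f (k r) F ∂(A (S, U))

/-- Probability that the result of the program lies in `E`. -/
def prob [MeasurableSpace X] [MeasurableSpace H] (A : Learner X H m n) (D₁ D₀ : Measure X)
    (f : X → Bool) (p : Prog X H m n α) (E : Set α) : ℝ≥0∞ :=
  p.expect A D₁ D₀ f (E.indicator 1)

/-- Run `p 0, p 1, …, p (k - 1)` in this order and collect the results. -/
def tuple : (k : ℕ) → (Fin k → Prog X H m n α) → Prog X H m n (Fin k → α)
  | 0, _ => ret Fin.elim0
  | k + 1, p => step <| (p 0).bind fun a => (tuple k fun j => p j.succ).bind fun v =>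
      ret (Fin.cons a v : Fin (k + 1) → α)

/-- The empirical mean of `k` independent runs of `p`. -/
def average (k : ℕ) (p : Prog X H m n ℝ) : Prog X H m n ℝ :=
  (tuple k fun _ => p).bind fun v => steps (k + 1) <| ret ((∑ j, v j) / k)

/-- The `{0,1}`-valued indicator of the outcome `true`. -/
def ind (b : Bool) : ℝ := if b then 1 else 0

/-- A `(γ, δ)`-estimate of the probability that `p` returns `true`: the empirical frequency in
`⌈log (2 / δ) / (2 γ ^ 2)⌉` independent runs. -/
def estimate (γ δ : ℝ) (p : Prog X H m n Bool) : Prog X H m n ℝ :=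
  average ⌈Real.log (2 / δ) / (2 * γ ^ 2)⌉₊ (p.bind fun b => step <| ret (ind b))

/-- Draw one labeled training example. -/
def drawTrain : Prog X H m n (X × Bool) := train ret

/-- Draw one unlabeled test example. -/
def drawTest : Prog X H m n X := test ret

/-- Run the TDS learner; writing down its input takes `m + n` steps. -/
def runA (S : Fin m → X × Bool) (U : Fin n → X) : Prog X H m n (Answer H) :=
  steps (m + n) <| call S U ret

end Prog

open Prog

/-- `L` is a program whose result is a selector together with a hypothesis, both possibly randomized:
the result is a map that sends `x` to a program that returns the pair (value of the hypothesis at `x`,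
value of the selector at `x`).  `L` is a PQ learner for `C` with error `ε`, rejection rate `η` and
probability of failure `δ` if for all `D₁`, `D₀` and `f ∈ C`, with probability at least `1 - δ` over
the run of `L`, the probability for `x ∼ D₀` (and the randomness of the evaluation) of a selected and
misclassified point is at most `ε`, and the probability for `x ∼ D₁` of a rejected point is at
most `η`. -/
def IsPQLearner {X : Type u} {H : Type v} [MeasurableSpace X] [MeasurableSpace H] {m n : ℕ}
    (A : Learner X H m n) (C : Set (X → Bool)) (ε η δ : ℝ)
    (L : Prog X H m n (X → Prog X H m n (Bool × Bool))) : Prop :=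
  ∀ (D₁ D₀ : Measure X) [IsProbabilityMeasure D₁] [IsProbabilityMeasure D₀], ∀ f ∈ C,
    ENNReal.ofReal (1 - δ) ≤ L.prob A D₁ D₀ f
      {o | ∫⁻ x, (o x).prob A D₁ D₀ f {hg | f x ≠ hg.1 ∧ hg.2 = true} ∂D₀ ≤ ENNReal.ofReal ε ∧
           ∫⁻ x, (o x).prob A D₁ D₀ f {hg | hg.2 = false} ∂D₁ ≤ ENNReal.ofReal η}

/-! ## Weak distinguishers -/

section Algorithm

variable {X : Type u} {H : Type v} {m n : ℕ}

/-- A one-sample weak distinguisher: a training set, a tuple of `n` unlabeled examples and a slot. -/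
structure WeakDist (X : Type u) (m n : ℕ) where
  trainSet : Fin m → X × Bool
  context : Fin n → X
  slot : Fin n

/-- Evaluation of a weak distinguisher at `x`: put `x` in the slot (overwriting the placeholder there),
run the TDS learner, and return whether it accepts. -/
def WeakDist.run (d : WeakDist X m n) (x : X) : Prog X H m n Bool :=
  (runA d.trainSet (Function.update d.context d.slot x)).bind fun r => step <| ret r.accepts

/-- First phase: search for a training set that witnesses a gap of the acceptance probabilities, in at
most `k` attempts with `r` trials each. -/
def findTrainSet (draw₁ : Prog X H m n (X × Bool)) (draw₀ : Prog X H m n X) (r : ℕ) :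
    ℕ → Prog X H m n (Option (Fin m → X × Bool))
  | 0 => ret none
  | k + 1 => step <| (tuple m fun _ => draw₁).bind fun S =>
      (average r <|
        (tuple n fun _ => draw₁.bind fun s => ret s.1).bind fun U₁ =>
        (tuple n fun _ => draw₀).bind fun U₀ =>
        (runA S U₁).bind fun r₁ =>
        (runA S U₀).bind fun r₀ =>
        step <| ret (ind r₁.accepts - ind r₀.accepts)).bind fun p =>
      if 0.004 ≤ p then ret (some S) else findTrainSet draw₁ draw₀ r k

/-- Second phase, for one slot `i`: at most `k` attempts to find a weak distinguisher whose empirical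
advantage in `l` trials is at least `1 / (5000 n)`.  The entries of the context before the slot come
from the test distribution and those after it from the training distribution. -/
def searchSlot (draw₁ : Prog X H m n (X × Bool)) (draw₀ : Prog X H m n X) (l : ℕ)
    (S : Fin m → X × Bool) (i : Fin n) : ℕ → Prog X H m n (Option (WeakDist X m n))
  | 0 => ret none
  | k + 1 => step <|
      (tuple n fun j => if j < i then draw₀ else draw₁.bind fun s => ret s.1).bind fun c =>
      (average l <|
        draw₁.bind fun s =>
        draw₀.bind fun x =>
        ((⟨S, c, i⟩ : WeakDist X m n).run s.1).bind fun b₁ =>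
        ((⟨S, c, i⟩ : WeakDist X m n).run x).bind fun b₀ =>
        step <| ret (ind b₁ - ind b₀)).bind fun p =>
      if 1 / (5000 * (n : ℝ)) ≤ p then ret (some ⟨S, c, i⟩) else searchSlot draw₁ draw₀ l S i k

/-- Second phase: the slots are tried one after the other. -/
def searchSlots (draw₁ : Prog X H m n (X × Bool)) (draw₀ : Prog X H m n X) (l k : ℕ)
    (S : Fin m → X × Bool) : List (Fin n) → Prog X H m n (Option (WeakDist X m n))
  | [] => ret none
  | i :: is => step <| (searchSlot draw₁ draw₀ l S i k).bind fun
      | some d => ret (some d)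
      | none => searchSlots draw₁ draw₀ l k S is

/-- `GetWeakDistinguisher` with constants `c`, `c₁` and failure probability `δ`, for the training
distribution sampled by `draw₁` and the test distribution sampled by `draw₀`; `none` is FAIL. -/
def getWeakDistinguisher (c c₁ : ℝ) (draw₁ : Prog X H m n (X × Bool)) (draw₀ : Prog X H m n X)
    (δ : ℝ) : Prog X H m n (Option (WeakDist X m n)) :=
  (findTrainSet draw₁ draw₀ ⌈c * Real.log (1 / δ)⌉₊ ⌈c₁ * Real.log (1 / δ)⌉₊).bind fun
    | none => ret none
    | some S => searchSlots draw₁ draw₀ ⌈c * (n : ℝ) ^ 2 * Real.log (n / δ)⌉₊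
        ⌈c₁ * n * Real.log (1 / δ)⌉₊ S (List.finRange n)

/-! ## Branching programs -/

/-- The success probability of the coin `ξ` in `Balance`: `1 / (1 + 2 |1/2 - q|)`. -/
def balanceBias (q : ℝ) : I :=
  ⟨1 / (1 + 2 * |1 / 2 - q|), by positivity,
    by rw [div_le_one (by positivity)]; linarith [abs_nonneg (1 / 2 - q)]⟩

/-- `Balance (q, w)`: with `b` the element of `{0,1}` closest to `q`, return `w` if `ξ = 1` and `1 - b`
if `ξ = 0`. -/
def balance (q : ℝ) (w : Bool) : Prog X H m n Bool :=
  flip (balanceBias q) fun ξ => steps 4 <| ret (if ξ then w else decide (q < 1 / 2))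

/-- A node of a branching program: its label; the hypotheses whose majority vote is the hypothesis of
the node; and its routing function, which is either `⊥` (`none`: the node is a leaf) or is given by a
weak distinguisher and the parameter `q` for `Balance`. -/
structure Node (X : Type u) (H : Type v) (m n : ℕ) where
  label : Bool
  hyps : List H
  next : Option (WeakDist X m n × ℝ)

/-- The nodes `(i, t)` of a branching program. -/
abbrev Branching (X : Type u) (H : Type v) (m n : ℕ) := ℕ → ℕ → Node X H m n

/-- Replace the node `(i, t)`. -/
def Branching.set (P : Branching X H m n) (i t : ℕ) (N : Node X H m n) : Branching X H m n :=
  Function.update P i (Function.update (P i) t N)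

/-- Route `x` through `P` from the node `N = (i, t)` until a leaf is reached, but for at most `k`
edges. -/
def walk (P : Branching X H m n) (x : X) : ℕ → ℕ × ℕ → Prog X H m n (ℕ × ℕ)
  | 0, N => ret N
  | k + 1, N => step <|
      match (P N.1 N.2).next with
      | none => ret N
      | some (d, q) => (d.run x).bind fun w => (balance q w).bind fun b =>
          walk P x k (if b then N.1 + 1 else N.1, N.2 + 1)

/-- `V_{i,t}(x)`: does `x` reach the node `(i, t)` from the root `(1, 1)`? -/
def reaches (P : Branching X H m n) (i t : ℕ) (x : X) : Prog X H m n Bool :=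
  (walk P x (t - 1) (1, 1)).bind fun N => steps 2 <| ret (decide (N = (i, t)))

/-- Rejection sampling: draw until the test `V` succeeds, but after `k` failures return the next draw
without testing it. -/
def rejectionSample {α : Type u} (draw : Prog X H m n α) (V : α → Prog X H m n Bool) :
    ℕ → Prog X H m n α
  | 0 => draw
  | k + 1 => step <| draw.bind fun a => (V a).bind fun b =>
      if b then ret a else rejectionSample draw V k

/-- The majority vote, at `x`, of a list of hypotheses (ties, and the empty list, give `+1`). -/
def majority (ev : H → X → Bool) (hs : List H) (x : X) : Bool :=
  decide (hs.length ≤ 2 * hs.countP fun h => ev h x)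

/-- The hypotheses in a tuple of answers. -/
def acceptedHyps {r : ℕ} (a : Fin r → Answer H) : List H :=
  (List.ofFn a).filterMap Sum.getRight?

/-! ## The boosting algorithm

`M` is the total sample complexity `m + n` of the TDS learner and `c` a large constant. -/

/-- The number of levels, `T = c M² log (1/ε)` (rounded up). -/
def numLevels (c : ℝ) (M : ℕ) (ε : ℝ) : ℕ := ⌈c * (M : ℝ) ^ 2 * Real.log (1 / ε)⌉₊

/-- `δ' = δ / (c T¹⁰)`. -/
def subDelta (c : ℝ) (T : ℕ) (δ : ℝ) : ℝ := δ / (c * (T : ℝ) ^ 10)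

/-- `r = c log (T / (ε δ))` (rounded up). -/
def numRuns (c : ℝ) (T : ℕ) (ε δ : ℝ) : ℕ := ⌈c * Real.log (T / (ε * δ))⌉₊

/-- `p_min = 3 ε / (4 T (T + 1))`. -/
def pMin (T : ℕ) (ε : ℝ) : ℝ := 3 * ε / (4 * T * (T + 1))

/-- `γ₁ = ε / (4 T (T + 1))`. -/
def gammaOne (T : ℕ) (ε : ℝ) : ℝ := ε / (4 * T * (T + 1))

/-- `γ₂ = 1 / (c M)`. -/
def gammaTwo (c : ℝ) (M : ℕ) : ℝ := 1 / (c * M)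

/-- The number of tested draws in rejection sampling: `r / p_min` (rounded up). -/
def numAttempts (c : ℝ) (T : ℕ) (ε δ : ℝ) : ℕ := ⌈numRuns c T ε δ / pMin T ε⌉₊

/-- Sampling from the labeled training distribution conditioned on reaching `(i, t)`. -/
def sampleTrain (k : ℕ) (P : Branching X H m n) (i t : ℕ) : Prog X H m n (X × Bool) :=
  rejectionSample drawTrain (fun s => reaches P i t s.1) k

/-- Sampling from the test distribution conditioned on reaching `(i, t)`. -/
def sampleTest (k : ℕ) (P : Branching X H m n) (i t : ℕ) : Prog X H m n X :=
  rejectionSample drawTest (fun x => reaches P i t x) k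

/-- Run the TDS learner on fresh examples from `draw₁` and `draw₀`. -/
def runOn (draw₁ : Prog X H m n (X × Bool)) (draw₀ : Prog X H m n X) : Prog X H m n (Answer H) :=
  (tuple m fun _ => draw₁).bind fun S => (tuple n fun _ => draw₀).bind fun U => runA S U

/-- A fair mixture of the two distributions. -/
def sampleMixture (draw₁ : Prog X H m n (X × Bool)) (draw₀ : Prog X H m n X) : Prog X H m n X :=
  flip ⟨1 / 2, by norm_num, by norm_num⟩ fun b =>
    if b then draw₁.bind fun s => ret s.1 else draw₀

/-- What the algorithm does at the node `(i, t)`. -/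
def visit (c c₁ ε δ : ℝ) (T i t : ℕ) (P : Branching X H m n) :
    Prog X H m n (Branching X H m n) :=
  let δ₁ := subDelta c T δ
  let r := numRuns c T ε δ
  let G₁ := sampleTrain (numAttempts c T ε δ) P i t
  let G₀ := sampleTest (numAttempts c T ε δ) P i t
  (estimate (gammaOne T ε) δ₁ (drawTrain.bind fun s => reaches P i t s.1)).bind fun p₁ =>
  (estimate (gammaOne T ε) δ₁ (drawTest.bind fun x => reaches P i t x)).bind fun p₀ =>
  steps 3 <|
  if (p₁ < pMin T ε ∨ p₀ < pMin T ε) ∧ t < T then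
    step <| ret (P.set i t { P i t with label := !decide (p₁ < pMin T ε) })
  else
    (estimate 0.01 δ₁ ((runOn G₁ G₀).bind fun a => ret a.accepts)).bind fun a =>
    step <|
    if 0.95 ≤ a then
      (tuple r fun _ => runOn G₁ G₀).bind fun answers =>
      steps (r + 1) <| ret (P.set i t { P i t with label := true, hyps := acceptedHyps answers })
    else step <| if t < T then
      (getWeakDistinguisher c c₁ G₁ G₀ δ₁).bind fun
        | none => ret P
        | some d =>
          (estimate (gammaTwo c (m + n)) δ₁ ((sampleMixture G₁ G₀).bind fun x => d.run x)).bind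
            fun q => step <| ret (P.set i t { P i t with next := some (d, q) })
    else ret P

/-- Visit the nodes of a list one after the other. -/
def visitAll (c c₁ ε δ : ℝ) (T : ℕ) :
    List (ℕ × ℕ) → Branching X H m n → Prog X H m n (Branching X H m n)
  | [], P => ret P
  | N :: Ns, P => step <| (visit c c₁ ε δ T N.1 N.2 P).bind fun Q => visitAll c c₁ ε δ T Ns Q

/-- The nodes `(i, t)`, `1 ≤ i ≤ t ≤ T`, in the order `t = 1, …, T`, `i = 1, …, t`. -/
def nodes (T : ℕ) : List (ℕ × ℕ) :=
  (List.range T).flatMap fun t => (List.range (t + 1)).map fun i => (i + 1, t + 1)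

/-- The initial branching program: every node is a leaf with constant hypothesis `+1`, and the node
`(i, T)` has label `1` if and only if `i ≥ T / 2`. -/
def initial (T : ℕ) : Branching X H m n := fun i t =>
  { label := decide (t = T ∧ T ≤ 2 * i), hyps := [], next := none }

/-- Evaluation of the hypothesis and the selector of a branching program at `x`: route `x` from the
root `(1, 1)` to a leaf, and return the value of the hypothesis and the label of that leaf. -/
def evaluate (ev : H → X → Bool) (T : ℕ) (P : Branching X H m n) (x : X) :
    Prog X H m n (Bool × Bool) :=
  (walk P x T (1, 1)).bind fun N =>
    steps ((P N.1 N.2).hyps.length + 1) <|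
      ret (majority ev (P N.1 N.2).hyps x, (P N.1 N.2).label)

/-- `TDSboost`, with constants `c`, `c₁` (the latter is used by `getWeakDistinguisher` only). -/
def boost (c c₁ : ℝ) (ev : H → X → Bool) (ε δ : ℝ) :
    Prog X H m n (X → Prog X H m n (Bool × Bool)) :=
  let T := numLevels c (m + n) ε
  steps (T * (T + 1)) <| (visitAll c c₁ ε δ T (nodes T) (initial T)).bind fun P =>
    ret (evaluate ev T P)

end Algorithm

/-- `k ≤ P (M, 1/ε, log (1/δ))` for the polynomial `P`, times `s`. -/
def PolyBounded (P : MvPolynomial (Fin 3) ℝ) (M : ℕ) (ε δ : ℝ) (s : ℕ) (k : ℕ∞) : Prop :=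
  ∃ N : ℕ, k ≤ N ∧ (N : ℝ) ≤ s * MvPolynomial.eval ![(M : ℝ), 1 / ε, Real.log (1 / δ)] P

end TDS

end

/-!
Every node of the branching program is visited once, and with high probability the visit leaves a
node before the last level in one of three states (`GoodNode`, `whp_visit`, `whp_visitAll_nodes`),
where `G₁` and `G₀` denote the distributions `D₁` and `D₀` conditioned on reaching the node.

* Few points of one of `D₁`, `D₀` reach the node: it is a leaf, which rejects in the case of `D₁`
  and selects in the case of `D₀`, and so does harm only on a mass of at most `ε / (T (T + 1))`.
  These masses add up to at most `ε` over all nodes.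
* The learner accepts often on `G₁`, `G₀`. By soundness few of the accepting runs return a
  hypothesis of error more than `ε` on `G₀`, so that a point on which the majority vote errs is one
  on which a constant fraction of all runs err with a good hypothesis. By Markov's inequality the
  majority vote has error at most `4 ε` on `G₀` (`majority_error_le`, `whp_majority`).
* The learner rejects noticeably often on `G₁`, `G₀`. By completeness it nearly always accepts when
  the test examples come from `G₁` as well, so its answer distinguishes `n` examples from `G₁` from
  `n` examples from `G₀`. The hybrid argument (`exists_slot`) replaces the test examples one by one,
  and yields a randomized test of a single point that accepts points from `G₁` more often than
  points from `G₀`, by a multiple of `1 / n`. It is found by sampling (`whp_getWeakDistinguisher`).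
  After balancing (`balance_drift`), it routes points from `G₁` up and points from `G₀` down with
  probability at least `1 / 2 + γ`, where `γ` is a constant multiple of `1 / (m + n)` (`whp_drift`).

So a random point of `D₁` performs a walk with upward drift, and one of `D₀` a walk with downward
drift, until they are absorbed at a leaf. The masses of the nodes, weighted with
`(1 ∓ 2 γ) ^ j (1 ± 2 γ) ^ (k - j)`, decrease by a factor `1 - 4 γ ^ 2` per level. Hence the
walks rarely end in the wrong half of the last level (`sum_lower_le`, `sum_upper_le`): the number of levels is at least
`γ⁻² log (1 / ε)`. A node of the last level where the learner does not accept often is a leaf that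
rejects in the lower half and selects in the upper half, which bounds the rejected part of `D₁`
(`lintegral_rejected_le`) and the misclassified selected part of `D₀` (`lintegral_misclassified_le`)
by multiples of `ε`. With the constant `100`, nothing is to be shown if `ε > 1 / 100`
(`isPQLearner_boost`).

The algorithm conditions on a node by rejection sampling with a bounded number of attempts, whose
law `rejectionLaw` differs from the conditional distribution by an explicit error term
(`integral_rejectionLaw_sub`). All statements about a visit are therefore formulated with integrals
over `D₁` and `D₀` against the probability `posProb` of reaching the node, and never divide by the
mass of the node.

The time is at most the running time of the learner times the total number of operations of all
kinds, which also bounds the numbers of calls and of examples. It is bounded by recursion over the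
program (`OpsLe`). The natural-number bound so obtained consists of sums and products of
polynomially bounded quantities, a closed class (`PolyDominated`, `exists_opsLe_boost`).
-/

noncomputable section

namespace TDS

/-! ### Expectations of programs -/

namespace Prog

section Expectation

variable {X : Type u} {H : Type v} [MeasurableSpace X] [MeasurableSpace H] {m n : ℕ}
  {α : Type w} {β : Type z}
  (A : Learner X H m n) (D₁ D₀ : Measure X) (f : X → Bool)

theorem expect_bind (p : Prog X H m n α) (g : α → Prog X H m n β) (F : β → ℝ≥0∞) :
    (p.bind g).expect A D₁ D₀ f F = p.expect A D₁ D₀ f fun a => (g a).expect A D₁ D₀ f F := by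
  induction p with
  | ret a => rfl
  | step p ih => simpa [Prog.bind, expect] using ih
  | flip q k ih => simp only [Prog.bind, expect, ih]
  | train k ih => simp only [Prog.bind, expect, ih]
  | test k ih => simp only [Prog.bind, expect, ih]
  | call S U k ih => simp only [Prog.bind, expect, ih]

@[simp]
theorem expect_steps (k : ℕ) (p : Prog X H m n α) (F : α → ℝ≥0∞) :
    (steps k p).expect A D₁ D₀ f F = p.expect A D₁ D₀ f F := by
  induction k with
  | zero => rfl
  | succ k ih => simpa [steps, expect] using ih

theorem expect_mono (p : Prog X H m n α) {F G : α → ℝ≥0∞} (h : ∀ a, F a ≤ G a) :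
    p.expect A D₁ D₀ f F ≤ p.expect A D₁ D₀ f G := by
  induction p with
  | ret a => exact h a
  | step p ih => exact ih
  | flip q k ih => exact add_le_add (mul_le_mul_right (ih _) _) (mul_le_mul_right (ih _) _)
  | train k ih => exact lintegral_mono fun x => ih _
  | test k ih => exact lintegral_mono fun x => ih _
  | call S U k ih => exact lintegral_mono fun x => ih _

theorem ofReal_add_ofReal_symm (q : I) :
    ENNReal.ofReal (q : ℝ) + ENNReal.ofReal (1 - (q : ℝ)) = 1 := by
  rw [← ENNReal.ofReal_add q.2.1 (by linarith [q.2.2])]; simp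

theorem expect_const [IsMarkovKernel A] [IsProbabilityMeasure D₁] [IsProbabilityMeasure D₀]
    (p : Prog X H m n α) (c : ℝ≥0∞) : p.expect A D₁ D₀ f (fun _ => c) = c := by
  induction p with
  | ret a => rfl
  | step p ih => exact ih
  | flip q k ih => simp only [expect, ih, ← add_mul, ofReal_add_ofReal_symm, one_mul]
  | train k ih => simp [expect, ih]
  | test k ih => simp [expect, ih]
  | call S U k ih => simp [expect, ih]

theorem expect_const_mul (p : Prog X H m n α) {c : ℝ≥0∞} (hc : c ≠ ∞) (F : α → ℝ≥0∞) :
    p.expect A D₁ D₀ f (fun a => c * F a) = c * p.expect A D₁ D₀ f F := by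
  induction p with
  | ret a => rfl
  | step p ih => exact ih
  | flip q k ih => simp only [expect, ih]; ring
  | train k ih => simp only [expect, ih, lintegral_const_mul' c _ hc]
  | test k ih => simp only [expect, ih, lintegral_const_mul' c _ hc]
  | call S U k ih => simp only [expect, ih, lintegral_const_mul' c _ hc]

/-! ### Events of high probability -/

/-- The result of `p` lies in `E` with probability at least `1 - a`.  As `prob` is built from lower
integrals, this makes sense, and composes, for events `E` that need not be measurable. -/
def Whp (p : Prog X H m n α) (E : Set α) (a : ℝ) : Prop :=
  ENNReal.ofReal (1 - a) ≤ p.prob A D₁ D₀ f E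

variable {A D₁ D₀ f}

theorem Whp.ret {a : α} {E : Set α} (h : a ∈ E) {b : ℝ} (hb : 0 ≤ b) :
    Whp A D₁ D₀ f (ret a : Prog X H m n α) E b := by
  simp [Whp, prob, expect, h, hb]

theorem whp_step_iff {p : Prog X H m n α} {E : Set α} {b : ℝ} :
    Whp A D₁ D₀ f (step p) E b ↔ Whp A D₁ D₀ f p E b := Iff.rfl

theorem whp_steps_iff {k : ℕ} {p : Prog X H m n α} {E : Set α} {b : ℝ} :
    Whp A D₁ D₀ f (steps k p) E b ↔ Whp A D₁ D₀ f p E b := by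
  simp [Whp, prob]

theorem Whp.mono {p : Prog X H m n α} {E E' : Set α} {a a' : ℝ} (h : Whp A D₁ D₀ f p E a)
    (hE : E ⊆ E') (ha : a ≤ a') : Whp A D₁ D₀ f p E' a' :=
  (ENNReal.ofReal_le_ofReal (by linarith)).trans
    (h.trans (expect_mono _ _ _ _ _ fun x =>
      Set.indicator_le_indicator_of_subset hE (fun _ => zero_le) x))

theorem whp_of_one_le {p : Prog X H m n α} {E : Set α} {a : ℝ} (h : 1 ≤ a) :
    Whp A D₁ D₀ f p E a := by
  simp [Whp, ENNReal.ofReal_of_nonpos (by linarith : 1 - a ≤ 0)]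

/-- The union bound for a sequential composition. -/
theorem Whp.bind {p : Prog X H m n α} {g : α → Prog X H m n β} {E : Set α} {E' : Set β} {a b : ℝ}
    (hp : Whp A D₁ D₀ f p E a) (hg : ∀ x ∈ E, Whp A D₁ D₀ f (g x) E' b) (ha : 0 ≤ a) (hb : 0 ≤ b) :
    Whp A D₁ D₀ f (p.bind g) E' (a + b) := by
  by_cases ha1 : 1 ≤ a
  · exact whp_of_one_le (by linarith)
  by_cases hb1 : 1 ≤ b
  · exact whp_of_one_le (by linarith)
  push Not at ha1 hb1
  unfold Whp prob at *
  rw [expect_bind]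
  calc ENNReal.ofReal (1 - (a + b)) ≤ ENNReal.ofReal ((1 - b) * (1 - a)) :=
        ENNReal.ofReal_le_ofReal (by nlinarith)
    _ = ENNReal.ofReal (1 - b) * ENNReal.ofReal (1 - a) := ENNReal.ofReal_mul (by linarith)
    _ ≤ ENNReal.ofReal (1 - b) * p.expect A D₁ D₀ f (E.indicator 1) := by gcongr
    _ = p.expect A D₁ D₀ f fun x => ENNReal.ofReal (1 - b) * E.indicator 1 x :=
        (expect_const_mul _ _ _ _ _ ENNReal.ofReal_ne_top _).symm
    _ ≤ _ := expect_mono _ _ _ _ _ fun x => by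
        by_cases hx : x ∈ E
        · simpa [hx] using hg x hx
        · simp [hx]

variable [IsMarkovKernel A] [IsProbabilityMeasure D₁] [IsProbabilityMeasure D₀]

theorem prob_le_one (p : Prog X H m n α) (E : Set α) : p.prob A D₁ D₀ f E ≤ 1 :=
  (expect_mono _ _ _ _ _ fun x => Set.indicator_le_self' (by simp) x).trans
    (expect_const A D₁ D₀ f p 1).le

theorem Whp.of_forall {p : Prog X H m n α} {E : Set α} (h : ∀ a, a ∈ E) {b : ℝ} (hb : 0 ≤ b) :
    Whp A D₁ D₀ f p E b := by
  have : E = Set.univ := Set.eq_univ_of_forall h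
  subst this
  have := expect_const A D₁ D₀ f p 1
  simp only [Whp, prob, Set.indicator_univ]
  refine le_trans ?_ this.ge
  simp [hb]

end Expectation

/-! ### Laws of programs -/

section Law

variable {X : Type u} {H : Type v} [MeasurableSpace X] [MeasurableSpace H] {m n : ℕ}
  {α : Type w} {β : Type z} [MeasurableSpace α] [MeasurableSpace β]
  (A : Learner X H m n) (D₁ D₀ : Measure X) (f : X → Bool)

/-- The result of `p` has law `μ`: the expectation of every measurable function is its
`μ`-integral. -/
def HasDist (p : Prog X H m n α) (μ : Measure α) : Prop :=
  ∀ F : α → ℝ≥0∞, Measurable F → p.expect A D₁ D₀ f F = ∫⁻ a, F a ∂μ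

variable {A D₁ D₀ f}

theorem HasDist.prob_eq {p : Prog X H m n α} {μ : Measure α} (h : HasDist A D₁ D₀ f p μ)
    {E : Set α} (hE : MeasurableSet E) : p.prob A D₁ D₀ f E = μ E := by
  rw [prob, h _ (measurable_one.indicator hE), lintegral_indicator_one hE]

theorem HasDist.whp {p : Prog X H m n α} {μ : Measure α} [IsProbabilityMeasure μ]
    (h : HasDist A D₁ D₀ f p μ)
    {E E' : Set α} (hE : MeasurableSet E) {a : ℝ} (ha : μ.real Eᶜ ≤ a) (hEE' : E ⊆ E') :
    Whp A D₁ D₀ f p E' a := by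
  refine Whp.mono (E := E) ?_ hEE' le_rfl
  rw [Whp, h.prob_eq hE, ← ENNReal.ofReal_toReal (measure_ne_top μ E)]
  apply ENNReal.ofReal_le_ofReal
  have := probReal_compl_eq_one_sub (μ := μ) hE
  rw [measureReal_def μ E] at this
  linarith

theorem HasDist.bind {p : Prog X H m n α} {μ : Measure α} (hp : HasDist A D₁ D₀ f p μ)
    {q : α → Prog X H m n β} {κ : Kernel α β} (hq : ∀ a, HasDist A D₁ D₀ f (q a) (κ a)) :
    HasDist A D₁ D₀ f (p.bind q) (μ.bind κ) := fun F hF => by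
  rw [expect_bind, Measure.lintegral_bind κ.measurable.aemeasurable hF.aemeasurable,
    ← hp _ hF.lintegral_kernel]
  congr 1
  funext a
  exact hq a F hF

theorem HasDist.bind_map {p : Prog X H m n α} {μ : Measure α} (hp : HasDist A D₁ D₀ f p μ)
    {g : α → β} (hg : Measurable g) {q : α → Prog X H m n β}
    (hq : ∀ a F, (q a).expect A D₁ D₀ f F = F (g a)) :
    HasDist A D₁ D₀ f (p.bind q) (μ.map g) := fun F hF => by
  rw [expect_bind, lintegral_map hF hg, show ∫⁻ a, F (g a) ∂μ = _ from (hp _ (hF.comp hg)).symm]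
  simp only [hq]
  rfl

theorem hasDist_drawTrain (hf : Measurable f) :
    HasDist A D₁ D₀ f (drawTrain : Prog X H m n (X × Bool)) (labeled D₁ f) := fun F hF => by
  rw [labeled, lintegral_map hF (by fun_prop)]; rfl

theorem hasDist_drawTest : HasDist A D₁ D₀ f (drawTest : Prog X H m n X) D₀ := fun _ _ => rfl

theorem hasDist_runA (S : Fin m → X × Bool) (U : Fin n → X) :
    HasDist A D₁ D₀ f (runA S U) (A (S, U)) := fun F hF => by
  simp [runA, expect]

theorem hasDist_tuple {k : ℕ} {p : Fin k → Prog X H m n α} {μ : Fin k → Measure α}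
    [∀ j, IsProbabilityMeasure (μ j)] (h : ∀ j, HasDist A D₁ D₀ f (p j) (μ j)) :
    HasDist A D₁ D₀ f (tuple k p) (Measure.pi μ) := by
  induction k with
  | zero =>
    intro F hF
    rw [Measure.pi_of_empty μ Fin.elim0, lintegral_dirac' _ hF]; rfl
  | succ k ih =>
    intro F hF
    have hmp := (measurePreserving_piFinSuccAbove μ 0).symm
    have hF' : Measurable fun z : α × (Fin k → α) => F (Fin.cons z.1 z.2 : Fin (k+1) → α) := by
      have := hF.comp (MeasurableEquiv.piFinSuccAbove (fun _ => α) 0).symm.measurable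
      simpa [Function.comp_def, MeasurableEquiv.piFinSuccAbove, Fin.consEquiv] using this
    have : ∫⁻ v, F v ∂Measure.pi μ =
        ∫⁻ z, F (Fin.cons z.1 z.2 : Fin (k+1) → α) ∂((μ 0).prod (Measure.pi fun j => μ j.succ)) := by
      rw [← hmp.map_eq, lintegral_map hF (MeasurableEquiv.measurable _)]
      simp [MeasurableEquiv.piFinSuccAbove, Fin.consEquiv]
    rw [this, lintegral_prod _ hF'.aemeasurable, ← h 0 _ hF'.lintegral_prod_right']
    simp only [tuple, expect, expect_bind]
    congr 1
    funext a
    exact ih (fun j => h j.succ) _ (hF'.comp measurable_prodMk_left)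

end Law

end Prog

theorem isProbabilityMeasure_labeled {X : Type u} [MeasurableSpace X] {D : Measure X}
    [IsProbabilityMeasure D] {f : X → Bool} (hf : Measurable f) :
    IsProbabilityMeasure (labeled D f) :=
  Measure.isProbabilityMeasure_map (by fun_prop)

/-! ### Concentration -/

section Concentration

variable {α : Type w} [MeasurableSpace α] {μ : Measure α} [IsProbabilityMeasure μ]

theorem hoeffding_upper {g : α → ℝ} (hg : Measurable g) {a b : ℝ} (hab : a < b)
    (hgab : ∀ x, g x ∈ Set.Icc a b) (k : ℕ) {s : ℝ} (hs : 0 ≤ s) :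
    (Measure.pi fun _ : Fin k => μ).real {v | k * s ≤ ∑ j, (g (v j) - ∫ x, g x ∂μ)} ≤
      Real.exp (-(2 * k * s ^ 2 / (b - a) ^ 2)) := by
  have hind : iIndepFun (fun (j : Fin k) (v : Fin k → α) => g (v j) - ∫ x, g x ∂μ)
      (Measure.pi fun _ : Fin k => μ) :=
    iIndepFun_pi (X := fun _ x => g x - ∫ x, g x ∂μ) (μ := fun _ : Fin k => μ)
      fun _ => (hg.sub_const _).aemeasurable
  have hsub : ∀ j ∈ (Finset.univ : Finset (Fin k)),
      HasSubgaussianMGF (fun v : Fin k → α => g (v j) - ∫ x, g x ∂μ) ((‖b - a‖₊ / 2) ^ 2)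
        (Measure.pi fun _ : Fin k => μ) := by
    intro j _
    have h := hasSubgaussianMGF_of_mem_Icc (μ := Measure.pi fun _ : Fin k => μ)
      (X := fun v => g (v j)) (a := a) (b := b) (hg.comp (measurable_pi_apply j)).aemeasurable (ae_of_all _ fun v => hgab _)
    have hint : ∫ v, g (v j) ∂(Measure.pi fun _ : Fin k => μ) = ∫ x, g x ∂μ := by
      have hmp := measurePreserving_eval (fun _ : Fin k => μ) j
      exact (integral_map hmp.measurable.aemeasurable (f := g) hg.aestronglyMeasurable).symm.trans
        (by rw [hmp.map_eq])
    rwa [hint] at h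
  refine (HasSubgaussianMGF.measure_sum_ge_le_of_iIndepFun hind hsub (by positivity)).trans ?_
  apply Real.exp_le_exp.mpr
  have hba : 0 < b - a := by linarith
  have hn : ‖b - a‖ = b - a := by rw [Real.norm_eq_abs, abs_of_pos hba]
  rcases Nat.eq_zero_or_pos k with rfl | hk
  · simp
  · have hk' : (0 : ℝ) < k := by exact_mod_cast hk
    apply le_of_eq
    simp [hn]
    field_simp

/-- Hoeffding's inequality for the empirical mean of independent trials. -/
theorem hoeffding {g : α → ℝ} (hg : Measurable g) {a b : ℝ} (hab : a < b)
    (hgab : ∀ x, g x ∈ Set.Icc a b) (k : ℕ) {s : ℝ} (hs : 0 ≤ s) :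
    (Measure.pi fun _ : Fin k => μ).real {v | |(∑ j, g (v j)) / k - ∫ x, g x ∂μ| ≤ s}ᶜ ≤
      2 * Real.exp (-(2 * k * s ^ 2 / (b - a) ^ 2)) := by
  rcases Nat.eq_zero_or_pos k with rfl | hk
  · refine measureReal_le_one.trans ?_
    simp
  have hk' : (0 : ℝ) < k := by exact_mod_cast hk
  have h₁ := hoeffding_upper (μ := μ) hg hab hgab k hs
  have h₂ := hoeffding_upper (μ := μ) (g := fun x => -g x) hg.neg (a := -b) (b := -a) (by linarith)
    (fun x => ⟨by linarith [(hgab x).2], by linarith [(hgab x).1]⟩) k hs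
  rw [show (-a - -b) = b - a by ring] at h₂
  refine (measureReal_mono (s₂ := _ ∪ _) ?_ (measure_ne_top _ _)).trans
    ((measureReal_union_le _ _).trans ((add_le_add h₁ h₂).trans (by linarith)))
  intro v hv
  simp only [Set.mem_compl_iff, Set.mem_ofPred_eq, not_le, lt_abs] at hv
  simp only [Set.mem_union, Set.mem_ofPred_eq, Finset.sum_sub_distrib, Finset.sum_const,
    Finset.card_univ, Fintype.card_fin, nsmul_eq_mul, integral_neg, Finset.sum_neg_distrib]
  have e : (∑ j, g (v j)) / k * k = ∑ j, g (v j) := by field_simp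
  rcases hv with hv | hv
  · left; nlinarith
  · right; nlinarith

/-- A form of Markov's inequality: a function with values in `[-1, 1]` and mean at least `2 s` exceeds
`s` with probability at least `s`. -/
theorem measureReal_ge_of_le_integral {g : α → ℝ} (hg : Measurable g) (hg1 : ∀ x, |g x| ≤ 1) {s : ℝ}
    (hs : 0 ≤ s) (h : 2 * s ≤ ∫ x, g x ∂μ) : s ≤ μ.real {x | s ≤ g x} := by
  have hE : MeasurableSet {x | s ≤ g x} := measurableSet_le measurable_const hg
  have hint : Integrable g μ :=
    Integrable.of_bound hg.aestronglyMeasurable 1 (ae_of_all _ fun x => by simpa using hg1 x)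
  have hi : Integrable ({x | s ≤ g x}.indicator (fun _ => (1 : ℝ))) μ :=
    (integrable_const _).indicator hE
  have : ∫ x, g x ∂μ ≤ ∫ x, ({x | s ≤ g x}.indicator (fun _ => (1 : ℝ)) x + s) ∂μ := by
    apply integral_mono hint (hi.add (integrable_const _))
    intro x
    by_cases hx : s ≤ g x
    · simp [hx]; linarith [(abs_le.mp (hg1 x)).2]
    · simp [hx]; linarith
  rw [integral_add hi (integrable_const _), integral_indicator_const _ hE] at this
  simp at this
  linarith

end Concentration

namespace Prog

section Sampling

variable {X : Type u} {H : Type v} [MeasurableSpace X] [MeasurableSpace H] {m n : ℕ}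
  {α : Type w} [MeasurableSpace α] {β : Type z}
  {A : Learner X H m n} {D₁ D₀ : Measure X} {f : X → Bool}

theorem measurable_ind : Measurable ind := measurable_of_finite _

/-- Empirical means of `k` independent runs whose result is a bounded function of a sample from
`μ`. -/
theorem HasDist.whp_average {p : Prog X H m n ℝ} {μ : Measure α} [IsProbabilityMeasure μ]
    {g : α → ℝ} (hg : Measurable g) (hp : HasDist A D₁ D₀ f p (μ.map g)) {a b : ℝ} (hab : a < b)
    (hgab : ∀ x, g x ∈ Set.Icc a b) (k : ℕ) {s : ℝ} (hs : 0 ≤ s) {η : ℝ}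
    (hη : 2 * Real.exp (-(2 * k * s ^ 2 / (b - a) ^ 2)) ≤ η) :
    Whp A D₁ D₀ f (average k p) {y | |y - ∫ x, g x ∂μ| ≤ s} η := by
  have := Measure.isProbabilityMeasure_map (μ := μ) hg.aemeasurable
  have ht := hasDist_tuple (A := A) (D₁ := D₁) (D₀ := D₀) (f := f) (k := k) (p := fun _ => p)
    (μ := fun _ => μ.map g) fun _ => hp
  have hmap : (Measure.pi fun _ : Fin k => μ.map g) =
      (Measure.pi fun _ : Fin k => μ).map fun v j => g (v j) :=
    (Measure.pi_map_pi (μ := fun _ : Fin k => μ) (f := fun _ => g) fun _ => hg.aemeasurable).symm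
  have hav : HasDist A D₁ D₀ f (average k p)
      ((Measure.pi fun _ : Fin k => μ.map g).map fun v => (∑ j, v j) / (k : ℝ)) :=
    ht.bind_map (by fun_prop) fun v F => by simp [expect]
  rw [hmap, Measure.map_map (by fun_prop) (by fun_prop)] at hav
  have hm : Measurable ((fun v : Fin k → ℝ => (∑ j, v j) / (k : ℝ)) ∘
      fun (v : Fin k → α) j => g (v j)) := by fun_prop
  have := Measure.isProbabilityMeasure_map (μ := Measure.pi fun _ : Fin k => μ) hm.aemeasurable
  have hE : MeasurableSet {y : ℝ | |y - ∫ x, g x ∂μ| ≤ s} := by measurability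
  refine hav.whp hE ?_ subset_rfl
  rw [map_measureReal_apply hm hE.compl]
  exact (hoeffding hg hab hgab k hs).trans hη

theorem HasDist.whp_estimate {p : Prog X H m n Bool} {μ : Measure Bool} [IsProbabilityMeasure μ]
    (hp : HasDist A D₁ D₀ f p μ) {γ δ : ℝ} (hγ : 0 < γ) (hδ : 0 < δ) :
    Whp A D₁ D₀ f (estimate γ δ p) {y | |y - μ.real {true}| ≤ γ} δ := by
  have h1 : HasDist A D₁ D₀ f (p.bind fun b => Prog.step <| Prog.ret (ind b)) (μ.map ind) :=
    hp.bind_map measurable_ind fun b F => rfl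
  have hint : ∫ b, ind b ∂μ = μ.real {true} := by
    rw [integral_fintype .of_finite]; simp [ind]
  have := h1.whp_average measurable_ind (a := 0) (b := 1) one_pos
    (fun x => by cases x <;> simp [ind]) ⌈Real.log (2 / δ) / (2 * γ ^ 2)⌉₊ hγ.le (η := δ) ?_
  · rwa [hint] at this
  · have hk := Nat.le_ceil (Real.log (2 / δ) / (2 * γ ^ 2))
    rw [div_le_iff₀ (by positivity)] at hk
    calc 2 * Real.exp _ ≤ 2 * Real.exp (-Real.log (2 / δ)) := by
          gcongr
          simp; linarith
      _ = δ := by rw [Real.exp_neg, Real.exp_log (by positivity)]; field_simp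

/-- The law of the difference of two Boolean outcomes obtained from independent inputs. -/
theorem hasDist_trial {α₁ : Type*} {α₀ : Type*} {ρ : Type*} [MeasurableSpace α₁] [MeasurableSpace α₀]
    [MeasurableSpace ρ] {q₁ : Prog X H m n α₁} {q₀ : Prog X H m n α₀}
    {μ₁ : Measure α₁} {μ₀ : Measure α₀} [IsProbabilityMeasure μ₁] [IsProbabilityMeasure μ₀]
    (h₁ : HasDist A D₁ D₀ f q₁ μ₁) (h₀ : HasDist A D₁ D₀ f q₀ μ₀)
    {k₁ : α₁ → Prog X H m n ρ} {k₀ : α₀ → Prog X H m n ρ} {κ₁ : Kernel α₁ ρ} {κ₀ : Kernel α₀ ρ}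
    [IsMarkovKernel κ₁] [IsMarkovKernel κ₀]
    (hk₁ : ∀ a, HasDist A D₁ D₀ f (k₁ a) (κ₁ a)) (hk₀ : ∀ a, HasDist A D₁ D₀ f (k₀ a) (κ₀ a))
    {g : ρ → Bool} (hg : Measurable g) :
    HasDist A D₁ D₀ f (q₁.bind fun a₁ => q₀.bind fun a₀ => (k₁ a₁).bind fun r₁ =>
        (k₀ a₀).bind fun r₀ => step <| ret (ind (g r₁) - ind (g r₀)))
      (((μ₁.bind κ₁).prod (μ₀.bind κ₀)).map fun z => ind (g z.1) - ind (g z.2)) := by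
  intro F hF
  have hm : Measurable fun z : ρ × ρ => ind (g z.1) - ind (g z.2) :=
    (measurable_ind.comp (hg.comp measurable_fst)).sub (measurable_ind.comp (hg.comp measurable_snd))
  have hG : Measurable fun z : ρ × ρ => F (ind (g z.1) - ind (g z.2)) := hF.comp hm
  have hG1 : ∀ a, Measurable fun r : ρ => ∫⁻ r₀, F (ind (g r) - ind (g r₀)) ∂κ₀ a := fun a =>
    hG.lintegral_prod_right'
  have e₁ : ∀ r₁ a₀, ((k₀ a₀).bind fun r₀ => step <| ret (ind (g r₁) - ind (g r₀))).expect A D₁ D₀ f F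
      = ∫⁻ r₀, F (ind (g r₁) - ind (g r₀)) ∂κ₀ a₀ := fun r₁ a₀ => by
    rw [expect_bind]; exact hk₀ a₀ _ (hG.comp (measurable_prodMk_left (x := r₁)))
  have e₂ : ∀ a₁ a₀, ((k₁ a₁).bind fun r₁ => (k₀ a₀).bind fun r₀ =>
      step <| ret (ind (g r₁) - ind (g r₀))).expect A D₁ D₀ f F
      = ∫⁻ r₁, ∫⁻ r₀, F (ind (g r₁) - ind (g r₀)) ∂κ₀ a₀ ∂κ₁ a₁ := fun a₁ a₀ => by
    rw [expect_bind, ← hk₁ a₁ _ (hG1 a₀)]; simp only [e₁]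
  have hJ : Measurable fun z : ρ × α₀ => ∫⁻ r₀, F (ind (g z.1) - ind (g r₀)) ∂κ₀ z.2 := by
    have h3 : Measurable (Function.uncurry fun (z : ρ × α₀) (r₀ : ρ) => F (ind (g z.1) - ind (g r₀))) :=
      hG.comp (by fun_prop : Measurable fun y : (ρ × α₀) × ρ => (y.1.1, y.2))
    exact Measurable.lintegral_kernel_prod_right (κ := κ₀.comap Prod.snd measurable_snd) h3
  have hJ2 : Measurable fun z : α₁ × α₀ => ∫⁻ r₁, ∫⁻ r₀, F (ind (g r₁) - ind (g r₀)) ∂κ₀ z.2 ∂κ₁ z.1 := by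
    have h3 : Measurable (Function.uncurry fun (z : α₁ × α₀) (r₁ : ρ) =>
        ∫⁻ r₀, F (ind (g r₁) - ind (g r₀)) ∂κ₀ z.2) :=
      hJ.comp (by fun_prop : Measurable fun y : (α₁ × α₀) × ρ => (y.2, y.1.2))
    exact Measurable.lintegral_kernel_prod_right (κ := κ₁.comap Prod.fst measurable_fst) h3
  rw [expect_bind, lintegral_map hF hm, lintegral_prod _ hG.aemeasurable,
    Measure.lintegral_bind κ₁.measurable.aemeasurable hG.lintegral_prod_right'.aemeasurable]
  have e₃ : ∀ r, ∫⁻ y, F (ind (g r) - ind (g y)) ∂(μ₀.bind κ₀) =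
      ∫⁻ a₀, ∫⁻ y, F (ind (g r) - ind (g y)) ∂κ₀ a₀ ∂μ₀ := fun r =>
    Measure.lintegral_bind κ₀.measurable.aemeasurable
      (hG.comp (measurable_prodMk_left (x := r))).aemeasurable
  simp only [e₃]
  have : ∀ a₁, (q₀.bind fun a₀ => (k₁ a₁).bind fun r₁ =>
        (k₀ a₀).bind fun r₀ => step <| ret (ind (g r₁) - ind (g r₀))).expect A D₁ D₀ f F =
      ∫⁻ r₁, ∫⁻ a₀, ∫⁻ r₀, F (ind (g r₁) - ind (g r₀)) ∂κ₀ a₀ ∂μ₀ ∂κ₁ a₁ := fun a₁ => by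
    rw [expect_bind, lintegral_lintegral_swap hJ.aemeasurable]
    simp only [e₂]
    exact h₀ _ (hJ2.comp (measurable_prodMk_left (x := a₁)))
  simp only [this]
  exact h₁ _ (Measurable.lintegral_kernel hJ.lintegral_prod_right')

end Sampling

end Prog

/-! ### Searching by repeated trials -/

namespace Prog

section Search

variable {X : Type u} {H : Type v} [MeasurableSpace X] [MeasurableSpace H] {m n : ℕ}
  {α : Type w} [MeasurableSpace α] {β : Type z}
  {A : Learner X H m n} {D₁ D₀ : Measure X} {f : X → Bool}

/-- If the continuation fails with probability at most `a` on an event of probability at least `π`,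
and with probability at most `b` elsewhere, then the composition fails with probability at most
`π a + (1 - π) b`. -/
theorem HasDist.whp_bind_of_real_le {p : Prog X H m n α} {μ : Measure α} [IsProbabilityMeasure μ]
    (hp : HasDist A D₁ D₀ f p μ) {q : α → Prog X H m n β} {E : Set β} {G : Set α}
    (hG : MeasurableSet G) {π a b : ℝ} (hπ : π ≤ μ.real G) (hab : a ≤ b)
    (ha : ∀ x ∈ G, Whp A D₁ D₀ f (q x) E a) (hb : ∀ x, Whp A D₁ D₀ f (q x) E b) :
    Whp A D₁ D₀ f (p.bind q) E (π * a + (1 - π) * b) := by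
  have hF : Measurable fun x => G.indicator (fun _ => ENNReal.ofReal (1 - a)) x +
      Gᶜ.indicator (fun _ => ENNReal.ofReal (1 - b)) x :=
    (measurable_const.indicator hG).add (measurable_const.indicator hG.compl)
  have h1 : p.expect A D₁ D₀ f (fun x => G.indicator (fun _ => ENNReal.ofReal (1 - a)) x +
      Gᶜ.indicator (fun _ => ENNReal.ofReal (1 - b)) x) ≤ (p.bind q).prob A D₁ D₀ f E := by
    rw [prob, expect_bind]
    refine expect_mono _ _ _ _ _ fun x => ?_
    by_cases hx : x ∈ G
    · simpa [hx, Whp, prob] using ha x hx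
    · simpa [hx, Whp, prob] using hb x
  refine le_trans ?_ h1
  rw [hp _ hF, lintegral_add_left (measurable_const.indicator hG), lintegral_indicator_const hG,
    lintegral_indicator_const hG.compl, ← ENNReal.ofReal_toReal (measure_ne_top μ G),
    ← ENNReal.ofReal_toReal (measure_ne_top μ Gᶜ), ← measureReal_def, ← measureReal_def,
    probReal_compl_eq_one_sub hG]
  have h0 : 0 ≤ μ.real G := measureReal_nonneg
  have h2 : μ.real G ≤ 1 := measureReal_le_one
  rw [← ENNReal.ofReal_mul' h0, ← ENNReal.ofReal_mul' (by linarith)]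
  refine le_trans (ENNReal.ofReal_le_ofReal ?_) ENNReal.ofReal_add_le
  nlinarith

variable {τ : Type z} {draw : Prog X H m n α} {test : α → Prog X H m n ℝ} {mk : α → τ}
  {p : ℕ → Prog X H m n (Option τ)} {θ s η : ℝ} {Δ : α → ℝ}

omit [MeasurableSpace α] in
/-- A search that accepts a candidate once its measured score is at least `θ` does not return a
candidate whose true score is far below `θ`. -/
theorem whp_search_sound [IsMarkovKernel A] [IsProbabilityMeasure D₁] [IsProbabilityMeasure D₀]
    (h0 : p 0 = ret none)
    (hs : ∀ k, p (k + 1) = step (draw.bind fun S => (test S).bind fun y =>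
      if θ ≤ y then ret (some (mk S)) else p k))
    (hη : 0 ≤ η) (htest : ∀ S, Whp A D₁ D₀ f (test S) {y | |y - Δ S| ≤ s} η) (k : ℕ) :
    Whp A D₁ D₀ f (p k) {o : Option τ | o = none ∨ ∃ S, o = some (mk S) ∧ θ - s ≤ Δ S} (k * η) := by
  induction k with
  | zero => rw [h0]; exact Whp.ret (by exact Or.inl rfl) (by simp)
  | succ k ih =>
    rw [hs, whp_step_iff]
    refine Whp.mono (Whp.bind (E := Set.univ) (b := η + k * η)
      (Whp.of_forall (fun _ => trivial) le_rfl) (fun S _ =>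
        Whp.bind (htest S) (fun y hy => ?_) hη (by positivity)) le_rfl (by positivity)) subset_rfl
      (by push_cast; linarith)
    have hy' := abs_le.mp (show |y - Δ S| ≤ s from hy)
    split_ifs with h
    · exact Whp.ret (by exact Or.inr ⟨S, rfl, by linarith⟩) (by positivity)
    · exact ih

/-- If moreover a candidate has a score clearly above `θ` with probability at least `π`, then `k`
attempts fail with probability at most `(1 - π) ^ k + k η`. -/
theorem whp_search [IsMarkovKernel A] [IsProbabilityMeasure D₁] [IsProbabilityMeasure D₀]
    {μ : Measure α} [IsProbabilityMeasure μ]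
    (hs : ∀ k, p (k + 1) = step (draw.bind fun S => (test S).bind fun y =>
      if θ ≤ y then ret (some (mk S)) else p k))
    (hη : 0 ≤ η) (htest : ∀ S, Whp A D₁ D₀ f (test S) {y | |y - Δ S| ≤ s} η)
    (hdraw : HasDist A D₁ D₀ f draw μ) (hΔ : Measurable Δ) {π : ℝ} (hπ0 : 0 ≤ π) (hπ1 : π ≤ 1)
    (hπ : π ≤ μ.real {S | θ + s ≤ Δ S}) (k : ℕ) :
    Whp A D₁ D₀ f (p k) {o | ∃ S, o = some (mk S) ∧ θ - s ≤ Δ S} ((1 - π) ^ k + k * η) := by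
  induction k with
  | zero => exact whp_of_one_le (by simp)
  | succ k ih =>
    have ha : 0 ≤ (1 - π) ^ k + k * η := by
      have : 0 ≤ 1 - π := by linarith
      positivity
    rw [hs, whp_step_iff]
    refine Whp.mono (hdraw.whp_bind_of_real_le (measurableSet_le measurable_const hΔ) hπ
      (a := η) (b := η + ((1 - π) ^ k + k * η)) (by linarith) (fun S hS => ?_) fun S => ?_)
      subset_rfl ?_
    · refine Whp.mono (Whp.bind (htest S) (b := 0) (fun y hy => ?_) hη le_rfl) subset_rfl (by simp)
      have hy' := abs_le.mp (show |y - Δ S| ≤ s from hy)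
      have hS' : θ + s ≤ Δ S := hS
      rw [if_pos (by linarith)]
      exact Whp.ret (by exact ⟨S, rfl, by linarith⟩) le_rfl
    · refine Whp.bind (htest S) (fun y hy => ?_) hη ha
      have hy' := abs_le.mp (show |y - Δ S| ≤ s from hy)
      split_ifs with h
      · exact Whp.ret (by exact ⟨S, rfl, by linarith⟩) ha
      · exact ih
    · have : 0 ≤ π * (k * η) := by positivity
      push_cast
      rw [pow_succ]
      nlinarith

end Search

end Prog

/-! ### Weak distinguishers -/

section Distinguish

variable {X : Type u} {H : Type v} [MeasurableSpace X] [MeasurableSpace H] {m n : ℕ}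

theorem measurable_accepts : Measurable (Answer.accepts : Answer H → Bool) := by
  have : (Answer.accepts : Answer H → Bool) = Sum.elim (fun _ => false) fun _ => true := by
    ext r; cases r <;> rfl
  rw [this]
  exact Measurable.sumElim measurable_const measurable_const

theorem measurableSet_accepts : MeasurableSet {r : Answer H | r.accepts = true} :=
  measurable_accepts (measurableSet_singleton true)

theorem real_bind {α : Type*} {β : Type*} [MeasurableSpace α] [MeasurableSpace β] (μ : Measure α)
    (κ : Kernel α β) [IsMarkovKernel κ] {s : Set β} (hs : MeasurableSet s) :
    (μ.bind κ).real s = ∫ a, (κ a).real s ∂μ := by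
  rw [measureReal_def, Measure.bind_apply hs κ.measurable.aemeasurable,
    ← integral_toReal (κ.measurable_coe hs).aemeasurable (ae_of_all _ fun a => measure_lt_top _ _)]
  rfl

theorem measurable_kernel_real {α : Type*} {β : Type*} [MeasurableSpace α] [MeasurableSpace β]
    (κ : Kernel α β) {s : Set β} (hs : MeasurableSet s) : Measurable fun a => (κ a).real s :=
  (κ.measurable_coe hs).ennreal_toReal

/-- Resampling one coordinate of a product distribution changes the factor of this coordinate. -/
theorem pi_prod_map_update {ι : Type*} [Fintype ι] [DecidableEq ι] {α : Type*} [MeasurableSpace α]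
    (μ : ι → Measure α) [∀ j, IsProbabilityMeasure (μ j)] (ν : Measure α) [IsProbabilityMeasure ν]
    (i : ι) :
    ((Measure.pi μ).prod ν).map (fun z => Function.update z.1 i z.2) =
      Measure.pi (Function.update (β := fun _ => Measure α) μ i ν) := by
  have hp : ∀ j, IsProbabilityMeasure ((Function.update μ i ν : ι → Measure α) j) := fun j => by
    by_cases h : j = i
    · subst h; simpa
    · rw [Function.update_of_ne h]; infer_instance
  symm
  refine Measure.pi_eq fun s hs => ?_
  rw [Measure.map_apply measurable_update' (.univ_pi hs)]
  have : (fun z : (ι → α) × α => Function.update z.1 i z.2) ⁻¹' Set.univ.pi s =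
      (Set.univ.pi (Function.update s i Set.univ)) ×ˢ s i := by
    ext ⟨c, x⟩
    simp only [Set.mem_preimage, Set.mem_univ_pi, Set.mem_prod]
    constructor
    · intro h
      refine ⟨fun j => ?_, by simpa using h i⟩
      by_cases hj : j = i
      · subst hj; simp
      · simpa [hj] using h j
    · rintro ⟨h, hx⟩ j
      by_cases hj : j = i
      · subst hj; simpa
      · simpa [hj] using h j
  rw [this, Measure.prod_prod, Measure.pi_pi, ← Finset.prod_erase_mul _ _ (Finset.mem_univ i),
    ← Finset.prod_erase_mul _ _ (Finset.mem_univ i)]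
  simp only [Function.update_self, measure_univ, mul_one]
  congr 1
  refine Finset.prod_congr rfl fun j hj => ?_
  simp [Finset.ne_of_mem_erase hj]

variable (A : Learner X H m n) [IsMarkovKernel A]

/-- The probability that the learner accepts the samples `S`, `U`. -/
def acceptProb (S : Fin m → X × Bool) (U : Fin n → X) : ℝ := (A (S, U)).real {r | r.accepts = true}

variable {A}

omit [IsMarkovKernel A] in
theorem measurable_acceptProb :
    Measurable fun z : (Fin m → X × Bool) × (Fin n → X) => acceptProb A z.1 z.2 :=
  measurable_kernel_real A measurableSet_accepts

omit [IsMarkovKernel A] in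
theorem measurable_acceptProb_right (S : Fin m → X × Bool) :
    Measurable fun U : Fin n → X => acceptProb A S U :=
  measurable_acceptProb.comp (measurable_prodMk_left (x := S))

omit [IsMarkovKernel A] in
theorem acceptProb_nonneg (S : Fin m → X × Bool) (U : Fin n → X) : 0 ≤ acceptProb A S U :=
  measureReal_nonneg

theorem acceptProb_le_one (S : Fin m → X × Bool) (U : Fin n → X) : acceptProb A S U ≤ 1 :=
  measureReal_le_one

theorem integral_mem_Icc {α : Type*} [MeasurableSpace α] {μ : Measure α} [IsProbabilityMeasure μ]
    {g : α → ℝ} (hg : Measurable g) (h0 : ∀ x, 0 ≤ g x) (h1 : ∀ x, g x ≤ 1) :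
    0 ≤ ∫ x, g x ∂μ ∧ ∫ x, g x ∂μ ≤ 1 := by
  refine ⟨integral_nonneg h0, ?_⟩
  have hint : Integrable g μ := Integrable.of_bound hg.aestronglyMeasurable 1
    (ae_of_all _ fun x => by rw [Real.norm_eq_abs, abs_of_nonneg (h0 x)]; exact h1 x)
  simpa using integral_mono hint (integrable_const 1) h1

namespace Prog

variable {D₁ D₀ : Measure X} {f : X → Bool} [IsProbabilityMeasure D₁] [IsProbabilityMeasure D₀]

omit [IsMarkovKernel A] [IsProbabilityMeasure D₁] [IsProbabilityMeasure D₀] in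
/-- The empirical mean of the difference of two independent Boolean outcomes is close to the
difference of their probabilities. -/
theorem whp_average_trial {α₁ : Type*} {α₀ : Type*} {ρ : Type*} [MeasurableSpace α₁]
    [MeasurableSpace α₀] [MeasurableSpace ρ] {q₁ : Prog X H m n α₁} {q₀ : Prog X H m n α₀}
    {μ₁ : Measure α₁} {μ₀ : Measure α₀} [IsProbabilityMeasure μ₁] [IsProbabilityMeasure μ₀]
    (h₁ : HasDist A D₁ D₀ f q₁ μ₁) (h₀ : HasDist A D₁ D₀ f q₀ μ₀)
    {k₁ : α₁ → Prog X H m n ρ} {k₀ : α₀ → Prog X H m n ρ} {κ₁ : Kernel α₁ ρ} {κ₀ : Kernel α₀ ρ}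
    [IsMarkovKernel κ₁] [IsMarkovKernel κ₀]
    (hk₁ : ∀ a, HasDist A D₁ D₀ f (k₁ a) (κ₁ a)) (hk₀ : ∀ a, HasDist A D₁ D₀ f (k₀ a) (κ₀ a))
    {g : ρ → Bool} (hg : Measurable g) (k : ℕ) {s η : ℝ} (hs : 0 ≤ s)
    (hη : 2 * Real.exp (-(k * s ^ 2 / 2)) ≤ η) :
    Whp A D₁ D₀ f (average k (q₁.bind fun a₁ => q₀.bind fun a₀ => (k₁ a₁).bind fun r₁ =>
        (k₀ a₀).bind fun r₀ => step <| ret (ind (g r₁) - ind (g r₀))))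
      {y | |y - (∫ a, (κ₁ a).real {r | g r = true} ∂μ₁ - ∫ a, (κ₀ a).real {r | g r = true} ∂μ₀)| ≤ s}
      η := by
  have hm : Measurable fun z : ρ × ρ => ind (g z.1) - ind (g z.2) :=
    (measurable_ind.comp (hg.comp measurable_fst)).sub (measurable_ind.comp (hg.comp measurable_snd))
  have hgs : MeasurableSet {r | g r = true} := hg (measurableSet_singleton true)
  have hsupp : ∀ z : ρ × ρ, ind (g z.1) - ind (g z.2) ∈ Set.Icc (-1 : ℝ) 1 := fun z => by
    cases g z.1 <;> cases g z.2 <;> simp [ind]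
  have hind : ∀ (ν : Measure ρ) [IsProbabilityMeasure ν],
      ∫ r, ind (g r) ∂ν = ν.real {r | g r = true} := fun ν _ => by
    rw [← integral_indicator_one hgs]
    refine integral_congr_ae (ae_of_all _ fun r => ?_)
    cases h : g r <;> simp [ind, h]
  have hint : ∀ (ν : Measure ρ) [IsProbabilityMeasure ν], Integrable (fun r => ind (g r)) ν :=
    fun ν _ => Integrable.of_bound (measurable_ind.comp hg).aestronglyMeasurable 1
      (ae_of_all _ fun r => by cases g r <;> simp [ind])
  have hmean : ∫ z, (ind (g z.1) - ind (g z.2)) ∂((μ₁.bind κ₁).prod (μ₀.bind κ₀)) =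
      ∫ a, (κ₁ a).real {r | g r = true} ∂μ₁ - ∫ a, (κ₀ a).real {r | g r = true} ∂μ₀ := by
    rw [integral_sub ((hint _).comp_fst _) ((hint _).comp_snd _),
      integral_fun_fst (fun r => ind (g r)), integral_fun_snd (fun r => ind (g r)), hind, hind,
      real_bind _ _ hgs, real_bind _ _ hgs]
    simp
  have := (hasDist_trial h₁ h₀ hk₁ hk₀ hg).whp_average hm (by norm_num) hsupp k hs (η := η) ?_
  · rwa [hmean] at this
  · convert hη using 4
    ring
end Prog

end Distinguish

section Distinguish

variable {X : Type u} {H : Type v} [MeasurableSpace X] [MeasurableSpace H] {m n : ℕ}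
  {A : Learner X H m n} [IsMarkovKernel A]

/-- The product distribution whose first `i` coordinates have law `G₀` and the others law `G₁`. -/
def hybrid (n : ℕ) (G₁ G₀ : Measure X) (i : ℕ) : Measure (Fin n → X) :=
  Measure.pi fun j => if (j : ℕ) < i then G₀ else G₁

variable {G₁ G₀ : Measure X} [IsProbabilityMeasure G₁] [IsProbabilityMeasure G₀]

instance isProbabilityMeasure_ite (p : Prop) [Decidable p] :
    IsProbabilityMeasure (if p then G₀ else G₁) := by
  split_ifs <;> infer_instance

instance isProbabilityMeasure_hybrid (i : ℕ) : IsProbabilityMeasure (hybrid n G₁ G₀ i) := by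
  unfold hybrid; infer_instance

/-- The difference of the acceptance probabilities of a weak distinguisher on `G₁` and on `G₀`. -/
def WeakDist.advantage (A : Learner X H m n) (G₁ G₀ : Measure X) (d : WeakDist X m n) : ℝ :=
  ∫ x, acceptProb A d.trainSet (Function.update d.context d.slot x) ∂G₁ -
    ∫ x, acceptProb A d.trainSet (Function.update d.context d.slot x) ∂G₀

/-- The difference of the acceptance probabilities, for the training set `S`, on test examples from
`G₁` and from `G₀`. -/
def acceptGap (A : Learner X H m n) (G₁ G₀ : Measure X) (S : Fin m → X × Bool) : ℝ :=
  ∫ U, acceptProb A S U ∂(Measure.pi fun _ : Fin n => G₁) -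
    ∫ U, acceptProb A S U ∂(Measure.pi fun _ : Fin n => G₀)

theorem integrable_of_mem {α : Type*} [MeasurableSpace α] {μ : Measure α} [IsFiniteMeasure μ]
    {g : α → ℝ} (hg : Measurable g) (h0 : ∀ x, 0 ≤ g x) (h1 : ∀ x, g x ≤ 1) : Integrable g μ :=
  Integrable.of_bound hg.aestronglyMeasurable 1
    (ae_of_all _ fun x => by rw [Real.norm_eq_abs, abs_of_nonneg (h0 x)]; exact h1 x)

omit [IsMarkovKernel A] in
theorem measurable_acceptProb_update (S : Fin m → X × Bool) (i : Fin n) :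
    Measurable fun z : (Fin n → X) × X => acceptProb A S (Function.update z.1 i z.2) :=
  (measurable_acceptProb_right S).comp measurable_update'

omit [IsMarkovKernel A] in
theorem measurable_advantage (S : Fin m → X × Bool) (i : Fin n) :
    Measurable fun c => WeakDist.advantage A G₁ G₀ ⟨S, c, i⟩ := by
  have h := (measurable_acceptProb_update (A := A) S i).stronglyMeasurable
  exact h.integral_prod_right'.measurable.sub h.integral_prod_right'.measurable

omit [IsMarkovKernel A] in
theorem measurable_acceptGap : Measurable (acceptGap A G₁ G₀) := by
  have h := (measurable_acceptProb (A := A)).stronglyMeasurable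
  exact h.integral_prod_right'.measurable.sub h.integral_prod_right'.measurable

theorem WeakDist.abs_advantage_le (d : WeakDist X m n) : |d.advantage A G₁ G₀| ≤ 1 := by
  have h := (measurable_acceptProb_right (A := A) d.trainSet).comp
    (measurable_update d.context (a := d.slot))
  have h1 := integral_mem_Icc (μ := G₁) h (fun _ => acceptProb_nonneg _ _)
    fun _ => acceptProb_le_one _ _
  have h2 := integral_mem_Icc (μ := G₀) h (fun _ => acceptProb_nonneg _ _)
    fun _ => acceptProb_le_one _ _
  simp only [Function.comp_def] at h1 h2
  rw [abs_le]
  constructor <;> unfold WeakDist.advantage <;> linarith [h1.1, h1.2, h2.1, h2.2]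

theorem abs_acceptGap_le (S : Fin m → X × Bool) : |acceptGap A G₁ G₀ S| ≤ 1 := by
  have h := measurable_acceptProb_right (A := A) S
  have h1 := integral_mem_Icc (μ := Measure.pi fun _ : Fin n => G₁) h
    (fun _ => acceptProb_nonneg _ _) fun _ => acceptProb_le_one _ _
  have h2 := integral_mem_Icc (μ := Measure.pi fun _ : Fin n => G₀) h
    (fun _ => acceptProb_nonneg _ _) fun _ => acceptProb_le_one _ _
  rw [abs_le]
  constructor <;> unfold acceptGap <;> linarith [h1.1, h1.2, h2.1, h2.2]

theorem integral_hybrid_update (S : Fin m → X × Bool) (i : Fin n) (k : ℕ) (ν : Measure X)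
    [IsProbabilityMeasure ν]
    (hk : ∀ j : Fin n, Function.update (fun j : Fin n => if (j : ℕ) < i then G₀ else G₁) i ν j =
      if (j : ℕ) < k then G₀ else G₁) :
    ∫ c, ∫ x, acceptProb A S (Function.update c i x) ∂ν ∂(hybrid n G₁ G₀ i) =
      ∫ U, acceptProb A S U ∂(hybrid n G₁ G₀ k) := by
  have hm := measurable_acceptProb_update (A := A) S i
  have := pi_prod_map_update (fun j : Fin n => if (j : ℕ) < i then G₀ else G₁) ν i
  rw [funext hk] at this
  rw [hybrid, hybrid, ← this, integral_map measurable_update'.aemeasurable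
    (measurable_acceptProb_right S).aestronglyMeasurable, integral_prod]
  exact integrable_of_mem hm (fun _ => acceptProb_nonneg _ _) fun _ => acceptProb_le_one _ _

/-- The mean advantage over random contexts is the increment of the hybrid argument. -/
theorem integral_advantage (S : Fin m → X × Bool) (i : Fin n) :
    ∫ c, WeakDist.advantage A G₁ G₀ ⟨S, c, i⟩ ∂(hybrid n G₁ G₀ i) =
      ∫ U, acceptProb A S U ∂(hybrid n G₁ G₀ i) -
        ∫ U, acceptProb A S U ∂(hybrid n G₁ G₀ (i + 1)) := by
  have hm := (measurable_acceptProb_update (A := A) S i)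
  have hint : ∀ (ν : Measure X) [IsProbabilityMeasure ν],
      Integrable (fun c => ∫ x, acceptProb A S (Function.update c i x) ∂ν) (hybrid n G₁ G₀ i) :=
    fun ν _ => integrable_of_mem hm.stronglyMeasurable.integral_prod_right'.measurable
      (fun c => (integral_mem_Icc (hm.comp (measurable_prodMk_left (x := c)))
        (fun _ => acceptProb_nonneg _ _) fun _ => acceptProb_le_one _ _).1)
      (fun c => (integral_mem_Icc (hm.comp (measurable_prodMk_left (x := c)))
        (fun _ => acceptProb_nonneg _ _) fun _ => acceptProb_le_one _ _).2)
  unfold WeakDist.advantage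
  rw [integral_sub (hint _) (hint _), integral_hybrid_update S i i G₁,
    integral_hybrid_update S i (i + 1) G₀]
  · intro j
    by_cases hj : j = i
    · subst hj; simp
    · have : (j : ℕ) ≠ i := fun h => hj (Fin.ext h)
      rw [Function.update_of_ne hj]
      by_cases h : (j : ℕ) < i
      · rw [if_pos h, if_pos (by omega)]
      · rw [if_neg h, if_neg (by omega)]
  · intro j
    by_cases hj : j = i
    · subst hj; simp
    · rw [Function.update_of_ne hj]

/-- The hybrid argument: some slot has mean advantage at least a `1 / n` fraction of the gap. -/
theorem exists_slot (S : Fin m → X × Bool) {a : ℝ} (ha : 0 < a) (h : a ≤ acceptGap A G₁ G₀ S) :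
    ∃ i : Fin n, a / n ≤ ∫ c, WeakDist.advantage A G₁ G₀ ⟨S, c, i⟩ ∂(hybrid n G₁ G₀ i) := by
  have h0 : hybrid n G₁ G₀ 0 = Measure.pi fun _ : Fin n => G₁ := by simp [hybrid]
  have hn : hybrid n G₁ G₀ n = Measure.pi fun _ : Fin n => G₀ := by simp [hybrid]
  have hsum : ∑ i : Fin n, ∫ c, WeakDist.advantage A G₁ G₀ ⟨S, c, i⟩ ∂(hybrid n G₁ G₀ i) =
      acceptGap A G₁ G₀ S := by
    simp_rw [integral_advantage]
    rw [Fin.sum_univ_eq_sum_range (fun i => ∫ U, acceptProb A S U ∂(hybrid n G₁ G₀ i) -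
        ∫ U, acceptProb A S U ∂(hybrid n G₁ G₀ (i + 1))) n, Finset.sum_range_sub', h0, hn]
    rfl
  by_contra! hlt
  rcases Nat.eq_zero_or_pos n with rfl | hpos
  · simp at hsum; linarith
  · have hn' : (0 : ℝ) < n := by exact_mod_cast hpos
    have : Nonempty (Fin n) := ⟨⟨0, hpos⟩⟩
    have := Finset.sum_lt_sum_of_nonempty (s := (Finset.univ : Finset (Fin n)))
      Finset.univ_nonempty fun i _ => hlt i
    rw [hsum] at this
    simp at this
    rw [mul_div_cancel₀ _ hn'.ne'] at this
    linarith

namespace Prog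

variable {D₁ D₀ : Measure X} {f : X → Bool} [IsProbabilityMeasure D₁] [IsProbabilityMeasure D₀]
  {draw₁ : Prog X H m n (X × Bool)} {draw₀ : Prog X H m n X}

omit [IsMarkovKernel A] [IsProbabilityMeasure D₁] [IsProbabilityMeasure D₀]
  [IsProbabilityMeasure G₁] in
theorem HasDist.bind_fst (hf : Measurable f) (h₁ : HasDist A D₁ D₀ f draw₁ (labeled G₁ f)) :
    HasDist A D₁ D₀ f (draw₁.bind fun s => Prog.ret s.1) G₁ := by
  have := h₁.bind_map (g := Prod.fst) measurable_fst (q := fun s => Prog.ret s.1) fun s F => rfl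
  rwa [labeled, Measure.map_map measurable_fst (by fun_prop), Function.comp_def, Measure.map_id']
    at this

/-- The law of the answer of a weak distinguisher, as a kernel. -/
def _root_.TDS.WeakDist.kernel (A : Learner X H m n) (d : WeakDist X m n) : Kernel X Bool :=
  (A.comap (fun x => (d.trainSet, Function.update d.context d.slot x))
    (measurable_const.prodMk (measurable_update _))).map Answer.accepts

instance (d : WeakDist X m n) : IsMarkovKernel (d.kernel A) :=
  Kernel.IsMarkovKernel.map _ measurable_accepts

omit [IsMarkovKernel A] in
theorem _root_.TDS.WeakDist.kernel_real (d : WeakDist X m n) (x : X) :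
    (d.kernel A x).real {b | b = true} =
      acceptProb A d.trainSet (Function.update d.context d.slot x) := by
  rw [WeakDist.kernel, Kernel.map_apply _ measurable_accepts,
    map_measureReal_apply measurable_accepts (by measurability)]
  rfl

omit [IsMarkovKernel A] [IsProbabilityMeasure D₁] [IsProbabilityMeasure D₀] in
theorem hasDist_run (d : WeakDist X m n) (x : X) :
    HasDist A D₁ D₀ f (d.run x) (d.kernel A x) := by
  rw [WeakDist.kernel, Kernel.map_apply _ measurable_accepts]
  exact (hasDist_runA d.trainSet (Function.update d.context d.slot x)).bind_map measurable_accepts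
    fun r F => rfl

/-- A mean acceptance gap of `0.02` makes one percent of the training sets have gap `0.01`, so that
some training set passes the test with threshold `0.004`. -/
theorem whp_findTrainSet (hf : Measurable f) (h₁ : HasDist A D₁ D₀ f draw₁ (labeled G₁ f))
    (h₀ : HasDist A D₁ D₀ f draw₀ G₀)
    (hgap : 0.02 ≤ ∫ S, acceptGap A G₁ G₀ S ∂(Measure.pi fun _ : Fin m => labeled G₁ f))
    (r k : ℕ) {η : ℝ} (hη : 2 * Real.exp (-(r * 0.002 ^ 2 / 2)) ≤ η) :
    Whp A D₁ D₀ f (findTrainSet draw₁ draw₀ r k)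
      {o | ∃ S, o = some S ∧ 0.002 ≤ acceptGap A G₁ G₀ S} ((1 - 0.01) ^ k + k * η) := by
  have := isProbabilityMeasure_labeled (D := G₁) hf
  have hη0 : 0 ≤ η := le_trans (by positivity) hη
  have key := whp_search (A := A) (D₁ := D₁) (D₀ := D₀) (f := f)
    (p := findTrainSet draw₁ draw₀ r) (θ := 0.004) (s := 0.002)
    (η := η) (Δ := acceptGap A G₁ G₀) (mk := id) (fun k => rfl) hη0 (fun S => ?_)
    (hasDist_tuple fun _ => h₁) measurable_acceptGap (π := 0.01) (by norm_num) (by norm_num) ?_ k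
  · refine key.mono ?_ le_rfl
    rintro o ⟨S, rfl, h⟩
    exact ⟨S, rfl, le_trans (by norm_num) h⟩
  · exact whp_average_trial (κ₁ := A.comap (fun U => (S, U)) measurable_prodMk_left)
      (κ₀ := A.comap (fun U => (S, U)) measurable_prodMk_left)
      (hasDist_tuple fun _ => h₁.bind_fst hf) (hasDist_tuple fun _ => h₀)
      (fun U => hasDist_runA S U) (fun U => hasDist_runA S U) measurable_accepts r (by norm_num) hη
  · refine (measureReal_ge_of_le_integral measurable_acceptGap abs_acceptGap_le (by norm_num)
      (le_trans (by norm_num) hgap)).trans (measureReal_mono fun S hS => ?_)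
    exact le_trans (by norm_num) (show (0.01 : ℝ) ≤ _ from hS)

omit [IsProbabilityMeasure D₁] [IsProbabilityMeasure D₀] in
/-- Testing a candidate measures its advantage. -/
theorem whp_searchSlot_test (hf : Measurable f) (h₁ : HasDist A D₁ D₀ f draw₁ (labeled G₁ f))
    (h₀ : HasDist A D₁ D₀ f draw₀ G₀) (d : WeakDist X m n)
    (l : ℕ) {s η : ℝ} (hs : 0 ≤ s) (hη : 2 * Real.exp (-(l * s ^ 2 / 2)) ≤ η) :
    Whp A D₁ D₀ f (average l <|
        draw₁.bind fun s =>
        draw₀.bind fun x =>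
        (d.run s.1).bind fun b₁ =>
        (d.run x).bind fun b₀ =>
        step <| ret (ind b₁ - ind b₀)) {y | |y - d.advantage A G₁ G₀| ≤ s} η := by
  have := isProbabilityMeasure_labeled (D := G₁) hf
  have key := whp_average_trial (κ₁ := (d.kernel A).comap Prod.fst measurable_fst)
    (κ₀ := d.kernel A) h₁ h₀ (fun z => hasDist_run d z.1) (hasDist_run d) (g := id)
    measurable_id l hs hη
  have e : ∫ z : X × Bool,
      (((d.kernel A).comap Prod.fst measurable_fst : Kernel (X × Bool) Bool) z).real {b | id b = true} ∂(labeled G₁ f) =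
      ∫ x, acceptProb A d.trainSet (Function.update d.context d.slot x) ∂G₁ := by
    have hm := measurable_kernel_real (d.kernel A) (s := {b | id b = true}) (by measurability)
    rw [labeled, integral_map (by fun_prop)]
    · exact integral_congr_ae (ae_of_all _ fun x => d.kernel_real x)
    · exact (hm.comp measurable_fst).aestronglyMeasurable
  have e' : ∫ x, ((d.kernel A) x).real {b | id b = true} ∂G₀ =
      ∫ x, acceptProb A d.trainSet (Function.update d.context d.slot x) ∂G₀ :=
    integral_congr_ae (ae_of_all _ fun x => d.kernel_real x)
  rwa [e, e'] at key

/-- Whatever the slot, the search in it does not return a distinguisher with too small an advantage;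
slots that are of no use are passed over safely. -/
theorem whp_searchSlot_sound (hf : Measurable f) (h₁ : HasDist A D₁ D₀ f draw₁ (labeled G₁ f))
    (h₀ : HasDist A D₁ D₀ f draw₀ G₀) (S : Fin m → X × Bool) (i : Fin n)
    (l k : ℕ) {η : ℝ} (hη : 2 * Real.exp (-(l * (1 / (10000 * n)) ^ 2 / 2)) ≤ η) :
    Whp A D₁ D₀ f (searchSlot draw₁ draw₀ l S i k)
      {o | o = none ∨ ∃ d, o = some d ∧ 1 / (10000 * n) ≤ d.advantage A G₁ G₀} (k * η) := by
  have hη0 : 0 ≤ η := le_trans (by positivity) hη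
  refine (whp_search_sound (A := A) (D₁ := D₁) (D₀ := D₀) (f := f)
    (p := searchSlot draw₁ draw₀ l S i) (s := 1 / (10000 * n)) rfl (fun k => rfl) hη0
    (fun c => whp_searchSlot_test hf h₁ h₀ _ l (by positivity) hη) k).mono ?_ le_rfl
  rintro o (h | ⟨c, rfl, h⟩)
  · exact Or.inl h
  · refine Or.inr ⟨_, rfl, le_trans (le_of_eq ?_) h⟩
    rcases Nat.eq_zero_or_pos n with rfl | hpos
    · simp
    · have : (0 : ℝ) < n := by exact_mod_cast hpos
      field_simp; norm_num

/-- The search in a slot succeeds if the mean advantage over the random contexts, which are drawn from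
the hybrid distribution of the slot, is at least `0.002 / n`. -/
theorem whp_searchSlot (hf : Measurable f) (h₁ : HasDist A D₁ D₀ f draw₁ (labeled G₁ f))
    (h₀ : HasDist A D₁ D₀ f draw₀ G₀) (S : Fin m → X × Bool) (i : Fin n)
    (hi : 0.002 / n ≤ ∫ c, WeakDist.advantage A G₁ G₀ ⟨S, c, i⟩ ∂(hybrid n G₁ G₀ i))
    (l k : ℕ) {η : ℝ} (hη : 2 * Real.exp (-(l * (1 / (10000 * n)) ^ 2 / 2)) ≤ η) :
    Whp A D₁ D₀ f (searchSlot draw₁ draw₀ l S i k)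
      {o | ∃ d, o = some d ∧ 1 / (10000 * n) ≤ d.advantage A G₁ G₀}
      ((1 - 0.001 / n) ^ k + k * η) := by
  have hη0 : 0 ≤ η := le_trans (by positivity) hη
  have hpos : 0 < n := i.pos
  have hn : (1 : ℝ) ≤ n := by exact_mod_cast hpos
  refine (whp_search (A := A) (D₁ := D₁) (D₀ := D₀) (f := f)
    (p := searchSlot draw₁ draw₀ l S i) (s := 1 / (10000 * n)) (μ := hybrid n G₁ G₀ i)
    (fun k => rfl) hη0
    (fun c => whp_searchSlot_test hf h₁ h₀ _ l (by positivity) hη) ?_ (measurable_advantage S i)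
    (π := 0.001 / n) (by positivity) (by rw [div_le_one (by linarith)]; linarith) ?_ k).mono ?_ le_rfl
  · refine hasDist_tuple fun j => ?_
    by_cases hj : j < i
    · rw [if_pos hj, if_pos (show (j : ℕ) < i from hj)]; exact h₀
    · rw [if_neg hj, if_neg (show ¬(j : ℕ) < i from hj)]; exact h₁.bind_fst hf
  · refine (measureReal_ge_of_le_integral (measurable_advantage S i)
      (fun c => WeakDist.abs_advantage_le _) (by positivity)
      (le_trans (le_of_eq (by ring)) hi)).trans (measureReal_mono fun S hS => ?_)
    refine le_trans ?_ (show 0.001 / (n : ℝ) ≤ _ from hS)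
    rw [← sub_nonneg]
    field_simp
    norm_num
  · rintro o ⟨c, rfl, h⟩
    refine ⟨_, rfl, le_trans (le_of_eq ?_) h⟩
    field_simp; norm_num

/-- The search through a list of slots succeeds if one of them is as in `whp_searchSlot`; only for
that slot the probability of missing all good contexts matters. -/
theorem whp_searchSlots (hf : Measurable f) (h₁ : HasDist A D₁ D₀ f draw₁ (labeled G₁ f))
    (h₀ : HasDist A D₁ D₀ f draw₀ G₀) (S : Fin m → X × Bool) (i : Fin n)
    (hi : 0.002 / n ≤ ∫ c, WeakDist.advantage A G₁ G₀ ⟨S, c, i⟩ ∂(hybrid n G₁ G₀ i))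
    (l k : ℕ) {η : ℝ} (hη : 2 * Real.exp (-(l * (1 / (10000 * n)) ^ 2 / 2)) ≤ η)
    (is : List (Fin n)) (his : i ∈ is) :
    Whp A D₁ D₀ f (searchSlots draw₁ draw₀ l k S is)
      {o | ∃ d, o = some d ∧ 1 / (10000 * n) ≤ d.advantage A G₁ G₀}
      ((1 - 0.001 / n) ^ k + is.length * (k * η)) := by
  have hη0 : 0 ≤ η := le_trans (by positivity) hη
  have hn : (1 : ℝ) ≤ n := by exact_mod_cast i.pos
  have hpow : (0 : ℝ) ≤ (1 - 0.001 / n) ^ k := by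
    have : 0.001 / (n : ℝ) ≤ 1 := by rw [div_le_one (by linarith)]; linarith
    have : (0 : ℝ) ≤ 1 - 0.001 / n := by linarith
    positivity
  induction is with
  | nil => simp at his
  | cons j is ih =>
    rw [searchSlots, whp_step_iff]
    by_cases hij : i = j
    · subst hij
      refine ((whp_searchSlot hf h₁ h₀ S i hi l k hη).bind (b := 0) ?_ (by positivity) le_rfl).mono
        subset_rfl ?_
      · rintro _ ⟨d, rfl, hd⟩
        exact Whp.ret (by exact ⟨d, rfl, hd⟩) le_rfl
      · simp only [List.length_cons]; push_cast
        have : 0 ≤ is.length * (k * η) := by positivity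
        linarith
    · have his' : i ∈ is := by simpa [hij] using his
      have hb : 0 ≤ (1 - 0.001 / n) ^ k + is.length * (k * η) := by positivity
      refine ((whp_searchSlot_sound hf h₁ h₀ S j l k hη).bind
        (b := (1 - 0.001 / n) ^ k + is.length * (k * η)) ?_ (by positivity) hb).mono subset_rfl ?_
      · rintro _ (rfl | ⟨d, rfl, hd⟩)
        · exact ih his'
        · exact Whp.ret (by exact ⟨d, rfl, hd⟩) hb
      · simp only [List.length_cons]; push_cast; linarith

end Prog

end Distinguish

theorem one_sub_pow_le_exp {x : ℝ} (hx : x ≤ 1) (k : ℕ) : (1 - x) ^ k ≤ Real.exp (-(k * x)) := by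
  calc (1 - x) ^ k ≤ Real.exp (-x) ^ k :=
        pow_le_pow_left₀ (by linarith) (by linarith [Real.add_one_le_exp (-x)]) k
    _ = _ := by rw [← Real.exp_nat_mul]; ring_nf

theorem exp_neg_mul_log {x : ℝ} (hx : 0 < x) (k : ℕ) : Real.exp (-(k * Real.log (1 / x))) = x ^ k := by
  rw [one_div, Real.log_inv, mul_neg, neg_neg, ← Real.log_pow, Real.exp_log (by positivity)]

section Distinguish

variable {X : Type u} {H : Type v} [MeasurableSpace X] [MeasurableSpace H] {m n : ℕ}
  {A : Learner X H m n} [IsMarkovKernel A]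
  {G₁ G₀ : Measure X} [IsProbabilityMeasure G₁] [IsProbabilityMeasure G₀]
  {D₁ D₀ : Measure X} {f : X → Bool} [IsProbabilityMeasure D₁] [IsProbabilityMeasure D₀]
  {draw₁ : Prog X H m n (X × Bool)} {draw₀ : Prog X H m n X}

open Prog

/-- If the learner accepts on test examples from `G₁` more often than on test examples from `G₀`, the
two-phase search finds a weak distinguisher. -/
theorem whp_getWeakDistinguisher (hf : Measurable f)
    (h₁ : HasDist A D₁ D₀ f draw₁ (labeled G₁ f)) (h₀ : HasDist A D₁ D₀ f draw₀ G₀)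
    (hgap : 0.02 ≤ ∫ S, acceptGap A G₁ G₀ S ∂(Measure.pi fun _ : Fin m => labeled G₁ f))
    {c c₁ δ : ℝ} (hc₁ : 1000 ≤ c₁) (hc : 10 ^ 9 ≤ c) (hcc : 2 * (c₁ + 1) ≤ c) (hδ : 0 < δ)
    (hδc : δ ≤ 1 / c) :
    Whp A D₁ D₀ f (getWeakDistinguisher c c₁ draw₁ draw₀ δ)
      {o | ∃ d, o = some d ∧ 1 / (10000 * n) ≤ d.advantage A G₁ G₀} (4 * δ) := by
  have hc0 : 0 < c := by linarith
  have hδ1 : δ ≤ 1 := hδc.trans (by rw [div_le_one hc0]; linarith)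
  have hcδ : 2 * (c₁ + 1) * δ ≤ 1 := by
    rw [le_div_iff₀ hc0] at hδc
    nlinarith
  have hL0 : 0 ≤ Real.log (1 / δ) := Real.log_nonneg (by rw [le_div_iff₀ hδ]; linarith)
  have hLδ : Real.log (1 / δ) * δ ≤ 1 := by
    have := Real.log_le_self (x := 1 / δ) (by positivity)
    rwa [le_div_iff₀ hδ] at this
  set L := Real.log (1 / δ) with hL
  have hexp : ∀ (k : ℕ) (y : ℝ), k * L ≤ y → Real.exp (-y) ≤ δ ^ k := fun k y hy => by
    rw [← exp_neg_mul_log hδ]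
    exact Real.exp_le_exp.mpr (by linarith)
  have hcube : δ ^ 3 ≤ δ ^ 2 := pow_le_pow_of_le_one hδ.le hδ1 (by norm_num)
  have hfour : δ ^ 4 ≤ δ ^ 3 := pow_le_pow_of_le_one hδ.le hδ1 (by norm_num)
  have hsq : 2 * (c₁ + 1) * δ ^ 2 ≤ δ := by nlinarith
  -- The number of trials per test makes its failure probability `2 δ ^ 4`.  The powers of `δ` absorb
  -- the number of tests, as `log (1 / δ) * δ ≤ 1` and `2 * (c₁ + 1) * δ ≤ 1`.
  have hη : 2 * Real.exp (-((⌈c * L⌉₊ : ℕ) * 0.002 ^ 2 / 2)) ≤ 2 * δ ^ 4 := by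
    gcongr
    refine hexp 4 _ ?_
    have := Nat.le_ceil (c * L)
    push_cast
    nlinarith
  have hk := (Nat.ceil_lt_add_one (mul_nonneg (by linarith : 0 ≤ c₁) hL0)).le
  have hphase1 : ((1 : ℝ) - 0.01) ^ ⌈c₁ * L⌉₊ + ⌈c₁ * L⌉₊ * (2 * δ ^ 4) ≤ 2 * δ := by
    have e1 : ((1 : ℝ) - 0.01) ^ ⌈c₁ * L⌉₊ ≤ δ := by
      refine (one_sub_pow_le_exp (by norm_num) _).trans ((hexp 1 _ ?_).trans (by simp))
      have := Nat.le_ceil (c₁ * L)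
      push_cast
      nlinarith
    have e2 : (⌈c₁ * L⌉₊ : ℝ) * (2 * δ ^ 4) ≤ δ := by
      calc (⌈c₁ * L⌉₊ : ℝ) * (2 * δ ^ 4) ≤ (c₁ * L + 1) * (2 * δ ^ 4) := by gcongr
        _ = 2 * (c₁ * (L * δ) + δ) * δ ^ 3 := by ring
        _ ≤ 2 * (c₁ * 1 + 1) * δ ^ 3 := by gcongr
        _ ≤ 2 * (c₁ + 1) * δ ^ 2 := by nlinarith
        _ ≤ δ := hsq
    linarith
  have hfirst := (whp_findTrainSet hf h₁ h₀ hgap ⌈c * L⌉₊ ⌈c₁ * L⌉₊ hη).mono subset_rfl hphase1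
  refine (hfirst.bind (b := 2 * δ) ?_ (by positivity) (by positivity)).mono subset_rfl (by linarith)
  -- A gap of `0.002` for the training set leaves a mean advantage of `0.002 / n` for some slot.  Here
  -- a test fails with probability `2 (δ / n) ^ 5`, which also absorbs the `n` slots.
  rintro _ ⟨S, rfl, hS⟩
  obtain ⟨i, hi⟩ := exists_slot S (by norm_num) hS
  have hn : (1 : ℝ) ≤ n := by exact_mod_cast i.pos
  have hn0 : (0 : ℝ) < n := by linarith
  have hη2 : 2 * Real.exp (-((⌈c * (n : ℝ) ^ 2 * Real.log (n / δ)⌉₊ : ℕ) *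
      (1 / (10000 * n)) ^ 2 / 2)) ≤ 2 * (δ / n) ^ 5 := by
    gcongr
    rw [← exp_neg_mul_log (x := δ / n) (by positivity), one_div_div]
    refine Real.exp_le_exp.mpr (neg_le_neg ?_)
    have hlog : 0 ≤ Real.log (n / δ) := Real.log_nonneg (by rw [le_div_iff₀ hδ]; linarith)
    have := Nat.le_ceil (c * (n : ℝ) ^ 2 * Real.log (n / δ))
    calc ((5 : ℕ) : ℝ) * Real.log (n / δ) ≤ (c / (2 * 10 ^ 8)) * Real.log (n / δ) := by
          gcongr
          rw [le_div_iff₀ (by positivity)]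
          push_cast
          linarith
      _ = (c * (n : ℝ) ^ 2 * Real.log (n / δ)) * (1 / (10000 * n)) ^ 2 / 2 := by
          field_simp
          norm_num
          ring
      _ ≤ _ := by gcongr
  refine (whp_searchSlots hf h₁ h₀ S i hi _ _ hη2 (List.finRange n) (List.mem_finRange i)).mono
    subset_rfl ?_
  have hk2 := (Nat.ceil_lt_add_one (mul_nonneg (mul_nonneg (by linarith : 0 ≤ c₁) hn0.le) hL0)).le
  have e1 : ((1 : ℝ) - 0.001 / n) ^ ⌈c₁ * n * L⌉₊ ≤ δ := by
    refine (one_sub_pow_le_exp ?_ _).trans ((hexp 1 _ ?_).trans (by simp))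
    · rw [div_le_one hn0]; linarith
    · have := Nat.le_ceil (c₁ * n * L)
      calc ((1 : ℕ) : ℝ) * L ≤ (c₁ * 0.001) * L := by
            push_cast
            gcongr
            linarith
        _ = (c₁ * n * L) * (0.001 / n) := by field_simp
        _ ≤ _ := by gcongr
  have e2 : (List.finRange n).length * ((⌈c₁ * n * L⌉₊ : ℝ) * (2 * (δ / n) ^ 5)) ≤ δ := by
    rw [List.length_finRange]
    calc (n : ℝ) * ((⌈c₁ * n * L⌉₊ : ℝ) * (2 * (δ / n) ^ 5))
        ≤ n * ((c₁ * n * L + n) * (2 * (δ / n) ^ 5)) := by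
          gcongr
          exact hk2.trans (by linarith)
      _ = 2 * (c₁ * (L * δ) + δ) * (δ / n) ^ 3 * δ := by field_simp
      _ ≤ 2 * (c₁ * 1 + 1) * δ ^ 3 * 1 := by
          gcongr
          rw [div_le_iff₀ hn0]
          nlinarith
      _ ≤ 2 * (c₁ + 1) * δ ^ 2 := by nlinarith
      _ ≤ δ := hsq
  linarith

end Distinguish

/-! ### Routing -/

section Routing

/-- Summation by pushing the mass of every position to its two successors. -/
theorem sum_range_push {R : Type*} [CommSemiring R] {a b d u : ℕ → R} {k : ℕ}
    (h0 : b 0 = a 0 * d 0) (hs : ∀ j, b (j + 1) = a (j + 1) * d (j + 1) + a j * u j)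
    (ha : a (k + 1) = 0) (G : ℕ → R) :
    ∑ j ∈ Finset.range (k + 2), b j * G j =
      ∑ j ∈ Finset.range (k + 1), a j * (u j * G (j + 1) + d j * G j) := by
  rw [Finset.sum_range_succ', h0]
  simp only [hs, add_mul, mul_add, Finset.sum_add_distrib]
  have : ∑ j ∈ Finset.range (k + 1), a (j + 1) * d (j + 1) * G (j + 1) + a 0 * d 0 * G 0 =
      ∑ j ∈ Finset.range (k + 1), a j * (d j * G j) := by
    rw [← Finset.sum_range_succ' fun j => a j * d j * G j, Finset.sum_range_succ, ha]
    simp [mul_assoc]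
  rw [add_right_comm, this, add_comm]
  simp [mul_assoc]

variable {X : Type u} {H : Type v} [MeasurableSpace X] [MeasurableSpace H] {m n : ℕ}

/-- The law of a coin of bias `v`. -/
def coin (v : ℝ) : Measure Bool :=
  ENNReal.ofReal v • Measure.dirac true + ENNReal.ofReal (1 - v) • Measure.dirac false

theorem lintegral_coin (v : ℝ) (F : Bool → ℝ≥0∞) :
    ∫⁻ b, F b ∂(coin v) = ENNReal.ofReal v * F true + ENNReal.ofReal (1 - v) * F false := by
  simp [coin, lintegral_add_measure, lintegral_dirac' _ (measurable_of_finite F)]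

theorem isProbabilityMeasure_coin {v : ℝ} (h0 : 0 ≤ v) (h1 : v ≤ 1) :
    IsProbabilityMeasure (coin v) := by
  constructor
  have := lintegral_coin v 1
  simp only [Pi.one_apply, lintegral_one, mul_one] at this
  rw [this, ← ENNReal.ofReal_add h0 (by linarith)]
  simp

theorem coin_real_true {v : ℝ} (h0 : 0 ≤ v) : (coin v).real {true} = v := by
  simp [coin, measureReal_def, h0]

/-- The coin with a bias that depends measurably on a parameter, as a kernel. -/
def coinKernel {α : Type*} [MeasurableSpace α] (v : α → ℝ) (hv : Measurable v) : Kernel α Bool where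
  toFun a := coin (v a)
  measurable' := by
    refine Measure.measurable_of_measurable_coe _ fun s hs => ?_
    simp only [coin, Measure.add_apply, Measure.smul_apply, smul_eq_mul]
    fun_prop

theorem hasDist_coin_of_expect {A : Learner X H m n} {D₁ D₀ : Measure X} {f : X → Bool}
    {p : Prog X H m n Bool} {v : ℝ}
    (h : ∀ F, p.expect A D₁ D₀ f F = ENNReal.ofReal v * F true + ENNReal.ofReal (1 - v) * F false) :
    Prog.HasDist A D₁ D₀ f p (coin v) := fun F _ => by rw [h, lintegral_coin]

open Prog

variable (A : Learner X H m n)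

/-- The probability that the routing function given by `d` and `q` sends `x` up, that is from
`(i, t)` to `(i + 1, t + 1)`. -/
def stepUp (d : WeakDist X m n) (q : ℝ) (x : X) : ℝ :=
  (balanceBias q : ℝ) * acceptProb A d.trainSet (Function.update d.context d.slot x) +
    (1 - (balanceBias q : ℝ)) * ind (decide (q < 1 / 2))

/-- The probability that a node sends `x` up; it is `0` at a leaf. -/
def Node.up (N : Node X H m n) (x : X) : ℝ :=
  match N.next with
  | none => 0
  | some (d, q) => stepUp A d q x

/-- The probability that a node sends `x` down, that is from `(i, t)` to `(i, t + 1)`; it is `0` at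
a leaf. -/
def Node.down (N : Node X H m n) (x : X) : ℝ :=
  match N.next with
  | none => 0
  | some (d, q) => 1 - stepUp A d q x

/-- The indicator of the leaves. -/
def Node.leaf (N : Node X H m n) : ℝ :=
  match N.next with
  | none => 1
  | some _ => 0

/-- The probability that `x`, routed from the root `(1, 1)`, reaches the node `(j + 1, k + 1)`. -/
def posProb (P : Branching X H m n) (x : X) : ℕ → ℕ → ℝ
  | 0, 0 => 1
  | 0, _ + 1 => 0
  | k + 1, 0 => posProb P x k 0 * (P 1 (k + 1)).down A x
  | k + 1, j + 1 => posProb P x k (j + 1) * (P (j + 2) (k + 1)).down A x +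
      posProb P x k j * (P (j + 1) (k + 1)).up A x

section

variable {A} {N : Node X H m n}

theorem Node.up_of_next_eq_none (h : N.next = none) (x : X) : N.up A x = 0 := by simp [Node.up, h]

theorem Node.down_of_next_eq_none (h : N.next = none) (x : X) : N.down A x = 0 := by simp [Node.down, h]

omit [MeasurableSpace X] [MeasurableSpace H] in
theorem Node.leaf_of_next_eq_none (h : N.next = none) : N.leaf = 1 := by simp [Node.leaf, h]

end

variable {A} [IsMarkovKernel A]

theorem ind_nonneg (b : Bool) : 0 ≤ ind b := by cases b <;> simp [ind]

theorem ind_le_one (b : Bool) : ind b ≤ 1 := by cases b <;> simp [ind]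

omit [IsMarkovKernel A] in
theorem stepUp_nonneg (d : WeakDist X m n) (q : ℝ) (x : X) : 0 ≤ stepUp A d q x :=
  add_nonneg (mul_nonneg (balanceBias q).2.1 (acceptProb_nonneg _ _))
    (mul_nonneg (by linarith [(balanceBias q).2.2]) (ind_nonneg _))

theorem stepUp_le_one (d : WeakDist X m n) (q : ℝ) (x : X) : stepUp A d q x ≤ 1 := by
  have h1 := acceptProb_le_one (A := A) d.trainSet (Function.update d.context d.slot x)
  have h2 := ind_le_one (decide (q < 1 / 2))
  have h3 := (balanceBias q).2.1
  have h4 := (balanceBias q).2.2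
  unfold stepUp
  nlinarith

omit [IsMarkovKernel A] in
theorem measurable_stepUp (d : WeakDist X m n) (q : ℝ) : Measurable (stepUp A d q) := by
  have h := (measurable_acceptProb_right (A := A) d.trainSet).comp
    (measurable_update d.context (a := d.slot))
  exact (h.const_mul _).add_const _

omit [IsMarkovKernel A] in
theorem Node.up_nonneg (N : Node X H m n) (x : X) : 0 ≤ N.up A x := by
  unfold Node.up; split
  · exact le_rfl
  · exact stepUp_nonneg _ _ _

theorem Node.down_nonneg (N : Node X H m n) (x : X) : 0 ≤ N.down A x := by
  unfold Node.down; split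
  · exact le_rfl
  · linarith [stepUp_le_one (A := A) ‹_› ‹_› x]

omit [MeasurableSpace X] [MeasurableSpace H] in
theorem Node.leaf_nonneg (N : Node X H m n) : 0 ≤ N.leaf := by
  unfold Node.leaf; split <;> norm_num

omit [IsMarkovKernel A] in
theorem Node.up_add_down_add_leaf (N : Node X H m n) (x : X) :
    N.up A x + N.down A x + N.leaf = 1 := by
  unfold Node.up Node.down Node.leaf
  split <;> simp_all

omit [IsMarkovKernel A] in
theorem Node.measurable_up (N : Node X H m n) : Measurable (N.up A) := by
  unfold Node.up
  rcases N.next with _ | ⟨d, q⟩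
  · exact measurable_const
  · exact measurable_stepUp d q

omit [IsMarkovKernel A] in
theorem Node.measurable_down (N : Node X H m n) : Measurable (N.down A) := by
  unfold Node.down
  rcases N.next with _ | ⟨d, q⟩
  · exact measurable_const
  · exact (measurable_stepUp d q).const_sub _

theorem posProb_nonneg (P : Branching X H m n) (x : X) (k j : ℕ) : 0 ≤ posProb A P x k j := by
  induction k generalizing j with
  | zero => cases j <;> simp [posProb]
  | succ k ih =>
    cases j with
    | zero => exact mul_nonneg (ih _) (Node.down_nonneg _ _)
    | succ j =>
      exact add_nonneg (mul_nonneg (ih _) (Node.down_nonneg _ _))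
        (mul_nonneg (ih _) (Node.up_nonneg _ _))

omit [IsMarkovKernel A] in
theorem posProb_eq_zero (P : Branching X H m n) (x : X) {k j : ℕ} (h : k < j) :
    posProb A P x k j = 0 := by
  induction k generalizing j with
  | zero => cases j <;> simp_all [posProb]
  | succ k ih =>
    cases j with
    | zero => omega
    | succ j => simp [posProb, ih (show k < j + 1 by omega), ih (show k < j by omega)]

omit [IsMarkovKernel A] in
theorem measurable_posProb (P : Branching X H m n) (k j : ℕ) :
    Measurable fun x => posProb A P x k j := by
  induction k generalizing j with
  | zero => cases j <;> simp [posProb]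
  | succ k ih =>
    cases j with
    | zero => exact (ih _).mul (Node.measurable_down _)
    | succ j => exact ((ih _).mul (Node.measurable_down _)).add ((ih _).mul (Node.measurable_up _))

omit [IsMarkovKernel A] in
/-- The probability of reaching a node is determined by the nodes of lower levels. -/
theorem posProb_congr {P Q : Branching X H m n} {k : ℕ} (h : ∀ i t, t ≤ k → P i t = Q i t) (x : X)
    (j : ℕ) : posProb A P x k j = posProb A Q x k j := by
  induction k generalizing j with
  | zero => cases j <;> simp [posProb]
  | succ k ih =>
    have ih' := ih fun i t ht => h i t (by omega)
    cases j with
    | zero => simp only [posProb, ih', h _ (k + 1) le_rfl]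
    | succ j => simp only [posProb, ih', h _ (k + 1) le_rfl]

omit [IsMarkovKernel A] in
theorem sum_posProb_mul (P : Branching X H m n) (x : X) (k : ℕ) (G : ℕ → ℝ) :
    ∑ j ∈ Finset.range (k + 2), posProb A P x (k + 1) j * G j =
      ∑ j ∈ Finset.range (k + 1), posProb A P x k j *
        ((P (j + 1) (k + 1)).up A x * G (j + 1) + (P (j + 1) (k + 1)).down A x * G j) :=
  sum_range_push rfl (fun _ => rfl) (posProb_eq_zero P x (Nat.lt_succ_self k)) G

theorem sum_ofReal_posProb_mul (P : Branching X H m n) (x : X) (k : ℕ) (G : ℕ → ℝ≥0∞) :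
    ∑ j ∈ Finset.range (k + 2), ENNReal.ofReal (posProb A P x (k + 1) j) * G j =
      ∑ j ∈ Finset.range (k + 1), ENNReal.ofReal (posProb A P x k j) *
        (ENNReal.ofReal ((P (j + 1) (k + 1)).up A x) * G (j + 1) +
          ENNReal.ofReal ((P (j + 1) (k + 1)).down A x) * G j) := by
  refine sum_range_push (a := fun j => ENNReal.ofReal (posProb A P x k j))
    (d := fun j => ENNReal.ofReal ((P (j + 1) (k + 1)).down A x))
    (u := fun j => ENNReal.ofReal ((P (j + 1) (k + 1)).up A x)) ?_ (fun j => ?_) ?_ G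
  · exact ENNReal.ofReal_mul (posProb_nonneg _ _ _ _)
  · rw [posProb, ENNReal.ofReal_add (mul_nonneg (posProb_nonneg _ _ _ _) (Node.down_nonneg _ _))
      (mul_nonneg (posProb_nonneg _ _ _ _) (Node.up_nonneg _ _)),
      ENNReal.ofReal_mul (posProb_nonneg _ _ _ _), ENNReal.ofReal_mul (posProb_nonneg _ _ _ _)]
  · simp [posProb_eq_zero P x (Nat.lt_succ_self k)]

theorem sum_posProb_le_one (P : Branching X H m n) (x : X) (k : ℕ) :
    ∑ j ∈ Finset.range (k + 1), posProb A P x k j ≤ 1 := by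
  induction k with
  | zero => simp [posProb]
  | succ k ih =>
    have := sum_posProb_mul (A := A) P x k fun _ => 1
    simp only [mul_one] at this
    rw [this]
    refine (Finset.sum_le_sum fun j _ => ?_).trans ih
    have h1 := Node.up_add_down_add_leaf (A := A) (P (j + 1) (k + 1)) x
    have h2 := Node.leaf_nonneg (P (j + 1) (k + 1))
    exact mul_le_of_le_one_right (posProb_nonneg _ _ _ _) (by linarith)

theorem posProb_le_one (P : Branching X H m n) (x : X) (k j : ℕ) : posProb A P x k j ≤ 1 := by
  rcases Nat.lt_or_ge k j with h | h
  · rw [posProb_eq_zero P x h]; exact zero_le_one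
  · exact (Finset.single_le_sum (fun j _ => posProb_nonneg (A := A) P x k j)
      (Finset.mem_range.mpr (by omega : j < k + 1))).trans (sum_posProb_le_one P x k)

variable {D₁ D₀ : Measure X} {f : X → Bool}

theorem acceptProb_compl {S : Fin m → X × Bool} {U : Fin n → X} :
    A (S, U) {r | r.accepts = true} = ENNReal.ofReal (acceptProb A S U) ∧
    A (S, U) {r | r.accepts = false} = ENNReal.ofReal (1 - acceptProb A S U) := by
  constructor
  · rw [acceptProb, measureReal_def, ENNReal.ofReal_toReal (measure_ne_top _ _)]
  · have := probReal_compl_eq_one_sub (μ := A (S, U)) (measurableSet_accepts (H := H))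
    rw [acceptProb, ← this, measureReal_def, ENNReal.ofReal_toReal (measure_ne_top _ _)]
    congr 1
    ext r
    simp

theorem expect_run (d : WeakDist X m n) (x : X) (F : Bool → ℝ≥0∞) :
    (d.run x).expect A D₁ D₀ f F =
      ENNReal.ofReal (acceptProb A d.trainSet (Function.update d.context d.slot x)) * F true +
      ENNReal.ofReal (1 - acceptProb A d.trainSet (Function.update d.context d.slot x)) * F false := by
  have h := (hasDist_run (A := A) (D₁ := D₁) (D₀ := D₀) (f := f) d x)
  rw [h F (measurable_of_finite F), WeakDist.kernel, Kernel.map_apply _ measurable_accepts,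
    lintegral_fintype]
  simp only [Fintype.univ_bool, Finset.mem_singleton, Bool.true_eq_false, not_false_eq_true,
    Finset.sum_insert, Finset.sum_singleton]
  rw [Measure.map_apply measurable_accepts (measurableSet_singleton _),
    Measure.map_apply measurable_accepts (measurableSet_singleton _), mul_comm (F true),
    mul_comm (F false), ← (acceptProb_compl (A := A)).1, ← (acceptProb_compl (A := A)).2]
  rfl

theorem expect_run_balance (d : WeakDist X m n) (q : ℝ) (x : X) (F : Bool → ℝ≥0∞) :
    ((d.run x).bind (balance q)).expect A D₁ D₀ f F =
      ENNReal.ofReal (stepUp A d q x) * F true + ENNReal.ofReal (1 - stepUp A d q x) * F false := by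
  have hb0 := (balanceBias q).2.1
  have hb1 := (balanceBias q).2.2
  have ha0 := acceptProb_nonneg (A := A) d.trainSet (Function.update d.context d.slot x)
  have ha1 := acceptProb_le_one (A := A) d.trainSet (Function.update d.context d.slot x)
  rw [expect_bind, expect_run]
  simp only [balance, expect, expect_steps, stepUp]
  set a := acceptProb A d.trainSet (Function.update d.context d.slot x)
  set β : ℝ := (balanceBias q : ℝ)
  have e1 : ENNReal.ofReal a + ENNReal.ofReal (1 - a) = 1 := by
    rw [← ENNReal.ofReal_add ha0 (by linarith)]; simp
  have hβ : 0 ≤ 1 - β := by linarith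
  have ha : 0 ≤ 1 - a := by linarith
  by_cases hq : q < 1 / 2
  · simp only [hq, decide_true, ind, if_true, mul_one, Bool.false_eq_true, if_false]
    rw [ENNReal.ofReal_add (by positivity) hβ, show 1 - (β * a + (1 - β)) = β * (1 - a) by ring,
      ENNReal.ofReal_mul hb0, ENNReal.ofReal_mul hb0]
    calc _ = (ENNReal.ofReal β * ENNReal.ofReal a + (ENNReal.ofReal a + ENNReal.ofReal (1 - a)) *
          ENNReal.ofReal (1 - β)) * F true + ENNReal.ofReal β * ENNReal.ofReal (1 - a) * F false := by
          ring
      _ = _ := by rw [e1, one_mul]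
  · simp only [hq, decide_false, ind, if_true, mul_zero, Bool.false_eq_true, if_false, add_zero]
    rw [show 1 - β * a = β * (1 - a) + (1 - β) by ring, ENNReal.ofReal_add (by positivity) hβ,
      ENNReal.ofReal_mul hb0, ENNReal.ofReal_mul hb0]
    calc _ = ENNReal.ofReal β * ENNReal.ofReal a * F true + (ENNReal.ofReal β * ENNReal.ofReal (1 - a) +
          (ENNReal.ofReal a + ENNReal.ofReal (1 - a)) * ENNReal.ofReal (1 - β)) * F false := by
          ring
      _ = _ := by rw [e1, one_mul]

/-- A single step of the routing. -/
theorem expect_walk_one (P : Branching X H m n) (x : X) (N : ℕ × ℕ) (F : ℕ × ℕ → ℝ≥0∞) :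
    (walk P x 1 N).expect A D₁ D₀ f F =
      ENNReal.ofReal ((P N.1 N.2).up A x) * F (N.1 + 1, N.2 + 1) +
      ENNReal.ofReal ((P N.1 N.2).down A x) * F (N.1, N.2 + 1) +
      ENNReal.ofReal (P N.1 N.2).leaf * F N := by
  simp only [walk, Node.up, Node.down, Node.leaf]
  rcases (P N.1 N.2).next with _ | ⟨d, q⟩
  · simp [expect]
  · have := expect_run_balance (A := A) (D₁ := D₁) (D₀ := D₀) (f := f) d q x
      fun b => F (if b then N.1 + 1 else N.1, N.2 + 1)
    rw [expect_bind] at this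
    simp only [expect, expect_bind]
    simpa using this

theorem expect_walk_succ (P : Branching X H m n) (x : X) (k : ℕ) (N : ℕ × ℕ) (F : ℕ × ℕ → ℝ≥0∞) :
    (walk P x (k + 1) N).expect A D₁ D₀ f F =
      (walk P x k N).expect A D₁ D₀ f fun N' => (walk P x 1 N').expect A D₁ D₀ f F := by
  induction k generalizing N with
  | zero => rfl
  | succ k ih =>
    cases h : (P N.1 N.2).next with
    | none =>
      have e : ∀ k, walk P x (k + 1) N = Prog.step (Prog.ret N) := fun k => by simp only [walk, h]
      rw [e, e]
      simp only [expect]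
      rw [expect_walk_one, Node.up_of_next_eq_none h, Node.down_of_next_eq_none h,
        Node.leaf_of_next_eq_none h]
      simp
    | some dq =>
      have e : ∀ k, walk P x (k + 1) N = Prog.step ((dq.1.run x).bind fun w =>
          (balance dq.2 w).bind fun b => walk P x k (if b then N.1 + 1 else N.1, N.2 + 1)) :=
        fun k => by simp only [walk, h]
      rw [e, e]
      simp only [expect, expect_bind]
      congr 1; funext w
      congr 1; funext b
      exact ih _

/-- The law of the position of `x` after at most `k` edges: either `k` edges were traversed, or the
route ended at a leaf of a lower level. -/
theorem expect_walk (P : Branching X H m n) (x : X) (k : ℕ) (F : ℕ × ℕ → ℝ≥0∞) :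
    (walk P x k (1, 1)).expect A D₁ D₀ f F =
      ∑ j ∈ Finset.range (k + 1), ENNReal.ofReal (posProb A P x k j) * F (j + 1, k + 1) +
      ∑ l ∈ Finset.range k, ∑ j ∈ Finset.range (l + 1), ENNReal.ofReal (posProb A P x l j) *
        (ENNReal.ofReal (P (j + 1) (l + 1)).leaf * F (j + 1, l + 1)) := by
  induction k generalizing F with
  | zero => simp [walk, expect, posProb]
  | succ k ih =>
    have hleaf : ∀ N : ℕ × ℕ, ENNReal.ofReal (P N.1 N.2).leaf *
        (walk P x 1 N).expect A D₁ D₀ f F = ENNReal.ofReal (P N.1 N.2).leaf * F N := fun N => by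
      rw [expect_walk_one]
      cases h : (P N.1 N.2).next with
      | none =>
        rw [Node.up_of_next_eq_none h, Node.down_of_next_eq_none h, Node.leaf_of_next_eq_none h]
        simp
      | some dq => simp [Node.leaf, h]
    have h1 := fun l j => hleaf (j + 1, l + 1)
    simp only at h1
    have h2 : ∑ j ∈ Finset.range (k + 1), ENNReal.ofReal (posProb A P x k j) *
          (walk P x 1 (j + 1, k + 1)).expect A D₁ D₀ f F =
        ∑ j ∈ Finset.range (k + 2), ENNReal.ofReal (posProb A P x (k + 1) j) *
          F (j + 1, k + 1 + 1) +
        ∑ j ∈ Finset.range (k + 1), ENNReal.ofReal (posProb A P x k j) *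
          (ENNReal.ofReal (P (j + 1) (k + 1)).leaf * F (j + 1, k + 1)) := by
      rw [sum_ofReal_posProb_mul P x k fun j => F (j + 1, k + 1 + 1), ← Finset.sum_add_distrib]
      refine Finset.sum_congr rfl fun j _ => ?_
      rw [expect_walk_one, ← mul_add]
    have h3 := Finset.sum_range_succ (fun l => ∑ j ∈ Finset.range (l + 1),
      ENNReal.ofReal (posProb A P x l j) *
        (ENNReal.ofReal (P (j + 1) (l + 1)).leaf * F (j + 1, l + 1))) k
    rw [expect_walk_succ, ih, h2, h3]
    simp only [h1]
    rw [add_assoc, add_comm (∑ j ∈ Finset.range (k + 1), _)]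

/-- The test of whether `x` reaches a node is a coin of bias `posProb`. -/
theorem expect_reaches [IsProbabilityMeasure D₁] [IsProbabilityMeasure D₀] (P : Branching X H m n)
    (x : X) {k j : ℕ} (hj : j ≤ k) (F : Bool → ℝ≥0∞) :
    (reaches P (j + 1) (k + 1) x).expect A D₁ D₀ f F =
      ENNReal.ofReal (posProb A P x k j) * F true +
      ENNReal.ofReal (1 - posProb A P x k j) * F false := by
  have h := fun F => expect_walk (A := A) (D₁ := D₁) (D₀ := D₀) (f := f) P x k F
  simp only [reaches, Nat.add_sub_cancel, expect_bind, expect_steps, expect]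
  have hs : ∀ F : ℕ × ℕ → ℝ≥0∞, ∑ i ∈ Finset.range (k + 1), ENNReal.ofReal (posProb A P x k i) *
      F (i + 1, k + 1) = ENNReal.ofReal (posProb A P x k j) * F (j + 1, k + 1) +
        ∑ i ∈ (Finset.range (k + 1)).erase j, ENNReal.ofReal (posProb A P x k i) *
          F (i + 1, k + 1) := fun F =>
    (Finset.add_sum_erase (Finset.range (k + 1)) (fun i => ENNReal.ofReal (posProb A P x k i) *
      F (i + 1, k + 1)) (Finset.mem_range.mpr (by omega))).symm
  have hne : ∀ i l, i ≠ j ∨ l ≠ k → F (decide ((i + 1, l + 1) = (j + 1, k + 1))) = F false :=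
    fun i l h => by
      rw [decide_eq_false]
      simp only [Prod.mk.injEq, Nat.add_right_cancel_iff]
      tauto
  have hrest : ∀ F : ℕ × ℕ → ℝ≥0∞, ∀ c, (∀ i l, i ≠ j ∨ l ≠ k → F (i + 1, l + 1) = c) →
      (walk P x k (1, 1)).expect A D₁ D₀ f F =
        ENNReal.ofReal (posProb A P x k j) * F (j + 1, k + 1) +
        (∑ i ∈ (Finset.range (k + 1)).erase j, ENNReal.ofReal (posProb A P x k i) +
          ∑ l ∈ Finset.range k, ∑ i ∈ Finset.range (l + 1), ENNReal.ofReal (posProb A P x l i) *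
            ENNReal.ofReal (P (i + 1) (l + 1)).leaf) * c := fun F c hF => by
    rw [h, hs, add_assoc, add_mul, Finset.sum_mul, Finset.sum_mul]
    congr 2
    · refine Finset.sum_congr rfl fun i hi => ?_
      rw [hF _ _ (Or.inl (Finset.ne_of_mem_erase hi))]
    · refine Finset.sum_congr rfl fun l hl => ?_
      rw [Finset.sum_mul]
      refine Finset.sum_congr rfl fun i _ => ?_
      rw [hF _ _ (Or.inr (Finset.mem_range.mp hl).ne), mul_assoc]
  have h1 := hrest (fun _ => 1) 1 fun _ _ _ => rfl
  rw [expect_const, mul_one, mul_one] at h1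
  rw [hrest (fun N => F (decide (N = (j + 1, k + 1)))) (F false) hne,
    ENNReal.ofReal_sub _ (posProb_nonneg _ _ _ _), ENNReal.ofReal_one]
  simp only [decide_true]
  congr 2
  refine ENNReal.eq_sub_of_add_eq ENNReal.ofReal_ne_top ?_
  rw [add_comm]
  exact h1.symm

end Routing

/-! ### Rejection sampling -/

section Rejection

/-- The law of the result of rejection sampling from `μ`, with at most `k` tested draws, where a draw
`a` passes the test with probability `v a`. -/
def rejectionLaw {α : Type*} [MeasurableSpace α] (μ : Measure α) (v : α → ℝ) : ℕ → Measure α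
  | 0 => μ
  | k + 1 => (μ.withDensity fun a => ENNReal.ofReal (v a)) +
      ENNReal.ofReal (1 - ∫ a, v a ∂μ) • rejectionLaw μ v k

section Abstract

variable {α : Type*} [MeasurableSpace α] {μ : Measure α} [IsProbabilityMeasure μ] {v : α → ℝ}

theorem ofReal_one_sub_integral (hv : Measurable v) (h0 : ∀ a, 0 ≤ v a) (h1 : ∀ a, v a ≤ 1) :
    ENNReal.ofReal (1 - ∫ a, v a ∂μ) = ∫⁻ a, ENNReal.ofReal (1 - v a) ∂μ := by
  have hi := integrable_of_mem (μ := μ) hv h0 h1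
  have hi' : Integrable (fun a => 1 - v a) μ := (integrable_const _).sub hi
  rw [← ofReal_integral_eq_lintegral_ofReal hi'
    (ae_of_all _ fun a => by simpa using h1 a), integral_sub (integrable_const _) hi]
  simp

theorem isProbabilityMeasure_rejectionLaw (hv : Measurable v) (h0 : ∀ a, 0 ≤ v a)
    (h1 : ∀ a, v a ≤ 1) (k : ℕ) : IsProbabilityMeasure (rejectionLaw μ v k) := by
  induction k with
  | zero => unfold rejectionLaw; infer_instance
  | succ k ih =>
    constructor
    rw [rejectionLaw, Measure.add_apply, Measure.smul_apply, withDensity_apply _ .univ,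
      measure_univ, Measure.restrict_univ, smul_eq_mul, mul_one, ofReal_one_sub_integral hv h0 h1,
      ← lintegral_add_left hv.ennreal_ofReal]
    simp_rw [← ENNReal.ofReal_add (h0 _) (sub_nonneg.mpr (h1 _))]
    simp

omit [IsProbabilityMeasure μ] in
theorem integral_withDensity_ofReal (hv : Measurable v) (h0 : ∀ a, 0 ≤ v a) (g : α → ℝ) :
    ∫ a, g a ∂(μ.withDensity fun a => ENNReal.ofReal (v a)) = ∫ a, v a * g a ∂μ := by
  rw [integral_withDensity_eq_integral_toReal_smul hv.ennreal_ofReal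
    (ae_of_all _ fun _ => ENNReal.ofReal_lt_top)]
  simp [ENNReal.toReal_ofReal (h0 _)]

/-- The exact error of rejection sampling: with probability `(1 - ∫ v) ^ k` no draw passes, and the
untested draw has law `μ` in place of the conditional distribution. -/
theorem integral_rejectionLaw_sub (hv : Measurable v) (h0 : ∀ a, 0 ≤ v a) (h1 : ∀ a, v a ≤ 1)
    {g : α → ℝ} (hg : Measurable g) (hg0 : ∀ a, 0 ≤ g a) (hg1 : ∀ a, g a ≤ 1) (k : ℕ) :
    (∫ a, v a ∂μ) * ∫ a, g a ∂(rejectionLaw μ v k) - ∫ a, v a * g a ∂μ =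
      (1 - ∫ a, v a ∂μ) ^ k * ((∫ a, v a ∂μ) * ∫ a, g a ∂μ - ∫ a, v a * g a ∂μ) := by
  induction k with
  | zero => simp [rejectionLaw]
  | succ k ih =>
    have hp := integral_mem_Icc (μ := μ) hv h0 h1
    have := isProbabilityMeasure_rejectionLaw (μ := μ) hv h0 h1 k
    have hfin : IsFiniteMeasure (μ.withDensity fun a => ENNReal.ofReal (v a)) :=
      isFiniteMeasure_withDensity_ofReal (integrable_of_mem hv h0 h1).2
    rw [rejectionLaw, integral_add_measure (integrable_of_mem hg hg0 hg1)
      ((integrable_of_mem hg hg0 hg1).smul_measure ENNReal.ofReal_ne_top),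
      integral_smul_measure, integral_withDensity_ofReal hv h0,
      ENNReal.toReal_ofReal (by linarith), smul_eq_mul, pow_succ]
    linear_combination (1 - ∫ a, v a ∂μ) * ih

/-- Rejection sampling is close to conditional sampling: multiplied by the probability `∫ v` of the
condition, the means differ by at most `(∫ v) (1 - ∫ v) ^ k`. -/
theorem abs_integral_rejectionLaw_sub_le (hv : Measurable v) (h0 : ∀ a, 0 ≤ v a)
    (h1 : ∀ a, v a ≤ 1) {g : α → ℝ} (hg : Measurable g) (hg0 : ∀ a, 0 ≤ g a)
    (hg1 : ∀ a, g a ≤ 1) (k : ℕ) :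
    |(∫ a, v a ∂μ) * ∫ a, g a ∂(rejectionLaw μ v k) - ∫ a, v a * g a ∂μ| ≤
      (∫ a, v a ∂μ) * (1 - ∫ a, v a ∂μ) ^ k := by
  have hp := integral_mem_Icc (μ := μ) hv h0 h1
  have hq := integral_mem_Icc (μ := μ) hg hg0 hg1
  have hvg : 0 ≤ ∫ a, v a * g a ∂μ := integral_nonneg fun a => mul_nonneg (h0 a) (hg0 a)
  have hvg' : ∫ a, v a * g a ∂μ ≤ ∫ a, v a ∂μ :=
    integral_mono (integrable_of_mem (hv.mul hg) (fun a => mul_nonneg (h0 a) (hg0 a))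
      fun a => mul_le_one₀ (h1 a) (hg0 a) (hg1 a)) (integrable_of_mem hv h0 h1)
      fun a => mul_le_of_le_one_right (h0 a) (hg1 a)
  have hs : 0 ≤ (1 - ∫ a, v a ∂μ) ^ k := pow_nonneg (by linarith) k
  rw [integral_rejectionLaw_sub hv h0 h1 hg hg0 hg1, abs_mul, abs_of_nonneg hs, mul_comm]
  refine mul_le_mul_of_nonneg_right ?_ hs
  rw [abs_le]
  constructor <;> nlinarith

end Abstract

variable {X : Type u} {H : Type v} [MeasurableSpace X] [MeasurableSpace H] {m n : ℕ}
  {A : Learner X H m n} {D₁ D₀ : Measure X} {f : X → Bool}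

open Prog

/-- Rejection sampling produces `rejectionLaw` if the test is a coin of bias `v a` for every `a`. -/
theorem hasDist_rejectionSample {α : Type u} [MeasurableSpace α] {μ : Measure α}
    [IsProbabilityMeasure μ] {draw : Prog X H m n α}
    (hdraw : HasDist A D₁ D₀ f draw μ) {v : α → ℝ} (hv : Measurable v) (h0 : ∀ a, 0 ≤ v a)
    (h1 : ∀ a, v a ≤ 1) {V : α → Prog X H m n Bool}
    (hV : ∀ a F, (V a).expect A D₁ D₀ f F =
      ENNReal.ofReal (v a) * F true + ENNReal.ofReal (1 - v a) * F false) (k : ℕ) :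
    HasDist A D₁ D₀ f (rejectionSample draw V k) (rejectionLaw μ v k) := by
  induction k with
  | zero => exact hdraw
  | succ k ih =>
    intro F hF
    simp only [rejectionSample, expect, expect_bind, hV, if_true, Bool.false_eq_true, if_false, ih F hF]
    rw [rejectionLaw, lintegral_add_measure, lintegral_smul_measure,
      lintegral_withDensity_eq_lintegral_mul _ hv.ennreal_ofReal hF,
      ofReal_one_sub_integral hv h0 h1, smul_eq_mul,
      ← lintegral_mul_const _ (hv.const_sub 1).ennreal_ofReal,
      ← lintegral_add_left (hv.ennreal_ofReal.mul hF)]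
    exact hdraw _ ((hv.ennreal_ofReal.mul hF).add ((hv.const_sub 1).ennreal_ofReal.mul_const _))

theorem rejectionLaw_labeled (hf : Measurable f) {D : Measure X} {v : X → ℝ} (hv : Measurable v)
    (k : ℕ) : rejectionLaw (labeled D f) (fun s => v s.1) k = labeled (rejectionLaw D v k) f := by
  have hm : Measurable fun x => (x, f x) := by fun_prop
  induction k with
  | zero => rfl
  | succ k ih =>
    simp only [rejectionLaw]
    rw [ih]
    simp only [labeled]
    have hint : ∫ s, v s.1 ∂(D.map fun x => (x, f x)) = ∫ x, v x ∂D :=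
      integral_map hm.aemeasurable (hv.comp measurable_fst).aestronglyMeasurable
    rw [Measure.map_add _ _ hm, Measure.map_smul, hint]
    congr 1
    ext s hs
    rw [withDensity_apply _ hs, Measure.map_apply hm hs, withDensity_apply _ (hm hs)]
    exact setLIntegral_map hs (hv.comp measurable_fst).ennreal_ofReal hm

variable [IsMarkovKernel A] [IsProbabilityMeasure D₁] [IsProbabilityMeasure D₀]

/-- The law of a sample from `D` conditioned, by rejection sampling, on reaching
`(j + 1, k + 1)`. -/
def nodeLaw (A : Learner X H m n) (D : Measure X) (a : ℕ) (P : Branching X H m n) (k j : ℕ) :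
    Measure X :=
  rejectionLaw D (fun x => posProb A P x k j) a

theorem isProbabilityMeasure_nodeLaw (D : Measure X) [IsProbabilityMeasure D] (a : ℕ)
    (P : Branching X H m n) (k j : ℕ) : IsProbabilityMeasure (nodeLaw A D a P k j) :=
  isProbabilityMeasure_rejectionLaw (measurable_posProb P k j) (fun x => posProb_nonneg P x k j)
    (fun x => posProb_le_one P x k j) a

theorem hasDist_sampleTest (a : ℕ) (P : Branching X H m n) {k j : ℕ} (hj : j ≤ k) :
    HasDist A D₁ D₀ f (sampleTest a P (j + 1) (k + 1)) (nodeLaw A D₀ a P k j) :=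
  hasDist_rejectionSample hasDist_drawTest (measurable_posProb P k j)
    (fun x => posProb_nonneg P x k j) (fun x => posProb_le_one P x k j)
    (fun x F => expect_reaches P x hj F) a

theorem hasDist_sampleTrain (hf : Measurable f) (a : ℕ) (P : Branching X H m n) {k j : ℕ}
    (hj : j ≤ k) :
    HasDist A D₁ D₀ f (sampleTrain a P (j + 1) (k + 1)) (labeled (nodeLaw A D₁ a P k j) f) := by
  have := isProbabilityMeasure_labeled (D := D₁) hf
  rw [nodeLaw, ← rejectionLaw_labeled hf (measurable_posProb P k j)]
  exact hasDist_rejectionSample (hasDist_drawTrain hf) ((measurable_posProb P k j).comp measurable_fst)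
    (fun s => posProb_nonneg P s.1 k j) (fun s => posProb_le_one P s.1 k j)
    (fun s F => expect_reaches P s.1 hj F) a

/-- The probability that a sample from `D` reaches the node `(j + 1, k + 1)`. -/
def nodeMass (A : Learner X H m n) (D : Measure X) (P : Branching X H m n) (k j : ℕ) : ℝ :=
  ∫ x, posProb A P x k j ∂D

theorem bind_coinKernel_real {α : Type*} [MeasurableSpace α] {μ : Measure α}
    [IsProbabilityMeasure μ] {v : α → ℝ} (hv : Measurable v) (h0 : ∀ a, 0 ≤ v a)
    (h1 : ∀ a, v a ≤ 1) :
    IsProbabilityMeasure (μ.bind (coinKernel v hv)) ∧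
      (μ.bind (coinKernel v hv)).real {true} = ∫ a, v a ∂μ := by
  have : IsMarkovKernel (coinKernel v hv) := ⟨fun a => isProbabilityMeasure_coin (h0 a) (h1 a)⟩
  refine ⟨inferInstance, ?_⟩
  rw [real_bind _ _ (measurableSet_singleton _)]
  exact integral_congr_ae (ae_of_all _ fun a => coin_real_true (h0 a))

omit [IsMarkovKernel A] [IsProbabilityMeasure D₁] [IsProbabilityMeasure D₀] in
/-- Estimating the probability that a random draw passes a randomized test. -/
theorem whp_estimate_bind {α : Type*} [MeasurableSpace α] {μ : Measure α}
    [IsProbabilityMeasure μ] {draw : Prog X H m n α}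
    (hdraw : HasDist A D₁ D₀ f draw μ) {v : α → ℝ} (hv : Measurable v) (h0 : ∀ a, 0 ≤ v a)
    (h1 : ∀ a, v a ≤ 1) {V : α → Prog X H m n Bool}
    (hV : ∀ a F, (V a).expect A D₁ D₀ f F =
      ENNReal.ofReal (v a) * F true + ENNReal.ofReal (1 - v a) * F false)
    {γ δ : ℝ} (hγ : 0 < γ) (hδ : 0 < δ) :
    Whp A D₁ D₀ f (estimate γ δ (draw.bind V)) {y | |y - ∫ a, v a ∂μ| ≤ γ} δ := by
  obtain ⟨hp, hr⟩ := bind_coinKernel_real (μ := μ) hv h0 h1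
  rw [← hr]
  exact (hdraw.bind (κ := coinKernel v hv) fun a => hasDist_coin_of_expect (hV a)).whp_estimate hγ hδ

theorem whp_estimate_train (hf : Measurable f) (P : Branching X H m n) {k j : ℕ} (hj : j ≤ k)
    {γ δ : ℝ} (hγ : 0 < γ) (hδ : 0 < δ) :
    Whp A D₁ D₀ f (estimate γ δ (drawTrain.bind fun s => reaches P (j + 1) (k + 1) s.1))
      {y | |y - nodeMass A D₁ P k j| ≤ γ} δ := by
  have := isProbabilityMeasure_labeled (D := D₁) hf
  have h := whp_estimate_bind (hasDist_drawTrain (A := A) (D₁ := D₁) (D₀ := D₀) hf)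
    ((measurable_posProb (A := A) P k j).comp measurable_fst)
    (fun s => posProb_nonneg P s.1 k j) (fun s => posProb_le_one P s.1 k j)
    (fun s F => expect_reaches P s.1 hj F) hγ hδ
  rwa [labeled, integral_map (by fun_prop)
    ((measurable_posProb (A := A) P k j).comp measurable_fst).aestronglyMeasurable] at h

theorem whp_estimate_test (P : Branching X H m n) {k j : ℕ} (hj : j ≤ k)
    {γ δ : ℝ} (hγ : 0 < γ) (hδ : 0 < δ) :
    Whp A D₁ D₀ f (estimate γ δ (drawTest.bind fun x => reaches P (j + 1) (k + 1) x))
      {y | |y - nodeMass A D₀ P k j| ≤ γ} δ :=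
  whp_estimate_bind hasDist_drawTest (measurable_posProb P k j)
    (fun x => posProb_nonneg P x k j) (fun x => posProb_le_one P x k j)
    (fun x F => expect_reaches P x hj F) hγ hδ

end Rejection

/-! ### Runs of the learner on given samplers -/

section Answers

variable {X : Type u} {H : Type v} [MeasurableSpace X] [MeasurableSpace H] {m n : ℕ}
  {A : Learner X H m n} [IsMarkovKernel A]
  {G₁ G₀ : Measure X} [IsProbabilityMeasure G₁] [IsProbabilityMeasure G₀]
  {D₁ D₀ : Measure X} {f : X → Bool}
  {draw₁ : Prog X H m n (X × Bool)} {draw₀ : Prog X H m n X}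

open Prog

theorem isProbabilityMeasure_answerLaw (hf : Measurable f) :
    IsProbabilityMeasure (answerLaw A G₁ G₀ f) := by
  have := isProbabilityMeasure_labeled (D := G₁) hf
  unfold answerLaw
  infer_instance

/-- The acceptance probability is the mean over the samples. -/
theorem answerLaw_real_accepts (hf : Measurable f) :
    (answerLaw A G₁ G₀ f).real {r | r.accepts = true} =
      ∫ S, ∫ U, acceptProb A S U ∂(Measure.pi fun _ : Fin n => G₀)
        ∂(Measure.pi fun _ : Fin m => labeled G₁ f) := by
  have := isProbabilityMeasure_labeled (D := G₁) hf
  rw [answerLaw, real_bind _ _ measurableSet_accepts, integral_prod]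
  · rfl
  · exact integrable_of_mem measurable_acceptProb (fun _ => acceptProb_nonneg _ _)
      fun _ => acceptProb_le_one _ _

/-- The mean acceptance gap. It is large if the learner accepts on `G₁`, `G₁` but not on `G₁`, `G₀`. -/
theorem integral_acceptGap (hf : Measurable f) :
    ∫ S, acceptGap A G₁ G₀ S ∂(Measure.pi fun _ : Fin m => labeled G₁ f) =
      (answerLaw A G₁ G₁ f).real {r | r.accepts = true} -
        (answerLaw A G₁ G₀ f).real {r | r.accepts = true} := by
  have := isProbabilityMeasure_labeled (D := G₁) hf
  have hint : ∀ (G : Measure X) [IsProbabilityMeasure G],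
      Integrable (fun S => ∫ U, acceptProb A S U ∂(Measure.pi fun _ : Fin n => G))
        (Measure.pi fun _ : Fin m => labeled G₁ f) := fun G _ =>
    integrable_of_mem (measurable_acceptProb (A := A)).stronglyMeasurable.integral_prod_right'.measurable
      (fun S => (integral_mem_Icc (measurable_acceptProb_right S)
        (fun _ => acceptProb_nonneg _ _) fun _ => acceptProb_le_one _ _).1)
      (fun S => (integral_mem_Icc (measurable_acceptProb_right S)
        (fun _ => acceptProb_nonneg _ _) fun _ => acceptProb_le_one _ _).2)
  unfold acceptGap
  rw [integral_sub (hint _) (hint _), answerLaw_real_accepts hf, answerLaw_real_accepts hf]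

omit [IsMarkovKernel A] in
theorem hasDist_runOn (hf : Measurable f) (h₁ : HasDist A D₁ D₀ f draw₁ (labeled G₁ f))
    (h₀ : HasDist A D₁ D₀ f draw₀ G₀) :
    HasDist A D₁ D₀ f (runOn draw₁ draw₀) (answerLaw A G₁ G₀ f) := by
  have := isProbabilityMeasure_labeled (D := G₁) hf
  intro F hF
  have hG : Measurable fun z => ∫⁻ r, F r ∂A z := hF.lintegral_kernel
  rw [answerLaw, Measure.lintegral_bind A.measurable.aemeasurable hF.aemeasurable,
    lintegral_prod _ hG.aemeasurable, runOn, expect_bind,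
    ← hasDist_tuple (fun _ => h₁) _ hG.lintegral_prod_right']
  congr 1
  funext S
  rw [expect_bind]
  refine Eq.trans ?_ (hasDist_tuple (fun _ => h₀) _ (hG.comp (measurable_prodMk_left (x := S))))
  congr 1
  funext U
  exact hasDist_runA S U F hF

theorem whp_estimate_accepts (hf : Measurable f) (h₁ : HasDist A D₁ D₀ f draw₁ (labeled G₁ f))
    (h₀ : HasDist A D₁ D₀ f draw₀ G₀) {γ δ : ℝ} (hγ : 0 < γ) (hδ : 0 < δ) :
    Whp A D₁ D₀ f (estimate γ δ ((runOn draw₁ draw₀).bind fun a => ret a.accepts))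
      {y | |y - (answerLaw A G₁ G₀ f).real {r | r.accepts = true}| ≤ γ} δ := by
  have := isProbabilityMeasure_answerLaw (A := A) (G₁ := G₁) (G₀ := G₀) hf
  have := Measure.isProbabilityMeasure_map (μ := answerLaw A G₁ G₀ f)
    (measurable_accepts (H := H)).aemeasurable
  have h := ((hasDist_runOn hf h₁ h₀).bind_map (measurable_accepts (H := H))
    (q := fun a => ret a.accepts) fun a F => rfl).whp_estimate hγ hδ
  rwa [map_measureReal_apply measurable_accepts (measurableSet_singleton _)] at h

theorem whp_estimate_mixture (hf : Measurable f) (h₁ : HasDist A D₁ D₀ f draw₁ (labeled G₁ f))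
    (h₀ : HasDist A D₁ D₀ f draw₀ G₀) (d : WeakDist X m n) {γ δ : ℝ} (hγ : 0 < γ) (hδ : 0 < δ) :
    Whp A D₁ D₀ f (estimate γ δ ((sampleMixture draw₁ draw₀).bind fun x => d.run x))
      {y | |y - ((∫ x, acceptProb A d.trainSet (Function.update d.context d.slot x) ∂G₁) +
        ∫ x, acceptProb A d.trainSet (Function.update d.context d.slot x) ∂G₀) / 2| ≤ γ} δ := by
  have h2 : ENNReal.ofReal (1 / 2) + ENNReal.ofReal (1 / 2) = 1 := by
    rw [← ENNReal.ofReal_add (by norm_num) (by norm_num)]; norm_num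
  have hm := (measurable_acceptProb_right (A := A) d.trainSet).comp
    (measurable_update d.context (a := d.slot))
  have hp : IsProbabilityMeasure (ENNReal.ofReal (1 / 2) • G₁ + ENNReal.ofReal (1 / 2) • G₀) := by
    constructor
    simpa using h2
  have hmix : HasDist A D₁ D₀ f (sampleMixture draw₁ draw₀)
      (ENNReal.ofReal (1 / 2) • G₁ + ENNReal.ofReal (1 / 2) • G₀) := fun F hF => by
    have e1 := h₁.bind_fst hf F hF
    have e0 := h₀ F hF
    rw [lintegral_add_measure, lintegral_smul_measure, lintegral_smul_measure, ← e1, ← e0]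
    simp only [sampleMixture, expect, if_true, Bool.false_eq_true, if_false, smul_eq_mul]
    norm_num
  have h := whp_estimate_bind hmix hm (fun _ => acceptProb_nonneg _ _)
    (fun _ => acceptProb_le_one _ _) (fun x F => expect_run d x F) hγ hδ
  have hint : ∀ (G : Measure X) [IsProbabilityMeasure G], Integrable (fun x =>
      acceptProb A d.trainSet (Function.update d.context d.slot x)) G := fun G _ =>
    integrable_of_mem hm (fun _ => acceptProb_nonneg _ _) fun _ => acceptProb_le_one _ _
  convert h using 6
  simp only [Function.comp_def]
  rw [integral_add_measure ((hint G₁).smul_measure ENNReal.ofReal_ne_top)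
    ((hint G₀).smul_measure ENNReal.ofReal_ne_top), integral_smul_measure, integral_smul_measure,
    ENNReal.toReal_ofReal (by norm_num)]
  simp only [smul_eq_mul]
  ring

end Answers

/-! ### Majority votes -/

section Majority

variable {X : Type u} {H : Type v} [MeasurableSpace X] [MeasurableSpace H] {m n : ℕ}

/-- Does the answer accept with a hypothesis in `p`? -/
def Answer.acceptsIn {H : Type v} (p : H → Bool) (r : Answer H) : Bool :=
  Sum.elim (fun _ => false) p r

open Prog

omit [MeasurableSpace H] in
theorem countP_acceptedHyps (p : H → Bool) {r : ℕ} (a : Fin r → Answer H) :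
    ((acceptedHyps a).countP p : ℝ) = ∑ j, ind ((a j).acceptsIn p) := by
  induction r with
  | zero => simp [acceptedHyps]
  | succ r ih =>
    rw [Fin.sum_univ_succ, ← ih fun j => a j.succ]
    unfold acceptedHyps
    rw [List.ofFn_succ, List.filterMap_cons]
    cases h : a 0 with
    | inl u => simp [Answer.acceptsIn, ind]
    | inr h' => cases hp : p h' <;> simp [Answer.acceptsIn, ind, hp, add_comm]

omit [MeasurableSpace H] in
theorem length_acceptedHyps {r : ℕ} (a : Fin r → Answer H) :
    ((acceptedHyps a).length : ℝ) = ∑ j, ind (a j).accepts := by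
  rw [← List.countP_true, countP_acceptedHyps]
  refine Finset.sum_congr rfl fun j _ => ?_
  cases a j <;> rfl

omit [MeasurableSpace X] [MeasurableSpace H] in
/-- Where the majority vote errs, at least half of the votes err. -/
theorem length_le_of_majority_ne (ev : H → X → Bool) (f : X → Bool) (hs : List H) (x : X)
    (h : f x ≠ majority ev hs x) : hs.length ≤ 2 * hs.countP fun h => decide (f x ≠ ev h x) := by
  have hlen := List.length_eq_countP_add_countP (fun h => ev h x) (l := hs)
  unfold majority at h
  cases hf : f x
  · have e : (hs.countP fun h => decide (false ≠ ev h x)) = hs.countP fun h => ev h x := by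
      congr 1; ext h; cases ev h x <;> rfl
    rw [e]
    by_contra hlt
    rw [hf, decide_eq_false hlt] at h
    exact h rfl
  · have e : (hs.countP fun h => decide (true ≠ ev h x)) =
        hs.countP fun h => decide ¬(ev h x = true) := by
      congr 1; ext h; cases ev h x <;> rfl
    rw [e]
    by_contra hlt
    rw [hf, decide_eq_true (by omega)] at h
    exact h rfl

variable {ev : H → X → Bool} {f : X → Bool}

theorem measurable_ne (hev : Measurable (Function.uncurry ev)) (hf : Measurable f) (h : H) :
    MeasurableSet {x | f x ≠ ev h x} :=
  (measurableSet_eq_fun hf (hev.comp (measurable_prodMk_left (x := h)))).compl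

omit [MeasurableSpace H] in
theorem measurable_countP (p : H → X → Bool) (hp : ∀ h, Measurable (p h)) (hs : List H) :
    Measurable fun x => hs.countP fun h => p h x := by
  induction hs with
  | nil => simp
  | cons h hs ih =>
    simp only [List.countP_cons]
    exact ih.add (Measurable.ite ((hp h) (measurableSet_singleton true)) measurable_const
      measurable_const)

theorem measurable_majority (hev : Measurable (Function.uncurry ev)) (hs : List H) :
    Measurable (majority ev hs) := by
  have h := measurable_countP ev (fun h => hev.comp (measurable_prodMk_left (x := h))) hs
  exact (measurable_from_top (f := fun k : ℕ => decide (hs.length ≤ 2 * k))).comp h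

variable {G : Measure X} [IsProbabilityMeasure G]

theorem measurable_error (hev : Measurable (Function.uncurry ev)) (hf : Measurable f) :
    Measurable fun h => G.real {x | f x ≠ ev h x} := by
  have hs : MeasurableSet {z : H × X | f z.2 ≠ ev z.1 z.2} :=
    (measurableSet_eq_fun (hf.comp measurable_snd) hev).compl
  exact (measurable_measure_prodMk_left hs).ennreal_toReal

/-- If at least nine tenths of the runs accept, and at most one twentieth of them accept with a
hypothesis of error above `ε`, the majority vote of the accepting runs has error at most `4 ε`. -/
theorem majority_error_le (hev : Measurable (Function.uncurry ev)) (hf : Measurable f) {ε : ℝ}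
    (hε : 0 ≤ ε) {r : ℕ} (hr : 0 < r) (a : Fin r → Answer H)
    (hacc : 0.9 * r ≤ ∑ j, ind (a j).accepts)
    (hbad : ∑ j, ind ((a j).acceptsIn fun h => decide (ε < G.real {x | f x ≠ ev h x})) ≤ 0.05 * r) :
    G.real {x | f x ≠ majority ev (acceptedHyps a) x} ≤ 4 * ε := by
  have hr0 : (0 : ℝ) < r := by exact_mod_cast hr
  set bad : H → Bool := fun h => decide (ε < G.real {x | f x ≠ ev h x}) with hbad_def
  have hE : MeasurableSet {x | f x ≠ majority ev (acceptedHyps a) x} :=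
    (measurableSet_eq_fun hf (measurable_majority hev _)).compl
  set w : Fin r → X → ℝ := fun j x =>
    ind ((a j).acceptsIn fun h => !bad h && decide (f x ≠ ev h x)) with hw
  have hw_meas : ∀ j, Measurable (w j) := fun j => by
    refine measurable_ind.comp ?_
    cases h : a j with
    | inl u => exact measurable_const
    | inr h' =>
      simp only [Answer.acceptsIn, Sum.elim_inr]
      refine (measurable_of_finite fun b : Bool => !bad h' && b).comp ?_
      exact measurable_to_bool (by
        convert measurable_ne hev hf h' using 1
        ext x; simp)
  have hw_int : ∀ j, Integrable (w j) G := fun j =>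
    integrable_of_mem (hw_meas j) (fun _ => ind_nonneg _) fun _ => ind_le_one _
  have hw_le : ∀ j, ∫ x, w j x ∂G ≤ ε := fun j => by
    cases h : a j with
    | inl u => simpa [hw, h, Answer.acceptsIn, ind] using hε
    | inr h' =>
      cases hb : bad h' with
      | true => simpa [hw, h, Answer.acceptsIn, ind, hb] using hε
      | false =>
        have hle : G.real {x | f x ≠ ev h' x} ≤ ε := by simpa [hbad_def] using hb
        refine le_trans (le_of_eq ?_) hle
        rw [← integral_indicator_one (measurable_ne hev hf h')]
        refine integral_congr_ae (ae_of_all _ fun x => ?_)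
        by_cases hx : f x = ev h' x <;> simp [hw, h, Answer.acceptsIn, ind, hb, hx]
  have hpt : ∀ x, {x | f x ≠ majority ev (acceptedHyps a) x}.indicator (fun _ => 0.4 * (r : ℝ)) x ≤
      ∑ j, w j x := fun x => by
    by_cases hx : f x ≠ majority ev (acceptedHyps a) x
    · rw [Set.indicator_of_mem (by exact hx)]
      have h1 : ((acceptedHyps a).length : ℝ) ≤
          2 * ((acceptedHyps a).countP fun h => decide (f x ≠ ev h x) : ℕ) := by
        exact_mod_cast length_le_of_majority_ne ev f _ x hx
      rw [length_acceptedHyps, countP_acceptedHyps] at h1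
      have h2 : ∑ j, ind ((a j).acceptsIn fun h => decide (f x ≠ ev h x)) ≤
          ∑ j, (ind ((a j).acceptsIn bad) + w j x) := by
        refine Finset.sum_le_sum fun j _ => ?_
        cases h : a j with
        | inl u => simp [hw, h, Answer.acceptsIn, ind]
        | inr h' =>
          cases hb : bad h' <;> by_cases hx : f x = ev h' x <;>
            simp [hw, h, Answer.acceptsIn, ind, hb, hx]
      rw [Finset.sum_add_distrib] at h2
      linarith
    · rw [Set.indicator_of_notMem (by exact hx)]
      exact Finset.sum_nonneg fun j _ => ind_nonneg _
  have hfin := integral_mono (μ := G) ((integrable_const (0.4 * (r : ℝ))).indicator hE)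
    (integrable_finsetSum _ fun j _ => hw_int j) hpt
  rw [integral_indicator_const _ hE, integral_finsetSum _ fun j _ => hw_int j] at hfin
  have hsum : ∑ j, ∫ x, w j x ∂G ≤ r * ε := by
    refine (Finset.sum_le_sum fun j _ => hw_le j).trans ?_
    simp
  rw [smul_eq_mul] at hfin
  have h3 : r * (0.4 * G.real {x | f x ≠ majority ev (acceptedHyps a) x}) ≤ r * ε := by linarith
  have h4 := le_of_mul_le_mul_left h3 hr0
  linarith

variable {A : Learner X H m n} {D₁ D₀ : Measure X} {g : X → Bool}

/-- The frequency of an event in independent runs. -/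
theorem whp_tuple_freq {α : Type w} [MeasurableSpace α] {q : Prog X H m n α} {μ : Measure α}
    [IsProbabilityMeasure μ] (hq : HasDist A D₁ D₀ g q μ) {p₁ p₂ : α → Bool} (hp₁ : Measurable p₁)
    (hp₂ : Measurable p₂) {s : ℝ} (hs : 0 ≤ s) (r : ℕ) (hr : 0 < r) :
    Whp A D₁ D₀ g (tuple r fun _ => q)
      {a | (μ.real {x | p₁ x = true} - s) * r ≤ ∑ j, ind (p₁ (a j)) ∧
        ∑ j, ind (p₂ (a j)) ≤ (μ.real {x | p₂ x = true} + s) * r}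
      (4 * Real.exp (-(2 * r * s ^ 2))) := by
  have hr0 : (0 : ℝ) < r := by exact_mod_cast hr
  have hind : ∀ p : α → Bool, Measurable p → ∫ x, ind (p x) ∂μ = μ.real {x | p x = true} :=
    fun p hp => by
      have hE : MeasurableSet {x | p x = true} := hp (measurableSet_singleton true)
      rw [← integral_indicator_one hE]
      refine integral_congr_ae (ae_of_all _ fun x => ?_)
      cases h : p x <;> simp [ind, h]
  have hm : ∀ p : α → Bool, Measurable p → MeasurableSet {a : Fin r → α |
      |(∑ j, ind (p (a j))) / r - ∫ x, ind (p x) ∂μ| ≤ s} := fun p hp => by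
    have h1 : ∀ j : Fin r, Measurable fun a : Fin r → α => ind (p (a j)) := fun j =>
      measurable_ind.comp (hp.comp (measurable_pi_apply j))
    have h2 : Measurable fun a : Fin r → α => |(∑ j, ind (p (a j))) / r - ∫ x, ind (p x) ∂μ| := by
      fun_prop
    exact measurableSet_le h2 measurable_const
  have hh : ∀ p : α → Bool, Measurable p → _ := fun p hp =>
    hoeffding (μ := μ) (measurable_ind.comp hp) one_pos (fun x => ⟨ind_nonneg _, ind_le_one _⟩) r hs
  simp only [Function.comp_def, sub_zero, one_pow, div_one] at hh
  refine (hasDist_tuple fun _ => hq).whp ((hm p₁ hp₁).inter (hm p₂ hp₂)) ?_ ?_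
  · rw [Set.compl_inter]
    refine (measureReal_union_le _ _).trans ((add_le_add (hh p₁ hp₁) (hh p₂ hp₂)).trans ?_)
    linarith
  · rintro a ⟨h1, h2⟩
    have h1' := (abs_le.mp (show |_| ≤ s from h1)).1
    have h2' := (abs_le.mp (show |_| ≤ s from h2)).2
    rw [hind p₁ hp₁] at h1'
    rw [hind p₂ hp₂] at h2'
    constructor
    · rw [← le_div_iff₀ hr0]; linarith
    · rw [← div_le_iff₀ hr0]; linarith

end Majority

/-! ### Parameters of the algorithm -/

section Parameters

variable {c ε δ : ℝ} {M T : ℕ}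

theorem le_numLevels : c * (M : ℝ) ^ 2 * Real.log (1 / ε) ≤ numLevels c M ε := Nat.le_ceil _

theorem one_le_log_inv (hε : 0 < ε) (hε1 : ε ≤ 1 / 100) : 1 ≤ Real.log (1 / ε) := by
  rw [Real.le_log_iff_exp_le (by positivity), le_div_iff₀ hε]
  have := Real.exp_one_lt_d9
  nlinarith

theorem le_numLevels' (hc : 0 ≤ c) (hε : 0 < ε) (hε1 : ε ≤ 1 / 100) :
    c * (M : ℝ) ^ 2 ≤ numLevels c M ε :=
  le_trans (le_mul_of_one_le_right (by positivity) (one_le_log_inv hε hε1)) le_numLevels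

theorem pMin_add_gammaOne (hT : 0 < T) : pMin T ε + gammaOne T ε = ε / (T * (T + 1)) := by
  have : (0 : ℝ) < T := by exact_mod_cast hT
  unfold pMin gammaOne
  field_simp
  ring

theorem pMin_pos (hT : 0 < T) (hε : 0 < ε) : 0 < pMin T ε := by
  have : (0 : ℝ) < T := by exact_mod_cast hT
  unfold pMin
  positivity

theorem gammaOne_eq (hT : 0 < T) : gammaOne T ε = pMin T ε / 3 := by
  have : (0 : ℝ) < T := by exact_mod_cast hT
  unfold pMin gammaOne
  field_simp

theorem le_numRuns : c * Real.log (T / (ε * δ)) ≤ numRuns c T ε δ := Nat.le_ceil _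

variable (hT : 0 < T) (hε : 0 < ε) (hε1 : ε ≤ 1 / 100) (hδ : 0 < δ) (hδ1 : δ < 1)
include hT hε hε1 hδ hδ1

theorem one_le_log_div : 1 ≤ Real.log (T / (ε * δ)) := by
  have hT1 : (1 : ℝ) ≤ T := by exact_mod_cast hT
  refine (one_le_log_inv hε hε1).trans (Real.log_le_log (by positivity) ?_)
  rw [div_le_div_iff₀ hε (by positivity)]
  nlinarith

/-- A power of `ε δ / T` bounds every quantity exponentially small in the number of runs. -/
theorem exp_neg_numRuns_le {a y : ℝ} {k : ℕ} (hk : k ≤ a * c) (ha : 0 ≤ a)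
    (hy : a * numRuns c T ε δ ≤ y) : Real.exp (-y) ≤ (ε * δ / T) ^ k := by
  have hT1 : (0 : ℝ) < T := by exact_mod_cast hT
  rw [← exp_neg_mul_log (x := ε * δ / T) (by positivity), one_div_div]
  have h1 := one_le_log_div hT hε hε1 hδ hδ1
  have h2 := mul_le_mul_of_nonneg_left (le_numRuns (c := c) (T := T) (ε := ε) (δ := δ)) ha
  refine Real.exp_le_exp.mpr (neg_le_neg ?_)
  nlinarith

theorem one_le_numRuns (hc : 1 ≤ c) : (1 : ℝ) ≤ numRuns c T ε δ := by
  have h1 := one_le_log_div hT hε hε1 hδ hδ1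
  have h2 := le_numRuns (c := c) (T := T) (ε := ε) (δ := δ)
  nlinarith

omit hε1 hδ hδ1 in
theorem numRuns_le_numAttempts_mul :
    (numRuns c T ε δ : ℝ) ≤ numAttempts c T ε δ * pMin T ε := by
  rw [← div_le_iff₀ (pMin_pos hT hε)]
  exact Nat.le_ceil _

/-- Rejection sampling at a node that is not too unlikely hardly ever runs out of attempts. -/
theorem one_sub_pow_numAttempts_le (hc : 2 ≤ c) {p : ℝ} (hp1 : p ≤ 1)
    (hp : pMin T ε - gammaOne T ε ≤ p) : (1 - p) ^ numAttempts c T ε δ ≤ 1 / T := by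
  have hT1 : (0 : ℝ) < T := by exact_mod_cast hT
  refine (one_sub_pow_le_exp hp1 _).trans ((exp_neg_numRuns_le (c := c) (a := 2 / 3) (k := 1) hT hε
    hε1 hδ hδ1 (by push_cast; linarith) (by norm_num) ?_).trans ?_)
  · rw [gammaOne_eq hT] at hp
    have := numRuns_le_numAttempts_mul (c := c) (δ := δ) hT hε
    have h2 : (numAttempts c T ε δ : ℝ) * (2 / 3 * pMin T ε) ≤ numAttempts c T ε δ * p :=
      mul_le_mul_of_nonneg_left (by linarith) (Nat.cast_nonneg _)
    linarith
  · rw [pow_one]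
    gcongr
    nlinarith

/-- The mass of a node times the probability that rejection sampling runs out of attempts. -/
theorem mul_one_sub_pow_numAttempts_le (hc : 1 ≤ c) {p : ℝ} (hp0 : 0 ≤ p) (hp1 : p ≤ 1) :
    p * (1 - p) ^ numAttempts c T ε δ ≤ ε / (T * (T + 1)) := by
  set a := numAttempts c T ε δ with ha
  have hpm := pMin_pos hT hε
  have h1 : (1 - p) ^ a * (1 + a * p) ≤ 1 := by
    calc (1 - p) ^ a * (1 + a * p) ≤ (1 - p) ^ a * (1 + p) ^ a :=
          mul_le_mul_of_nonneg_left (one_add_mul_le_pow (by linarith) a)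
            (pow_nonneg (by linarith) a)
      _ = ((1 - p) * (1 + p)) ^ a := (mul_pow _ _ _).symm
      _ ≤ 1 := pow_le_one₀ (mul_nonneg (by linarith) (by linarith)) (by nlinarith)
  have h2 : 1 ≤ a * pMin T ε := (one_le_numRuns hT hε hε1 hδ hδ1 hc).trans
    (numRuns_le_numAttempts_mul hT hε)
  have h3 : 0 ≤ (1 - p) ^ a := pow_nonneg (by linarith) a
  have h4 : p * (1 - p) ^ a ≤ pMin T ε := by
    have h5 : a * (p * (1 - p) ^ a) ≤ 1 := by nlinarith
    have ha0 : (0 : ℝ) < a := by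
      by_contra h
      have : (a : ℝ) = 0 := le_antisymm (not_lt.mp h) (Nat.cast_nonneg _)
      rw [this] at h2
      linarith
    exact le_of_mul_le_mul_left (h5.trans h2) ha0
  have h6 := pMin_add_gammaOne (ε := ε) hT
  rw [gammaOne_eq hT] at h6
  linarith

end Parameters

/-! ### Balanced routing functions -/

section Balance

open Prog

variable {X : Type u} {H : Type v} [MeasurableSpace X] [MeasurableSpace H] {m n : ℕ}
  {A : Learner X H m n} [IsMarkovKernel A]

/-- Balancing turns an advantage into drifts away from `1/2`, of opposite signs for the two
distributions. -/
theorem balance_drift {q E₁ E₀ γ : ℝ} (hγ1 : γ ≤ 1 / 100) (h10 : 0 ≤ E₁)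
    (h11 : E₁ ≤ 1) (h00 : 0 ≤ E₀) (h01 : E₀ ≤ 1) (hadv : E₀ ≤ E₁)
    (hq : |q - (E₁ + E₀) / 2| ≤ γ) :
    1 - ((balanceBias q : ℝ) * E₁ + (1 - balanceBias q) * ind (decide (q < 1 / 2))) ≤
        1 / 2 - (E₁ - E₀) / 5 + γ ∧
      (balanceBias q : ℝ) * E₀ + (1 - balanceBias q) * ind (decide (q < 1 / 2)) ≤
        1 / 2 - (E₁ - E₀) / 5 + γ := by
  obtain ⟨hq1, hq2⟩ := abs_le.mp hq
  have hγ0 : 0 ≤ γ := (abs_nonneg _).trans hq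
  have hb : (balanceBias q : ℝ) = 1 / (1 + 2 * |1 / 2 - q|) := rfl
  by_cases h : q < 1 / 2
  · have e : (balanceBias q : ℝ) = 1 / (2 - 2 * q) := by
      rw [hb, abs_of_pos (by linarith)]; ring_nf
    have hpos : 0 < 2 - 2 * q := by linarith
    have h1 : 0 ≤ γ * (2 * (1 - q) - 1) := mul_nonneg hγ0 (by linarith)
    have h2 : 0 ≤ (E₁ - E₀) * (5 / 4 - (1 - q)) := mul_nonneg (by linarith) (by linarith)
    rw [e]
    simp only [h, decide_true, ind, if_true, mul_one]
    constructor
    · have h3 : (1 - E₁) / (2 - 2 * q) ≤ 1 / 2 - (E₁ - E₀) / 5 + γ := by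
        rw [div_le_iff₀ hpos]; nlinarith
      linarith [show (1 - E₁) / (2 - 2 * q) = 1 / (2 - 2 * q) - 1 / (2 - 2 * q) * E₁ by ring]
    · have h3 : 1 - (1 / 2 - (E₁ - E₀) / 5 + γ) ≤ (1 - E₀) / (2 - 2 * q) := by
        rw [le_div_iff₀ hpos]; nlinarith
      linarith [show (1 - E₀) / (2 - 2 * q) = 1 / (2 - 2 * q) - 1 / (2 - 2 * q) * E₀ by ring]
  · have hpos : 0 < 2 * q := by linarith
    have h1 : 0 ≤ γ * (2 * q - 1) := mul_nonneg hγ0 (by linarith)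
    have h2 : 0 ≤ (E₁ - E₀) * (5 / 4 - q) := mul_nonneg (by linarith) (by linarith)
    have e : (balanceBias q : ℝ) = 1 / (2 * q) := by
      rw [hb, abs_of_nonpos (by linarith)]; ring_nf
    rw [e]
    simp only [h, decide_false, ind, Bool.false_eq_true, if_false, mul_zero, add_zero]
    constructor
    · have h3 : 1 - (1 / 2 - (E₁ - E₀) / 5 + γ) ≤ E₁ / (2 * q) := by
        rw [le_div_iff₀ hpos]; nlinarith
      linarith [show E₁ / (2 * q) = 1 / (2 * q) * E₁ by ring]
    · have h3 : E₀ / (2 * q) ≤ 1 / 2 - (E₁ - E₀) / 5 + γ := by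
        rw [div_le_iff₀ hpos]; nlinarith
      linarith [show E₀ / (2 * q) = 1 / (2 * q) * E₀ by ring]

theorem integral_stepUp (G : Measure X) [IsProbabilityMeasure G] (d : WeakDist X m n) (q : ℝ) :
    ∫ x, stepUp A d q x ∂G =
      (balanceBias q : ℝ) * ∫ x, acceptProb A d.trainSet (Function.update d.context d.slot x) ∂G +
        (1 - balanceBias q) * ind (decide (q < 1 / 2)) := by
  have hm := (measurable_acceptProb_right (A := A) d.trainSet).comp
    (measurable_update d.context (a := d.slot))
  have hint := integrable_of_mem (μ := G) hm (fun _ => acceptProb_nonneg _ _)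
    fun _ => acceptProb_le_one _ _
  simp only [Function.comp_def] at hint
  unfold stepUp
  rw [integral_add (hint.const_mul _) (integrable_const _), integral_const_mul]
  simp

end Balance

/-! ### Visiting one node -/

section Learners

open Prog

variable {X : Type u} {H : Type v} [MeasurableSpace X] [MeasurableSpace H] {m n : ℕ}
  {A : Learner X H m n} [IsMarkovKernel A] {ev : H → X → Bool} {C : Set (X → Bool)} {ε δ : ℝ}
  {f : X → Bool}

/-- Completeness. -/
theorem IsTDSLearner.le_real_accepts (hA : IsTDSLearner ev C A ε δ) (hfC : f ∈ C)
    (hf : Measurable f) (G : Measure X) [IsProbabilityMeasure G] :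
    1 - δ ≤ (answerLaw A G G f).real {r | r.accepts = true} := by
  have := isProbabilityMeasure_answerLaw (A := A) (G₁ := G) (G₀ := G) hf
  refine (ENNReal.ofReal_le_iff_le_toReal (measure_ne_top _ _)).mp ((hA G G f hfC).trans ?_)
  exact measure_mono fun r hr => hr.2 rfl

theorem measurable_acceptsIn_error (hev : Measurable (Function.uncurry ev)) (hf : Measurable f)
    (G : Measure X) [IsProbabilityMeasure G] (ε : ℝ) :
    Measurable (Answer.acceptsIn fun h => decide (ε < G.real {x | f x ≠ ev h x})) := by
  refine measurable_const.sumElim (measurable_to_bool ?_)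
  convert measurableSet_lt (measurable_const (a := ε)) (measurable_error (G := G) hev hf) using 1
  ext h; simp

/-- Soundness, as a bound for the probability of accepting with an inaccurate hypothesis. -/
theorem IsTDSLearner.real_acceptsIn_le (hA : IsTDSLearner ev C A ε δ)
    (hev : Measurable (Function.uncurry ev)) (hfC : f ∈ C) (hf : Measurable f)
    (G₁ G₀ : Measure X) [IsProbabilityMeasure G₁] [IsProbabilityMeasure G₀] (hε : 0 ≤ ε) :
    (answerLaw A G₁ G₀ f).real
      {r | r.acceptsIn (fun h => decide (ε < G₀.real {x | f x ≠ ev h x})) = true} ≤ δ := by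
  have := isProbabilityMeasure_answerLaw (A := A) (G₁ := G₁) (G₀ := G₀) hf
  have hm : MeasurableSet
      {r : Answer H | r.acceptsIn (fun h => decide (ε < G₀.real {x | f x ≠ ev h x})) = true} :=
    measurable_acceptsIn_error hev hf G₀ ε (measurableSet_singleton true)
  have h : 1 - δ ≤ (answerLaw A G₁ G₀ f).real
      {r | r.acceptsIn (fun h => decide (ε < G₀.real {x | f x ≠ ev h x})) = true}ᶜ := by
    refine (ENNReal.ofReal_le_iff_le_toReal (measure_ne_top _ _)).mp ((hA G₁ G₀ f hfC).trans ?_)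
    refine measure_mono fun r hr => ?_
    rcases r with u | h
    · exact Bool.false_ne_true
    · have h1 := ENNReal.toReal_le_of_le_ofReal hε (hr.1 h rfl)
      have h2 : ¬ ε < G₀.real {x | f x ≠ ev h x} := not_lt.mpr h1
      show ¬ decide (ε < G₀.real {x | f x ≠ ev h x}) = true
      simpa using h2
  rw [probReal_compl_eq_one_sub hm] at h
  linarith

variable {G₁ G₀ D₁ D₀ : Measure X} [IsProbabilityMeasure G₁] [IsProbabilityMeasure G₀]
  {draw₁ : Prog X H m n (X × Bool)} {draw₀ : Prog X H m n X}

/-- If the learner often accepts on `G₁` and `G₀`, the majority vote of the accepting runs is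
accurate on `G₀`: the accepting runs with a bad hypothesis are few. -/
theorem whp_majority (hA : IsTDSLearner ev C A ε 0.01) (hev : Measurable (Function.uncurry ev))
    (hfC : f ∈ C) (hf : Measurable f) (hε : 0 ≤ ε)
    (h₁ : HasDist A D₁ D₀ f draw₁ (labeled G₁ f)) (h₀ : HasDist A D₁ D₀ f draw₀ G₀)
    (hacc : 0.94 ≤ (answerLaw A G₁ G₀ f).real {r | r.accepts = true}) {r : ℕ} (hr : 0 < r) :
    Whp A D₁ D₀ f (tuple r fun _ => runOn draw₁ draw₀)
      {a | G₀.real {x | f x ≠ majority ev (acceptedHyps a) x} ≤ 4 * ε}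
      (4 * Real.exp (-(2 * r * 0.04 ^ 2))) := by
  have := isProbabilityMeasure_answerLaw (A := A) (G₁ := G₁) (G₀ := G₀) hf
  have hbad := hA.real_acceptsIn_le hev hfC hf G₁ G₀ hε
  have hr0 : (0 : ℝ) < r := by exact_mod_cast hr
  refine (whp_tuple_freq (hasDist_runOn hf h₁ h₀) measurable_accepts
    (measurable_acceptsIn_error hev hf G₀ ε) (by norm_num : (0 : ℝ) ≤ 0.04) r hr).mono ?_ le_rfl
  rintro a ⟨ha, hb⟩
  exact majority_error_le hev hf hε hr a
    (le_trans (mul_le_mul_of_nonneg_right (by linarith) hr0.le) ha)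
    (hb.trans (mul_le_mul_of_nonneg_right (by linarith) hr0.le))

/-- If the learner does not accept often enough on `G₁` and `G₀`, a balanced routing function that
sends points from `G₁` up and points from `G₀` down, with a noticeable drift, is found: by
completeness the learner would accept on test examples from `G₁`. -/
theorem whp_drift (hA : IsTDSLearner ev C A ε 0.01) (hfC : f ∈ C) (hf : Measurable f)
    (h₁ : HasDist A D₁ D₀ f draw₁ (labeled G₁ f)) (h₀ : HasDist A D₁ D₀ f draw₀ G₀)
    [IsProbabilityMeasure D₁] [IsProbabilityMeasure D₀]
    (hacc : (answerLaw A G₁ G₀ f).real {r | r.accepts = true} ≤ 0.96) {c c₁ γ : ℝ}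
    (hc₁ : 1000 ≤ c₁) (hc : 10 ^ 9 ≤ c) (hcc : 2 * (c₁ + 1) ≤ c) (hδ : 0 < δ) (hδc : δ ≤ 1 / c)
    (hγ0 : 0 < γ) (hγ : γ ≤ 1 / 100) {β : Type*} (yes : WeakDist X m n → ℝ → β) (no : β) :
    Whp A D₁ D₀ f ((getWeakDistinguisher c c₁ draw₁ draw₀ δ).bind fun
        | none => ret no
        | some d => (estimate γ δ ((sampleMixture draw₁ draw₀).bind fun x => d.run x)).bind
            fun q => step <| ret (yes d q))
      {b | ∃ d q, b = yes d q ∧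
        ∫ x, (1 - stepUp A d q x) ∂G₁ ≤ 1 / 2 - 1 / (50000 * n) + γ ∧
        ∫ x, stepUp A d q x ∂G₀ ≤ 1 / 2 - 1 / (50000 * n) + γ} (4 * δ + δ) := by
  have hcompl := hA.le_real_accepts hfC hf G₁
  refine (whp_getWeakDistinguisher hf h₁ h₀ ?_ hc₁ hc hcc hδ hδc).bind ?_ (by positivity) hδ.le
  · rw [integral_acceptGap hf]
    linarith
  · rintro o ⟨d, rfl, hd⟩
    have hE := whp_estimate_mixture hf h₁ h₀ d hγ0 hδ
    refine Whp.mono (hE.bind (g := fun q => step <| ret (yes d q)) (b := 0) (fun q hq => ?_) hδ.le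
      le_rfl) subset_rfl (add_zero δ).le
    rw [whp_step_iff]
    refine Whp.ret (by
      have hm := (measurable_acceptProb_right (A := A) d.trainSet).comp
        (measurable_update d.context (a := d.slot))
      have b1 := integral_mem_Icc (μ := G₁) hm (fun _ => acceptProb_nonneg _ _)
        fun _ => acceptProb_le_one _ _
      have b0 := integral_mem_Icc (μ := G₀) hm (fun _ => acceptProb_nonneg _ _)
        fun _ => acceptProb_le_one _ _
      have hn : (0 : ℝ) ≤ 1 / (10000 * n) := by positivity
      unfold WeakDist.advantage at hd
      obtain ⟨e1, e0⟩ := balance_drift hγ b1.1 b1.2 b0.1 b0.2 (by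
        simp only [Function.comp_def]; linarith) (show |_| ≤ γ from hq)
      simp only [Function.comp_def] at e1 e0
      have hu := integrable_of_mem (μ := G₁) (measurable_stepUp (A := A) d q)
        (fun x => stepUp_nonneg d q x) fun x => stepUp_le_one d q x
      have hadv : (1 : ℝ) / (50000 * n) = 1 / (10000 * n) / 5 := by ring
      refine ⟨d, q, rfl, ?_, ?_⟩
      · rw [integral_sub (integrable_const _) hu, integral_stepUp]
        simp only [integral_const, probReal_univ, smul_eq_mul, mul_one]
        linarith
      · rw [integral_stepUp]
        linarith) le_rfl

end Learners

section Visit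

open Prog

variable {X : Type u} {H : Type v} [MeasurableSpace X] [MeasurableSpace H] {m n : ℕ}

/-- The mass, for `D`, of the points that reach `(j + 1, k + 1)` and on which the majority vote of
`hs` errs. -/
def errorMass (A : Learner X H m n) (D : Measure X) (f : X → Bool) (ev : H → X → Bool)
    (P : Branching X H m n) (k j : ℕ) (hs : List H) : ℝ :=
  ∫ x, posProb A P x k j * ind (decide (f x ≠ majority ev hs x)) ∂D

/-- What a visit achieves for the node `N = (j + 1, k + 1)`.  Either `N` is a leaf for which the
label is harmless: label `0` means that `D₁` hardly reaches it, label `1` that `D₀` hardly errs at it,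
unless the label is that of the last level.  Or `N` is an internal node, which sends points of `D₁` up
and points of `D₀` down with a drift `γ`. -/
def GoodNode (A : Learner X H m n) (D₁ D₀ : Measure X) (f : X → Bool) (ev : H → X → Bool) (T : ℕ)
    (ε γ : ℝ) (P : Branching X H m n) (k j : ℕ) (N : Node X H m n) : Prop :=
  (N.next = none ∧
    (N.label = false → nodeMass A D₁ P k j ≤ ε / (T * (T + 1)) ∨ (k + 1 = T ∧ 2 * (j + 1) < T)) ∧
    (N.label = true →
      errorMass A D₀ f ev P k j N.hyps ≤ 4 * ε * nodeMass A D₀ P k j + ε / (T * (T + 1)) ∨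
        (k + 1 = T ∧ T ≤ 2 * (j + 1)))) ∨
  (N.next ≠ none ∧ k + 1 < T ∧
    ∫ x, posProb A P x k j * N.down A x ∂D₁ ≤ (1 / 2 - γ) * nodeMass A D₁ P k j ∧
    ∫ x, posProb A P x k j * N.up A x ∂D₀ ≤ (1 / 2 - γ) * nodeMass A D₀ P k j)

variable {A : Learner X H m n} [IsMarkovKernel A] {D₁ D₀ D : Measure X} [IsProbabilityMeasure D₁]
  [IsProbabilityMeasure D₀] [IsProbabilityMeasure D]
  {ev : H → X → Bool} {C : Set (X → Bool)} {ε δ c c₁ : ℝ} {f : X → Bool} {T : ℕ}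
  {P : Branching X H m n} {k j : ℕ}

theorem nodeMass_mem_Icc (P : Branching X H m n) (k j : ℕ) :
    0 ≤ nodeMass A D P k j ∧ nodeMass A D P k j ≤ 1 :=
  integral_mem_Icc (measurable_posProb P k j) (fun x => posProb_nonneg P x k j)
    fun x => posProb_le_one P x k j

/-- What is small in the mean over the rejection samples of a node is small in the mean over the
points that reach the node, up to the probability of running out of attempts. -/
theorem integral_posProb_mul_le (P : Branching X H m n) (k j a : ℕ) {g : X → ℝ} (hg : Measurable g)
    (h0 : ∀ x, 0 ≤ g x) (h1 : ∀ x, g x ≤ 1) :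
    ∫ x, posProb A P x k j * g x ∂D ≤ nodeMass A D P k j * ∫ x, g x ∂(nodeLaw A D a P k j) +
      nodeMass A D P k j * (1 - nodeMass A D P k j) ^ a := by
  have := (abs_le.mp (abs_integral_rejectionLaw_sub_le (μ := D) (measurable_posProb (A := A) P k j)
    (fun x => posProb_nonneg P x k j) (fun x => posProb_le_one P x k j) hg h0 h1 a)).1
  unfold nodeMass nodeLaw
  linarith

theorem measurable_error_ind (hev : Measurable (Function.uncurry ev)) (hf : Measurable f)
    (hs : List H) : Measurable fun x => ind (decide (f x ≠ majority ev hs x)) := by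
  refine measurable_ind.comp (measurable_to_bool ?_)
  convert (measurableSet_eq_fun hf (measurable_majority hev hs)).compl using 1
  ext x; simp

theorem errorMass_le_nodeMass (hev : Measurable (Function.uncurry ev)) (hf : Measurable f)
    (hs : List H) : errorMass A D f ev P k j hs ≤ nodeMass A D P k j :=
  integral_mono (integrable_of_mem ((measurable_posProb P k j).mul (measurable_error_ind hev hf hs))
    (fun x => mul_nonneg (posProb_nonneg P x k j) (ind_nonneg _))
    fun x => mul_le_one₀ (posProb_le_one P x k j) (ind_nonneg _) (ind_le_one _))
    (integrable_of_mem (measurable_posProb P k j) (fun x => posProb_nonneg P x k j)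
    fun x => posProb_le_one P x k j)
    fun x => mul_le_of_le_one_right (posProb_nonneg P x k j) (ind_le_one _)

/-- An error of `e` on the rejection samples bounds the mass of the errors at the node. The bound does
not require that the node is reached with any minimal probability. -/
theorem errorMass_le (hev : Measurable (Function.uncurry ev)) (hf : Measurable f) (hT : 0 < T)
    (hε : 0 < ε) (hε1 : ε ≤ 1 / 100) (hδ : 0 < δ) (hδ1 : δ < 1) (hc : 1 ≤ c) {hs : List H} {e : ℝ}
    (h : (nodeLaw A D (numAttempts c T ε δ) P k j).real {x | f x ≠ majority ev hs x} ≤ e) :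
    errorMass A D f ev P k j hs ≤ e * nodeMass A D P k j + ε / (T * (T + 1)) := by
  obtain ⟨p0, p1⟩ := nodeMass_mem_Icc (A := A) (D := D) P k j
  have := isProbabilityMeasure_nodeLaw (A := A) D (numAttempts c T ε δ) P k j
  have h1 := integral_posProb_mul_le (A := A) (D := D) P k j (numAttempts c T ε δ)
    (measurable_error_ind hev hf hs) (fun _ => ind_nonneg _) fun _ => ind_le_one _
  have h2 := mul_one_sub_pow_numAttempts_le hT hε hε1 hδ hδ1 hc p0 p1
  have h3 : ∫ x, ind (decide (f x ≠ majority ev hs x)) ∂(nodeLaw A D (numAttempts c T ε δ) P k j) =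
      (nodeLaw A D (numAttempts c T ε δ) P k j).real {x | f x ≠ majority ev hs x} := by
    have hE : MeasurableSet {x | f x ≠ majority ev hs x} :=
      (measurableSet_eq_fun hf (measurable_majority hev hs)).compl
    rw [← integral_indicator_one hE]
    refine integral_congr_ae (ae_of_all _ fun x => ?_)
    by_cases hx : f x = majority ev hs x <;> simp [ind, hx]
  rw [h3] at h1
  unfold errorMass
  nlinarith

omit [MeasurableSpace X] [MeasurableSpace H] in
theorem Branching.set_same (P : Branching X H m n) (i t : ℕ) (N : Node X H m n) :
    P.set i t N i t = N := by simp [Branching.set]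

omit [MeasurableSpace X] [MeasurableSpace H] in
theorem Branching.set_of_ne (P : Branching X H m n) {i t i' t' : ℕ} (N : Node X H m n)
    (h : (i', t') ≠ (i, t)) : P.set i t N i' t' = P i' t' := by
  unfold Branching.set
  by_cases hi : i' = i
  · subst hi
    have : t' ≠ t := fun e => h (by rw [e])
    simp [this]
  · simp [Function.update_of_ne hi]

/-- A visit makes its node good and changes no other node. -/
theorem whp_visit (hA : IsTDSLearner ev C A ε 0.01) (hev : Measurable (Function.uncurry ev))
    (hfC : f ∈ C) (hf : Measurable f) (hM : 1 ≤ m + n)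
    (hT : c * ((m + n : ℕ) : ℝ) ^ 2 ≤ T) (hε : 0 < ε) (hε1 : ε ≤ 1 / 100) (hδ : 0 < δ) (hδ1 : δ < 1)
    (hc₁ : 1000 ≤ c₁) (hc : 10 ^ 9 ≤ c) (hcc : 2 * (c₁ + 1) ≤ c) (hj : j ≤ k) (hk : k < T)
    (hP : P (j + 1) (k + 1) = initial T (j + 1) (k + 1)) :
    Whp A D₁ D₀ f (visit c c₁ ε δ T (j + 1) (k + 1) P)
      {Q | ∃ N, Q = P.set (j + 1) (k + 1) N ∧
        GoodNode A D₁ D₀ f ev T ε (1 / (10 ^ 5 * (m + n : ℕ))) P k j N}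
      (8 * subDelta c T δ + 4 * (ε * δ / T) ^ 3) := by
  have hT0 : 0 < T := by omega
  have hT0' : (0 : ℝ) < T := by exact_mod_cast hT0
  have hT1 : (1 : ℝ) ≤ T := by exact_mod_cast hT0
  have hM1 : (1 : ℝ) ≤ (m + n : ℕ) := by exact_mod_cast hM
  have hc0 : 0 < c := by linarith
  have hγ₁ : 0 < gammaOne T ε := by rw [gammaOne_eq hT0]; linarith [pMin_pos hT0 hε]
  have hδ₁ : 0 < subDelta c T δ := by unfold subDelta; positivity
  have hδ₁c : subDelta c T δ ≤ 1 / c := by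
    unfold subDelta
    have : (1 : ℝ) ≤ T ^ 10 := one_le_pow₀ hT1
    exact div_le_div₀ zero_le_one hδ1.le hc0 (le_mul_of_one_le_right hc0.le this)
  have hX : 0 ≤ 4 * (ε * δ / T) ^ 3 := by positivity
  obtain ⟨p10, p11⟩ := nodeMass_mem_Icc (A := A) (D := D₁) P k j
  obtain ⟨p00, p01⟩ := nodeMass_mem_Icc (A := A) (D := D₀) P k j
  have hself : P.set (j + 1) (k + 1) (P (j + 1) (k + 1)) = P := by
    funext i t
    by_cases h : (i, t) = (j + 1, k + 1)
    · obtain ⟨rfl, rfl⟩ := Prod.mk.inj h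
      exact P.set_same _ _ _
    · exact P.set_of_ne _ h
  have hinit : (P (j + 1) (k + 1)).next = none := by rw [hP]; rfl
  have hpm := pMin_add_gammaOne (ε := ε) hT0
  unfold visit
  have hsplit : 8 * subDelta c T δ + 4 * (ε * δ / T) ^ 3 =
      subDelta c T δ + (subDelta c T δ + (subDelta c T δ +
        (5 * subDelta c T δ + 4 * (ε * δ / T) ^ 3))) := by ring
  rw [hsplit]
  refine (whp_estimate_train hf P hj hγ₁ hδ₁).bind (fun y₁ hy₁ => ?_) hδ₁.le (by positivity)
  refine (whp_estimate_test P hj hγ₁ hδ₁).bind (fun y₀ hy₀ => ?_) hδ₁.le (by positivity)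
  obtain ⟨hy₁, hy₁'⟩ := abs_le.mp (show |_| ≤ gammaOne T ε from hy₁)
  obtain ⟨hy₀, hy₀'⟩ := abs_le.mp (show |_| ≤ gammaOne T ε from hy₀)
  rw [whp_steps_iff]
  by_cases htest : (y₁ < pMin T ε ∨ y₀ < pMin T ε) ∧ k + 1 < T
  · rw [if_pos htest]
    -- a node reached too rarely becomes a leaf whose label is harmless
    rw [whp_step_iff]
    refine Whp.ret (by
      refine ⟨_, rfl, Or.inl ⟨hinit, fun hl => Or.inl ?_, fun hl => Or.inl ?_⟩⟩
      · have : y₁ < pMin T ε := by simpa using hl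
        linarith
      · have h1 : ¬ y₁ < pMin T ε := by simpa using hl
        have h0 := htest.1.resolve_left h1
        have := errorMass_le_nodeMass (A := A) (D := D₀) (P := P) (k := k) (j := j) hev hf
          (P (j + 1) (k + 1)).hyps
        have h4 : 0 ≤ 4 * ε * nodeMass A D₀ P k j := by positivity
        exact (this.trans (by linarith)).trans (le_add_of_nonneg_left h4)) (by positivity)
  rw [if_neg htest]
  set a := numAttempts c T ε δ with ha
  have hG₁ := isProbabilityMeasure_nodeLaw (A := A) D₁ a P k j
  have hG₀ := isProbabilityMeasure_nodeLaw (A := A) D₀ a P k j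
  have d₁ := hasDist_sampleTrain (A := A) (D₁ := D₁) (D₀ := D₀) hf a P hj
  have d₀ := hasDist_sampleTest (A := A) (D₁ := D₁) (D₀ := D₀) (f := f) a P hj
  refine (whp_estimate_accepts hf d₁ d₀ (by norm_num) hδ₁).bind (fun y hy => ?_) hδ₁.le (by positivity)
  obtain ⟨hy, hy'⟩ := abs_le.mp (show |_| ≤ (0.01 : ℝ) from hy)
  rw [whp_step_iff]
  by_cases hacc : 0.95 ≤ y
  · rw [if_pos hacc]
    -- the learner accepts: the majority vote is accurate
    have hr1 := one_le_numRuns (c := c) hT0 hε hε1 hδ hδ1 (by linarith)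
    have hr0 : 0 < numRuns c T ε δ := by
      have : (0 : ℝ) < numRuns c T ε δ := by linarith
      exact_mod_cast this
    have hexp := exp_neg_numRuns_le (c := c) (a := 0.0032) (k := 3)
      (y := 2 * numRuns c T ε δ * 0.04 ^ 2) hT0 hε hε1 hδ hδ1 (by push_cast; linarith) (by norm_num)
      (by linarith)
    refine Whp.mono ((whp_majority hA hev hfC hf hε.le d₁ d₀ (by linarith) hr0).bind
      (E' := {Q | ∃ N, Q = P.set (j + 1) (k + 1) N ∧
        GoodNode A D₁ D₀ f ev T ε (1 / (10 ^ 5 * (m + n : ℕ))) P k j N}) (b := 0)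
      (fun ans hans => ?_) (by positivity) le_rfl) le_rfl (by linarith)
    rw [whp_steps_iff]
    refine Whp.ret (by
      refine ⟨_, rfl, Or.inl ⟨hinit, fun hl => absurd hl (by simp), fun _ => Or.inl ?_⟩⟩
      exact errorMass_le hev hf hT0 hε hε1 hδ hδ1 (by linarith) hans) le_rfl
  rw [if_neg hacc]
  by_cases hlt : k + 1 < T
  · simp only [if_pos hlt]
    -- the learner rejects too often: a weak distinguisher yields a balanced routing function
    rw [whp_step_iff]
    have hγ₂ : 0 < gammaTwo c (m + n) := by unfold gammaTwo; positivity
    have hγ₂M : gammaTwo c (m + n) ≤ 1 / (10 ^ 9 * (m + n : ℕ)) := by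
      unfold gammaTwo
      gcongr
    have hγ₂' : gammaTwo c (m + n) ≤ 1 / 100 := by
      refine hγ₂M.trans ?_
      exact one_div_le_one_div_of_le (by norm_num) (by linarith)
    have htest' : ¬ (y₁ < pMin T ε ∨ y₀ < pMin T ε) := fun h => htest ⟨h, hlt⟩
    obtain ⟨ht1, ht0⟩ := not_or.mp htest'
    have e1 := one_sub_pow_numAttempts_le (c := c) hT0 hε hε1 hδ hδ1 (by linarith) p11
      (by linarith)
    have e0 := one_sub_pow_numAttempts_le (c := c) hT0 hε hε1 hδ hδ1 (by linarith) p01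
      (by linarith)
    have hTM : (1 : ℝ) / T ≤ 1 / (10 ^ 9 * (m + n : ℕ)) := by
      refine one_div_le_one_div_of_le (by positivity) (le_trans ?_ hT)
      refine mul_le_mul hc ?_ (by positivity) hc0.le
      nlinarith
    refine Whp.mono ((whp_drift hA hfC hf d₁ d₀ (by linarith) hc₁ hc hcc hδ₁ hδ₁c hγ₂ hγ₂'
      (fun d q => P.set (j + 1) (k + 1) { P (j + 1) (k + 1) with next := some (d, q) }) P)) ?_
      (by linarith)
    rintro Q ⟨d, q, rfl, b1, b0⟩
    have hnM : (1 : ℝ) / (50000 * (m + n : ℕ)) ≤ 1 / (50000 * n) := by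
      have hn : (0 : ℝ) < n := by exact_mod_cast (Nat.zero_le _).trans_lt d.slot.2
      refine one_div_le_one_div_of_le (by positivity) ?_
      push_cast
      linarith [(Nat.cast_nonneg m : (0 : ℝ) ≤ m)]
    have hdrift : ∀ {p s e : ℝ}, s ≤ 1 / 2 - 1 / (50000 * n) + gammaTwo c (m + n) → 0 ≤ p →
        e ≤ 1 / T → p * s + p * e ≤ (1 / 2 - 1 / (10 ^ 5 * (m + n : ℕ))) * p := by
      intro p s e hs hp he
      rw [← mul_add, mul_comm]
      refine mul_le_mul_of_nonneg_right ?_ hp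
      have h1 : (1 : ℝ) / (50000 * (m + n : ℕ)) = 1 / 50000 * (1 / (m + n : ℕ)) := by ring
      have h2 : (1 : ℝ) / (10 ^ 9 * (m + n : ℕ)) = 1 / 10 ^ 9 * (1 / (m + n : ℕ)) := by ring
      have h3 : (1 : ℝ) / (10 ^ 5 * (m + n : ℕ)) = 1 / 10 ^ 5 * (1 / (m + n : ℕ)) := by ring
      have h4 : (0 : ℝ) < 1 / (m + n : ℕ) := by positivity
      rw [h1] at hnM
      rw [h2] at hTM hγ₂M
      rw [h3]
      linarith
    refine ⟨_, rfl, Or.inr ⟨by simp, hlt, ?_, ?_⟩⟩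
    · have h := integral_posProb_mul_le (A := A) (D := D₁) P k j a
        ((measurable_stepUp (A := A) d q).const_sub 1)
        (fun x => sub_nonneg.mpr (stepUp_le_one d q x)) fun x => by linarith [stepUp_nonneg (A := A) d q x]
      exact h.trans (hdrift b1 p10 e1)
    · have h := integral_posProb_mul_le (A := A) (D := D₀) P k j a (measurable_stepUp (A := A) d q)
        (fun x => stepUp_nonneg d q x) fun x => stepUp_le_one d q x
      exact h.trans (hdrift b0 p00 e0)
  · simp only [if_neg hlt]
    -- at the last level the node keeps its initial label
    rw [whp_step_iff]
    refine Whp.ret (by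
      refine ⟨P (j + 1) (k + 1), hself.symm, Or.inl ⟨hinit, fun hl => Or.inr ?_, fun hl => Or.inr ?_⟩⟩
      · rw [hP] at hl
        have : ¬ (k + 1 = T ∧ T ≤ 2 * (j + 1)) := by simpa [initial] using hl
        omega
      · rw [hP] at hl
        simpa [initial] using hl) (by positivity)

end Visit

/-! ### Visiting all nodes -/

section Nodes

theorem exists_of_mem_nodes {T : ℕ} {N : ℕ × ℕ} (h : N ∈ nodes T) :
    ∃ j k, N = (j + 1, k + 1) ∧ j ≤ k ∧ k < T := by
  simp only [nodes, List.mem_flatMap, List.mem_range, List.mem_map] at h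
  obtain ⟨k, hk, j, hj, rfl⟩ := h
  exact ⟨j, k, rfl, by omega, hk⟩

theorem mem_nodes {T j k : ℕ} (hj : j ≤ k) (hk : k < T) : (j + 1, k + 1) ∈ nodes T := by
  simp only [nodes, List.mem_flatMap, List.mem_range, List.mem_map]
  exact ⟨k, hk, j, by omega, rfl⟩

theorem pairwise_nodes (T : ℕ) : (nodes T).Pairwise fun a b => a ≠ b ∧ a.2 ≤ b.2 := by
  unfold nodes
  rw [List.pairwise_flatMap]
  constructor
  · intro k _
    rw [List.pairwise_map]
    refine List.pairwise_lt_range.imp fun {a b} h => ⟨fun e => ?_, le_rfl⟩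
    have := (Prod.mk.inj e).1
    omega
  · refine List.pairwise_lt_range.imp fun {a b} h x hx y hy => ?_
    simp only [List.mem_map, List.mem_range] at hx hy
    obtain ⟨_, _, rfl⟩ := hx
    obtain ⟨_, _, rfl⟩ := hy
    refine ⟨fun e => ?_, by simp only; omega⟩
    have := (Prod.mk.inj e).2
    omega

theorem length_nodes_le (T : ℕ) : (nodes T).length ≤ T ^ 2 := by
  unfold nodes
  rw [List.length_flatMap, sq]
  refine (List.sum_le_card_nsmul _ T fun x hx => ?_).trans (by simp)
  simp only [List.mem_map, List.mem_range, List.length_map, List.length_range] at hx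
  obtain ⟨a, ha, rfl⟩ := hx
  exact ha

variable {X : Type u} {H : Type v} [MeasurableSpace X] [MeasurableSpace H] {m n : ℕ}
  {A : Learner X H m n} {D₁ D₀ : Measure X}
  {ev : H → X → Bool} {C : Set (X → Bool)} {ε δ c c₁ γ : ℝ} {f : X → Bool} {T : ℕ}

open Prog

theorem GoodNode.congr {P Q : Branching X H m n} {k j : ℕ} {N : Node X H m n}
    (h : GoodNode A D₁ D₀ f ev T ε γ P k j N) (hPQ : ∀ i t, t ≤ k → P i t = Q i t) :
    GoodNode A D₁ D₀ f ev T ε γ Q k j N := by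
  unfold GoodNode nodeMass errorMass at *
  simpa only [posProb_congr hPQ] using h

variable [IsMarkovKernel A] [IsProbabilityMeasure D₁] [IsProbabilityMeasure D₀]

/-- Visiting the nodes of a list, level by level, makes all of them good. A node stays good, since
`GoodNode` depends only on the lower levels, which are not visited any more. -/
theorem whp_visitAll (hA : IsTDSLearner ev C A ε 0.01) (hev : Measurable (Function.uncurry ev))
    (hfC : f ∈ C) (hf : Measurable f) (hM : 1 ≤ m + n)
    (hT : c * ((m + n : ℕ) : ℝ) ^ 2 ≤ T) (hε : 0 < ε) (hε1 : ε ≤ 1 / 100) (hδ : 0 < δ) (hδ1 : δ < 1)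
    (hc₁ : 1000 ≤ c₁) (hc : 10 ^ 9 ≤ c) (hcc : 2 * (c₁ + 1) ≤ c) (Ns : List (ℕ × ℕ))
    (P : Branching X H m n) (hNs : Ns.Pairwise fun a b => a ≠ b ∧ a.2 ≤ b.2)
    (hNs' : ∀ N ∈ Ns, ∃ j k, N = (j + 1, k + 1) ∧ j ≤ k ∧ k < T)
    (hP : ∀ N ∈ Ns, P N.1 N.2 = initial T N.1 N.2) :
    Whp A D₁ D₀ f (visitAll c c₁ ε δ T Ns P)
      {Q | (∀ i t, (i, t) ∉ Ns → Q i t = P i t) ∧ ∀ j k, (j + 1, k + 1) ∈ Ns →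
        GoodNode A D₁ D₀ f ev T ε (1 / (10 ^ 5 * (m + n : ℕ))) Q k j (Q (j + 1) (k + 1))}
      (Ns.length * (8 * subDelta c T δ + 4 * (ε * δ / T) ^ 3)) := by
  have hβ : 0 ≤ 8 * subDelta c T δ + 4 * (ε * δ / T) ^ 3 := by unfold subDelta; positivity
  induction Ns generalizing P with
  | nil => exact Whp.ret (by exact ⟨fun _ _ _ => rfl, fun j k h => absurd h (by simp)⟩) (by simp)
  | cons N Ns ih =>
    obtain ⟨hN, hNs_tail⟩ := List.pairwise_cons.mp hNs
    obtain ⟨j, k, rfl, hj, hk⟩ := hNs' N (by simp)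
    rw [visitAll, whp_step_iff]
    refine Whp.mono ((whp_visit hA hev hfC hf hM hT hε hε1 hδ hδ1 hc₁ hc hcc hj hk
      (hP (j + 1, k + 1) (by simp))).bind (b := Ns.length * (8 * subDelta c T δ + 4 * (ε * δ / T) ^ 3))
      (fun Q hQ => ?_) hβ (by positivity)) subset_rfl (by push_cast [List.length_cons]; linarith)
    obtain ⟨N, rfl, hgood⟩ := hQ
    refine (ih _ hNs_tail (fun N hN => hNs' N (by simp [hN])) fun N' hN' => ?_).mono ?_ le_rfl
    · rw [← hP N' (by simp [hN'])]
      exact P.set_of_ne _ (hN N' hN').1.symm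
    · rintro Q ⟨hQ1, hQ2⟩
      have hnot : (j + 1, k + 1) ∉ Ns := fun h => (hN _ h).1 rfl
      have hout : ∀ i t, (i, t) ∉ (j + 1, k + 1) :: Ns → Q i t = P i t := fun i t h => by
        rw [hQ1 i t fun h' => h (by simp [h']), P.set_of_ne _ fun e => h (by simp [e])]
      refine ⟨hout, fun j' k' h => ?_⟩
      rcases List.mem_cons.mp h with h | h
      · obtain ⟨e1, e2⟩ := Prod.mk.inj h
        obtain rfl : j' = j := by omega
        obtain rfl : k' = k := by omega
        rw [hQ1 _ _ hnot, Branching.set_same]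
        -- the nodes of the levels before the visited one never change again
        refine hgood.congr fun i t ht => (hout i t fun h' => ?_).symm
        rcases List.mem_cons.mp h' with h' | h'
        · have := (Prod.mk.inj h').2
          omega
        · have : k' + 1 ≤ t := (hN _ h').2
          omega
      · exact hQ2 j' k' h

/-- With high probability the algorithm produces a branching program with good nodes only. -/
theorem whp_visitAll_nodes (hA : IsTDSLearner ev C A ε 0.01) (hev : Measurable (Function.uncurry ev))
    (hfC : f ∈ C) (hf : Measurable f) (hM : 1 ≤ m + n)
    (hT : c * ((m + n : ℕ) : ℝ) ^ 2 ≤ T) (hε : 0 < ε) (hε1 : ε ≤ 1 / 100) (hδ : 0 < δ) (hδ1 : δ < 1)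
    (hc₁ : 1000 ≤ c₁) (hc : 10 ^ 9 ≤ c) (hcc : 2 * (c₁ + 1) ≤ c) :
    Whp A D₁ D₀ f (visitAll c c₁ ε δ T (nodes T) (initial T))
      {Q | ∀ j k, j ≤ k → k < T →
        GoodNode A D₁ D₀ f ev T ε (1 / (10 ^ 5 * (m + n : ℕ))) Q k j (Q (j + 1) (k + 1))} δ := by
  refine (whp_visitAll hA hev hfC hf hM hT hε hε1 hδ hδ1 hc₁ hc hcc (nodes T) (initial T)
    (pairwise_nodes T) (fun N => exists_of_mem_nodes) fun _ _ => rfl).mono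
    (fun Q hQ j k hj hk => hQ.2 j k (mem_nodes hj hk)) ?_
  have hM1 : (1 : ℝ) ≤ (m + n : ℕ) := by exact_mod_cast hM
  have hT1 : (1 : ℝ) ≤ T := by nlinarith
  have hT0 : (0 : ℝ) < T := by linarith
  have hlen : ((nodes T).length : ℝ) ≤ T ^ 2 := by exact_mod_cast length_nodes_le T
  have h1 : (T : ℝ) ^ 2 * subDelta c T δ ≤ δ / 10 ^ 9 := by
    have h8 : (1 : ℝ) ≤ T ^ 8 := one_le_pow₀ hT1
    have e : (T : ℝ) ^ 2 * subDelta c T δ = δ / (c * T ^ 8) := by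
      unfold subDelta
      have : c ≠ 0 := by linarith
      field_simp
    rw [e]
    exact div_le_div_of_nonneg_left hδ.le (by norm_num) (by nlinarith)
  have h2 : (T : ℝ) ^ 2 * (ε * δ / T) ^ 3 ≤ δ / 10 ^ 6 := by
    have e : (T : ℝ) ^ 2 * (ε * δ / T) ^ 3 = ε ^ 3 * δ ^ 2 * (δ / T) := by field_simp
    have h3 : ε ^ 3 ≤ (1 / 100) ^ 3 := pow_le_pow_left₀ hε.le hε1 3
    have h4 : δ ^ 2 ≤ 1 := pow_le_one₀ hδ.le hδ1.le
    have h5 : δ / T ≤ δ := div_le_self hδ.le hT1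
    rw [e]
    calc ε ^ 3 * δ ^ 2 * (δ / T) ≤ (1 / 100) ^ 3 * 1 * δ := by gcongr
      _ = δ / 10 ^ 6 := by ring
  have hβ : 0 ≤ 8 * subDelta c T δ + 4 * (ε * δ / T) ^ 3 := by unfold subDelta; positivity
  have := mul_le_mul_of_nonneg_right hlen hβ
  linarith

end Nodes

/-! ### The drift of the random walk -/

section Drift

/-- An exponential potential of a walk: if every step multiplies the weights by at most `ρ` in the
mean, where a step up is weighted with `p` and a step down with `q`, then after `k` steps the total
weight is at most `ρ ^ k`. -/
theorem sum_weights_le {M U V : ℕ → ℕ → ℝ} {p q ρ : ℝ} {K : ℕ}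
    (hpush : ∀ k (G : ℕ → ℝ), ∑ j ∈ Finset.range (k + 2), M (k + 1) j * G j =
      ∑ j ∈ Finset.range (k + 1), (U k j * G (j + 1) + V k j * G j))
    (h0 : M 0 0 ≤ 1) (hp : 0 ≤ p) (hq : 0 ≤ q) (hρ : 0 ≤ ρ)
    (hstep : ∀ k j, j ≤ k → k < K → p * U k j + q * V k j ≤ ρ * M k j) {k : ℕ} (hk : k ≤ K) :
    ∑ j ∈ Finset.range (k + 1), M k j * (p ^ j * q ^ (k - j)) ≤ ρ ^ k := by
  induction k with
  | zero => simpa using h0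
  | succ k ih =>
    rw [hpush k fun j => p ^ j * q ^ (k + 1 - j), pow_succ']
    refine le_trans ?_ (mul_le_mul_of_nonneg_left (ih (by omega)) hρ)
    rw [Finset.mul_sum]
    refine Finset.sum_le_sum fun j hj => ?_
    have hj' : j ≤ k := by simpa [Nat.lt_succ_iff] using hj
    have e : k + 1 - j = (k - j) + 1 := by omega
    have h1 := mul_le_mul_of_nonneg_right (hstep k j hj' (by omega))
      (mul_nonneg (pow_nonneg hp j) (pow_nonneg hq (k - j)))
    rw [Nat.add_sub_add_right, e, pow_succ, pow_succ]
    linarith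

/-- In the half against the drift, a position has weight at least the square root of the bound for the
total weight in `sum_weights_le`. -/
theorem sqrt_pow_le_weight {γ : ℝ} (h0 : 0 ≤ γ) (h1 : γ ≤ 1 / 4) {i j : ℕ} (h : i ≤ j) :
    √((1 - 4 * γ ^ 2) ^ (i + j)) ≤ (1 - 2 * γ) ^ i * (1 + 2 * γ) ^ j := by
  have hz : 0 ≤ 1 - 2 * γ := by linarith
  have hzy : (1 - 2 * γ) * (1 + 2 * γ) = 1 - 4 * γ ^ 2 := by ring
  have hρ0 : 0 ≤ 1 - 4 * γ ^ 2 := by nlinarith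
  rw [Real.sqrt_le_left (by positivity), mul_pow, ← pow_mul, ← pow_mul]
  obtain ⟨l, rfl⟩ := Nat.exists_eq_add_of_le h
  calc (1 - 4 * γ ^ 2) ^ (i + (i + l)) = (1 - 4 * γ ^ 2) ^ (i * 2) * (1 - 4 * γ ^ 2) ^ l := by
        rw [← pow_add]; congr 1; omega
    _ ≤ (1 - 4 * γ ^ 2) ^ (i * 2) * 1 := by
        gcongr
        exact pow_le_one₀ hρ0 (by nlinarith)
    _ ≤ (1 - 4 * γ ^ 2) ^ (i * 2) * (1 + 2 * γ) ^ (l * 2) := by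
        gcongr
        exact one_le_pow₀ (by linarith)
    _ = _ := by
        rw [← hzy, mul_pow]
        ring

/-- A walk with drift `γ` up, as in `sum_weights_le`, is unlikely to be in the lower half. -/
theorem sum_lower_le {M U V : ℕ → ℕ → ℝ} {γ : ℝ} {K : ℕ}
    (hpush : ∀ k (G : ℕ → ℝ), ∑ j ∈ Finset.range (k + 2), M (k + 1) j * G j =
      ∑ j ∈ Finset.range (k + 1), (U k j * G (j + 1) + V k j * G j))
    (h0 : M 0 0 ≤ 1) (hM : ∀ k j, 0 ≤ M k j) (hγ0 : 0 ≤ γ) (hγ1 : γ ≤ 1 / 4)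
    (hUV : ∀ k j, U k j + V k j ≤ M k j)
    (hdrift : ∀ k j, j ≤ k → k < K → V k j ≤ (1 / 2 - γ) * M k j) :
    ∑ j ∈ Finset.range (K + 1), (if 2 * j ≤ K then M K j else 0) ≤ √((1 - 4 * γ ^ 2) ^ K) := by
  have hρ0 : 0 < 1 - 4 * γ ^ 2 := by nlinarith
  have h := sum_weights_le hpush h0 (p := 1 - 2 * γ) (q := 1 + 2 * γ) (ρ := 1 - 4 * γ ^ 2)
    (by linarith) (by linarith) hρ0.le (fun k j hj hk => by
      have := hdrift k j hj hk
      have := hUV k j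
      have := hM k j
      nlinarith) le_rfl
  have hs : 0 < √((1 - 4 * γ ^ 2) ^ K) := Real.sqrt_pos.mpr (pow_pos hρ0 K)
  refine le_of_mul_le_mul_right (le_trans ?_ (h.trans (Real.mul_self_sqrt (by positivity)).symm.le)) hs
  rw [Finset.sum_mul]
  refine Finset.sum_le_sum fun j hj => ?_
  have hj' : j ≤ K := by simpa [Nat.lt_succ_iff] using hj
  split_ifs with hc
  · have := sqrt_pow_le_weight hγ0 hγ1 (show j ≤ K - j by omega)
    rw [Nat.add_sub_cancel' hj'] at this
    exact mul_le_mul_of_nonneg_left this (hM K j)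
  · rw [zero_mul]
    have : 0 ≤ 1 - 2 * γ := by linarith
    exact mul_nonneg (hM K j) (by positivity)

/-- A walk with drift `γ` down, as in `sum_weights_le`, is unlikely to be in the upper half. -/
theorem sum_upper_le {M U V : ℕ → ℕ → ℝ} {γ : ℝ} {K : ℕ}
    (hpush : ∀ k (G : ℕ → ℝ), ∑ j ∈ Finset.range (k + 2), M (k + 1) j * G j =
      ∑ j ∈ Finset.range (k + 1), (U k j * G (j + 1) + V k j * G j))
    (h0 : M 0 0 ≤ 1) (hM : ∀ k j, 0 ≤ M k j) (hγ0 : 0 ≤ γ) (hγ1 : γ ≤ 1 / 4)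
    (hUV : ∀ k j, U k j + V k j ≤ M k j)
    (hdrift : ∀ k j, j ≤ k → k < K → U k j ≤ (1 / 2 - γ) * M k j) :
    ∑ j ∈ Finset.range (K + 1), (if K ≤ 2 * j + 1 then M K j else 0) ≤
      2 * √((1 - 4 * γ ^ 2) ^ K) := by
  have hρ0 : 0 < 1 - 4 * γ ^ 2 := by nlinarith
  have h := sum_weights_le hpush h0 (p := 1 + 2 * γ) (q := 1 - 2 * γ) (ρ := 1 - 4 * γ ^ 2)
    (by linarith) (by linarith) hρ0.le (fun k j hj hk => by
      have := hdrift k j hj hk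
      have := hUV k j
      have := hM k j
      nlinarith) le_rfl
  have hs : 0 < √((1 - 4 * γ ^ 2) ^ K) := Real.sqrt_pos.mpr (pow_pos hρ0 K)
  have hz : 1 / 2 ≤ 1 - 2 * γ := by linarith
  suffices hsum : (∑ j ∈ Finset.range (K + 1), (if K ≤ 2 * j + 1 then M K j else 0)) *
      (1 / 2 * √((1 - 4 * γ ^ 2) ^ K)) ≤ (1 - 4 * γ ^ 2) ^ K by
    have hss := Real.mul_self_sqrt (pow_pos hρ0 K).le
    refine le_of_mul_le_mul_right ?_ hs
    linarith
  refine le_trans ?_ h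
  rw [Finset.sum_mul]
  refine Finset.sum_le_sum fun j hj => ?_
  have hj' : j ≤ K := by simpa [Nat.lt_succ_iff] using hj
  split_ifs with hc
  · refine mul_le_mul_of_nonneg_left ?_ (hM K j)
    rcases Nat.lt_or_ge j (K - j) with hlt | hge
    · -- in the middle one factor `1 - 2 γ` is in excess
      obtain ⟨i, hi⟩ : ∃ i, K - j = i + 1 := ⟨K - j - 1, by omega⟩
      have h1 := sqrt_pow_le_weight hγ0 hγ1 (show i ≤ j by omega)
      have h2 : √((1 - 4 * γ ^ 2) ^ K) ≤ √((1 - 4 * γ ^ 2) ^ (i + j)) :=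
        Real.sqrt_le_sqrt (pow_le_pow_of_le_one hρ0.le (by nlinarith) (by omega))
      rw [hi, pow_succ]
      calc 1 / 2 * √((1 - 4 * γ ^ 2) ^ K) ≤ (1 - 2 * γ) * ((1 - 2 * γ) ^ i * (1 + 2 * γ) ^ j) :=
            mul_le_mul hz (h2.trans h1) hs.le (by linarith)
        _ = _ := by ring
    · have := sqrt_pow_le_weight hγ0 hγ1 hge
      rw [Nat.sub_add_cancel hj'] at this
      linarith
  · rw [zero_mul]
    exact mul_nonneg (hM K j) (mul_nonneg (by positivity) (pow_nonneg (by linarith) _))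

/-- The number of steps after which the walk has left the wrong half, up to probability `x`. -/
theorem sqrt_pow_le {γ x : ℝ} (hx : 0 < x) (hγ : 4 * γ ^ 2 ≤ 1) {K : ℕ}
    (h : Real.log (1 / x) ≤ 2 * γ ^ 2 * K) : √((1 - 4 * γ ^ 2) ^ K) ≤ x := by
  rw [Real.sqrt_le_left hx.le]
  refine (one_sub_pow_le_exp hγ K).trans ?_
  rw [← exp_neg_mul_log hx 2]
  refine Real.exp_le_exp.mpr ?_
  push_cast
  linarith

end Drift

/-! ### The error of a branching program with good nodes -/

section Evaluation

open Prog

variable {X : Type u} {H : Type v} [MeasurableSpace X] [MeasurableSpace H] {m n : ℕ}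
  {A : Learner X H m n} [IsMarkovKernel A] {D D₁ D₀ : Measure X} [IsProbabilityMeasure D]
  {ev : H → X → Bool} {f : X → Bool} {T : ℕ} {P : Branching X H m n}

theorem prob_evaluate (hP : ∀ x j, posProb A P x T j = 0) (e : Bool × Bool → Bool) (x : X) :
    (evaluate ev T P x).prob A D₁ D₀ f {o | e o = true} =
      ENNReal.ofReal (∑ l ∈ Finset.range T, ∑ j ∈ Finset.range (l + 1), posProb A P x l j *
        ((P (j + 1) (l + 1)).leaf *
          ind (e (majority ev (P (j + 1) (l + 1)).hyps x, (P (j + 1) (l + 1)).label)))) := by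
  have hterm : ∀ l j, 0 ≤ posProb A P x l j * ((P (j + 1) (l + 1)).leaf *
      ind (e (majority ev (P (j + 1) (l + 1)).hyps x, (P (j + 1) (l + 1)).label))) := fun l j =>
    mul_nonneg (posProb_nonneg P x l j) (mul_nonneg (Node.leaf_nonneg _) (ind_nonneg _))
  rw [prob, evaluate, expect_bind, expect_walk]
  simp only [hP, ENNReal.ofReal_zero, zero_mul, Finset.sum_const_zero, zero_add, expect_steps, expect]
  rw [ENNReal.ofReal_sum_of_nonneg fun l _ => Finset.sum_nonneg fun j _ => hterm l j]
  refine Finset.sum_congr rfl fun l _ => ?_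
  rw [ENNReal.ofReal_sum_of_nonneg fun j _ => hterm l j]
  refine Finset.sum_congr rfl fun j _ => ?_
  rw [ENNReal.ofReal_mul (posProb_nonneg P x l j), ENNReal.ofReal_mul (Node.leaf_nonneg _)]
  congr 2
  cases h : e (majority ev (P (j + 1) (l + 1)).hyps x, (P (j + 1) (l + 1)).label) <;>
    simp [ind, h]

/-- The mass of the points that end at a leaf where a condition holds. -/
theorem lintegral_prob_evaluate (hP : ∀ x j, posProb A P x T j = 0)
    (e : X → Bool × Bool → Bool)
    (he : ∀ l j, Measurable fun x =>
      e x (majority ev (P (j + 1) (l + 1)).hyps x, (P (j + 1) (l + 1)).label)) :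
    ∫⁻ x, (evaluate ev T P x).prob A D₁ D₀ f {o | e x o = true} ∂D =
      ENNReal.ofReal (∑ l ∈ Finset.range T, ∑ j ∈ Finset.range (l + 1), (P (j + 1) (l + 1)).leaf *
        ∫ x, posProb A P x l j *
          ind (e x (majority ev (P (j + 1) (l + 1)).hyps x, (P (j + 1) (l + 1)).label)) ∂D) := by
  simp only [prob_evaluate hP]
  have hint : ∀ l j, Integrable (fun x => posProb A P x l j *
      ind (e x (majority ev (P (j + 1) (l + 1)).hyps x, (P (j + 1) (l + 1)).label))) D := fun l j =>
    integrable_of_mem ((measurable_posProb P l j).mul (measurable_ind.comp (he l j)))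
      (fun x => mul_nonneg (posProb_nonneg P x l j) (ind_nonneg _))
      fun x => mul_le_one₀ (posProb_le_one P x l j) (ind_nonneg _) (ind_le_one _)
  simp only [mul_left_comm (posProb A P _ _ _)]
  have hint' := fun l j => (hint l j).const_mul (P (j + 1) (l + 1)).leaf
  rw [← ofReal_integral_eq_lintegral_ofReal]
  · rw [integral_finsetSum _ fun l _ => integrable_finsetSum _ fun j _ => hint' l j]
    congr 1
    refine Finset.sum_congr rfl fun l _ => ?_
    rw [integral_finsetSum _ fun j _ => hint' l j]
    exact Finset.sum_congr rfl fun j _ => integral_const_mul _ _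
  · exact integrable_finsetSum _ fun l _ => integrable_finsetSum _ fun j _ => hint' l j
  · exact ae_of_all _ fun x => Finset.sum_nonneg fun l _ => Finset.sum_nonneg fun j _ =>
      mul_nonneg (Node.leaf_nonneg _) (mul_nonneg (posProb_nonneg P x l j) (ind_nonneg _))

theorem Node.up_le_one (N : Node X H m n) (x : X) : N.up A x ≤ 1 := by
  linarith [N.up_add_down_add_leaf (A := A) x, N.down_nonneg (A := A) x, N.leaf_nonneg]

omit [IsMarkovKernel A] in
theorem Node.down_le_one (N : Node X H m n) (x : X) : N.down A x ≤ 1 := by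
  linarith [N.up_add_down_add_leaf (A := A) x, N.up_nonneg (A := A) x, N.leaf_nonneg]

theorem integrable_posProb (P : Branching X H m n) (k j : ℕ) :
    Integrable (fun x => posProb A P x k j) D :=
  integrable_of_mem (measurable_posProb P k j) (fun x => posProb_nonneg P x k j)
    fun x => posProb_le_one P x k j

theorem integrable_posProb_mul_up (P : Branching X H m n) (k j : ℕ) (N : Node X H m n) :
    Integrable (fun x => posProb A P x k j * N.up A x) D :=
  integrable_of_mem ((measurable_posProb P k j).mul N.measurable_up)
    (fun x => mul_nonneg (posProb_nonneg P x k j) (N.up_nonneg x))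
    fun x => mul_le_one₀ (posProb_le_one P x k j) (N.up_nonneg x) (N.up_le_one x)

theorem integrable_posProb_mul_down (P : Branching X H m n) (k j : ℕ) (N : Node X H m n) :
    Integrable (fun x => posProb A P x k j * N.down A x) D :=
  integrable_of_mem ((measurable_posProb P k j).mul N.measurable_down)
    (fun x => mul_nonneg (posProb_nonneg P x k j) (N.down_nonneg x))
    fun x => mul_le_one₀ (posProb_le_one P x k j) (N.down_nonneg x) (N.down_le_one x)

/-- The masses of the nodes evolve by the routing. -/
theorem sum_nodeMass_mul (P : Branching X H m n) (k : ℕ) (G : ℕ → ℝ) :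
    ∑ j ∈ Finset.range (k + 2), nodeMass A D P (k + 1) j * G j =
      ∑ j ∈ Finset.range (k + 1),
        ((∫ x, posProb A P x k j * (P (j + 1) (k + 1)).up A x ∂D) * G (j + 1) +
          (∫ x, posProb A P x k j * (P (j + 1) (k + 1)).down A x ∂D) * G j) := by
  have h : ∫ x, ∑ j ∈ Finset.range (k + 2), posProb A P x (k + 1) j * G j ∂D =
      ∫ x, ∑ j ∈ Finset.range (k + 1), (posProb A P x k j * (P (j + 1) (k + 1)).up A x * G (j + 1) +
        posProb A P x k j * (P (j + 1) (k + 1)).down A x * G j) ∂D := by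
    refine integral_congr_ae (ae_of_all _ fun x => ?_)
    simp only [sum_posProb_mul]
    exact Finset.sum_congr rfl fun j _ => by ring
  have hu := fun j => (integrable_posProb_mul_up (A := A) (D := D) P k j
    (P (j + 1) (k + 1))).mul_const (G (j + 1))
  have hd := fun j => (integrable_posProb_mul_down (A := A) (D := D) P k j
    (P (j + 1) (k + 1))).mul_const (G j)
  rw [integral_finsetSum _ fun j _ => (integrable_posProb P (k + 1) j).mul_const _,
    integral_finsetSum _ fun j _ => by exact (hu j).add (hd j)] at h
  simp only [integral_mul_const] at h
  unfold nodeMass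
  rw [h]
  refine Finset.sum_congr rfl fun j _ => ?_
  have := integral_add (hu j) (hd j)
  simp only [integral_mul_const] at this
  exact this

theorem integral_up_add_integral_down_le (P : Branching X H m n) (k j : ℕ) :
    ∫ x, posProb A P x k j * (P (j + 1) (k + 1)).up A x ∂D +
      ∫ x, posProb A P x k j * (P (j + 1) (k + 1)).down A x ∂D ≤ nodeMass A D P k j := by
  rw [← integral_add (integrable_posProb_mul_up P k j _) (integrable_posProb_mul_down P k j _)]
  refine integral_mono ((integrable_posProb_mul_up P k j _).add (integrable_posProb_mul_down P k j _))
    (integrable_posProb P k j) fun x => ?_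
  have h1 := Node.up_add_down_add_leaf (A := A) (P (j + 1) (k + 1)) x
  have h2 := Node.leaf_nonneg (P (j + 1) (k + 1))
  have h3 := posProb_nonneg (A := A) P x k j
  show posProb A P x k j * _ + posProb A P x k j * _ ≤ posProb A P x k j
  rw [← mul_add]
  exact mul_le_of_le_one_right h3 (by linarith)

variable [IsProbabilityMeasure D₁] [IsProbabilityMeasure D₀] {ε γ : ℝ}
  (hgood : ∀ j k, j ≤ k → k < T → GoodNode A D₁ D₀ f ev T ε γ P k j (P (j + 1) (k + 1)))
include hgood

omit [IsMarkovKernel A] [IsProbabilityMeasure D₁] [IsProbabilityMeasure D₀] in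
/-- The nodes of the last level are leaves. -/
theorem posProb_eq_zero_of_goodNode (hT : 0 < T) (x : X) (j : ℕ) : posProb A P x T j = 0 := by
  obtain ⟨K, rfl⟩ : ∃ K, T = K + 1 := ⟨T - 1, by omega⟩
  have hlast : ∀ j, j ≤ K → (P (j + 1) (K + 1)).next = none := fun j hj => by
    rcases hgood j K hj (by omega) with h | h
    · exact h.1
    · exact absurd h.2.1 (by omega)
  have hdown : ∀ j, posProb A P x K j * (P (j + 1) (K + 1)).down A x = 0 := fun j => by
    rcases Nat.lt_or_ge K j with h | h
    · rw [posProb_eq_zero P x h, zero_mul]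
    · rw [Node.down_of_next_eq_none (hlast j h), mul_zero]
  have hup : ∀ j, posProb A P x K j * (P (j + 1) (K + 1)).up A x = 0 := fun j => by
    rcases Nat.lt_or_ge K j with h | h
    · rw [posProb_eq_zero P x h, zero_mul]
    · rw [Node.up_of_next_eq_none (hlast j h), mul_zero]
  cases j with
  | zero => exact hdown 0
  | succ j => exact (congrArg₂ (· + ·) (hdown (j + 1)) (hup j)).trans (add_zero 0)

omit [IsProbabilityMeasure D₀] in
theorem integral_down_le (hγ : γ ≤ 1 / 2) {k j : ℕ} (hj : j ≤ k) (hk : k < T) :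
    ∫ x, posProb A P x k j * (P (j + 1) (k + 1)).down A x ∂D₁ ≤
      (1 / 2 - γ) * nodeMass A D₁ P k j := by
  rcases hgood j k hj hk with h | h
  · simp only [Node.down_of_next_eq_none h.1, mul_zero, integral_zero]
    exact mul_nonneg (by linarith) (nodeMass_mem_Icc P k j).1
  · exact h.2.2.1

omit [IsProbabilityMeasure D₁] in
theorem integral_up_le (hγ : γ ≤ 1 / 2) {k j : ℕ} (hj : j ≤ k) (hk : k < T) :
    ∫ x, posProb A P x k j * (P (j + 1) (k + 1)).up A x ∂D₀ ≤
      (1 / 2 - γ) * nodeMass A D₀ P k j := by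
  rcases hgood j k hj hk with h | h
  · simp only [Node.up_of_next_eq_none h.1, mul_zero, integral_zero]
    exact mul_nonneg (by linarith) (nodeMass_mem_Icc P k j).1
  · exact h.2.2.2

omit hgood in
theorem sum_const_le (hε : 0 ≤ ε) :
    ∑ l ∈ Finset.range T, ∑ _j ∈ Finset.range (l + 1), ε / (T * (T + 1)) ≤ ε := by
  rcases Nat.eq_zero_or_pos T with rfl | hT
  · simpa using hε
  have hT0 : (0 : ℝ) < T := by exact_mod_cast hT
  have h : ∀ l ∈ Finset.range T, ∑ _j ∈ Finset.range (l + 1), ε / ((T : ℝ) * (T + 1)) ≤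
      ε / (T + 1) := fun l hl => by
    have hl' : ((l + 1 : ℕ) : ℝ) ≤ T := by exact_mod_cast Finset.mem_range.mp hl
    rw [Finset.sum_const, Finset.card_range, nsmul_eq_mul, ← div_div, mul_div_assoc']
    gcongr
    rw [mul_div_assoc', div_le_iff₀ hT0, mul_comm]
    exact mul_le_mul_of_nonneg_left hl' hε
  refine (Finset.sum_le_sum h).trans ?_
  rw [Finset.sum_const, Finset.card_range, nsmul_eq_mul, mul_div_assoc', div_le_iff₀ (by positivity)]
  nlinarith

omit hgood in
theorem sum_last_level (hT : 0 < T) (p : ℕ → Prop) [DecidablePred p] (F : ℕ → ℕ → ℝ) :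
    ∑ l ∈ Finset.range T, ∑ j ∈ Finset.range (l + 1), (if l + 1 = T ∧ p j then F l j else 0) =
      ∑ j ∈ Finset.range (T - 1 + 1), if p j then F (T - 1) j else 0 := by
  rw [Finset.sum_eq_single_of_mem (T - 1) (Finset.mem_range.mpr (by omega))]
  · refine Finset.sum_congr rfl fun j _ => ?_
    simp [show T - 1 + 1 = T by omega]
  · intro l _ hl
    refine Finset.sum_eq_zero fun j _ => if_neg fun h => hl (by omega)

omit [IsProbabilityMeasure D₀] in
/-- The training distribution is hardly rejected: few of its points reach a leaf with label `0`
before the last level, and the drift keeps the others away from the lower half of the last level. -/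
theorem lintegral_rejected_le (hT : 0 < T) (hε : 0 ≤ ε) (hγ0 : 0 ≤ γ) (hγ1 : γ ≤ 1 / 4) :
    ∫⁻ x, (evaluate ev T P x).prob A D₁ D₀ f {o | o.2 = false} ∂D₁ ≤
      ENNReal.ofReal (ε + √((1 - 4 * γ ^ 2) ^ (T - 1))) := by
  have h := lintegral_prob_evaluate (A := A) (D := D₁) (D₁ := D₁) (D₀ := D₀) (f := f) (ev := ev)
    (posProb_eq_zero_of_goodNode hgood hT) (fun _ o => !o.2) fun l j =>
      measurable_const (a := !(P (j + 1) (l + 1)).label)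
  have e : {o : Bool × Bool | o.2 = false} = {o | (!o.2) = true} := by ext o; simp
  rw [e, h]
  refine ENNReal.ofReal_le_ofReal ?_
  have hlow := sum_lower_le (K := T - 1) (sum_nodeMass_mul (A := A) (D := D₁) P)
    (nodeMass_mem_Icc P 0 0).2 (fun k j => (nodeMass_mem_Icc P k j).1) hγ0 hγ1
    (integral_up_add_integral_down_le P)
    fun k j hj hk => integral_down_le hgood (by linarith) hj (by omega)
  rw [← sum_last_level hT] at hlow
  refine le_trans ?_ (add_le_add (sum_const_le (T := T) hε) hlow)
  rw [← Finset.sum_add_distrib]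
  refine Finset.sum_le_sum fun l hl => ?_
  rw [← Finset.sum_add_distrib]
  refine Finset.sum_le_sum fun j hj => ?_
  have hl' := Finset.mem_range.mp hl
  have hj' := Finset.mem_range.mp hj
  have hm := (nodeMass_mem_Icc (A := A) (D := D₁) P l j).1
  have hc : 0 ≤ ε / ((T : ℝ) * (T + 1)) := by positivity
  have hif : 0 ≤ if l + 1 = T ∧ 2 * j ≤ T - 1 then nodeMass A D₁ P l j else 0 := by
    split_ifs <;> [exact hm; exact le_rfl]
  rcases hgood j l (by omega) hl' with h | h
  · rw [Node.leaf_of_next_eq_none h.1, one_mul]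
    cases hlab : (P (j + 1) (l + 1)).label with
    | true => simpa [ind] using add_nonneg hc hif
    | false =>
      simp only [Bool.not_false, ind, if_true, mul_one]
      change nodeMass A D₁ P l j ≤ _
      rcases h.2.1 hlab with h | h
      · linarith
      · rw [if_pos ⟨h.1, by omega⟩]
        linarith
  · obtain ⟨dq, hdq⟩ := Option.ne_none_iff_exists'.mp h.1
    simp only [Node.leaf, hdq, zero_mul]
    exact add_nonneg hc hif

/-- The selected points of the test distribution are hardly misclassified: the errors at leaves with
label `1` before the last level are controlled, and the drift keeps the other points away from the
upper half of the last level. -/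
theorem lintegral_misclassified_le (hev : Measurable (Function.uncurry ev)) (hf : Measurable f)
    (hT : 0 < T) (hε : 0 ≤ ε) (hγ0 : 0 ≤ γ) (hγ1 : γ ≤ 1 / 4) :
    ∫⁻ x, (evaluate ev T P x).prob A D₁ D₀ f {o | f x ≠ o.1 ∧ o.2 = true} ∂D₀ ≤
      ENNReal.ofReal (4 * ε + ε + 2 * √((1 - 4 * γ ^ 2) ^ (T - 1))) := by
  have hz := posProb_eq_zero_of_goodNode hgood hT
  have hmeas : ∀ l j, Measurable fun x =>
      decide (f x ≠ majority ev (P (j + 1) (l + 1)).hyps x) && (P (j + 1) (l + 1)).label := fun l j => by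
    refine (measurable_of_finite fun b : Bool => b && (P (j + 1) (l + 1)).label).comp
      (measurable_to_bool ?_)
    convert (measurableSet_eq_fun hf (measurable_majority hev (P (j + 1) (l + 1)).hyps)).compl using 1
    ext x; simp
  have h := lintegral_prob_evaluate (A := A) (D := D₀) (D₁ := D₁) (D₀ := D₀) (f := f) (ev := ev)
    hz (fun x o => decide (f x ≠ o.1) && o.2) hmeas
  have e : ∀ x, {o : Bool × Bool | f x ≠ o.1 ∧ o.2 = true} =
      {o | (decide (f x ≠ o.1) && o.2) = true} := fun x => by ext o; simp
  simp only [e]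
  rw [h]
  refine ENNReal.ofReal_le_ofReal ?_
  have hup := sum_upper_le (K := T - 1) (sum_nodeMass_mul (A := A) (D := D₀) P)
    (nodeMass_mem_Icc P 0 0).2 (fun k j => (nodeMass_mem_Icc P k j).1) hγ0 hγ1
    (integral_up_add_integral_down_le P)
    fun k j hj hk => integral_up_le hgood (by linarith) hj (by omega)
  rw [← sum_last_level hT] at hup
  have htot : ∑ l ∈ Finset.range T, ∑ j ∈ Finset.range (l + 1),
      (P (j + 1) (l + 1)).leaf * nodeMass A D₀ P l j ≤ 1 := by
    have h1 := lintegral_prob_evaluate (A := A) (D := D₀) (D₁ := D₁) (D₀ := D₀) (f := f) (ev := ev)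
      hz (fun _ _ => true) (fun _ _ => measurable_const)
    have h2 : ∫⁻ x, (evaluate ev T P x).prob A D₁ D₀ f {o | true = true} ∂D₀ ≤ 1 :=
      (lintegral_mono fun x => prob_le_one _ _).trans (by simp)
    rw [h1] at h2
    simpa [ind, nodeMass] using ENNReal.ofReal_le_one.mp h2
  refine le_trans ?_ (add_le_add (add_le_add
    (mul_le_of_le_one_right (show 0 ≤ 4 * ε by linarith) htot) (sum_const_le (T := T) hε)) hup)
  rw [Finset.mul_sum, ← Finset.sum_add_distrib, ← Finset.sum_add_distrib]
  refine Finset.sum_le_sum fun l hl => ?_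
  rw [Finset.mul_sum, ← Finset.sum_add_distrib, ← Finset.sum_add_distrib]
  refine Finset.sum_le_sum fun j hj => ?_
  have hl' := Finset.mem_range.mp hl
  have hj' := Finset.mem_range.mp hj
  have hm := (nodeMass_mem_Icc (A := A) (D := D₀) P l j).1
  have hc : 0 ≤ ε / ((T : ℝ) * (T + 1)) := by positivity
  have hif : 0 ≤ if l + 1 = T ∧ T - 1 ≤ 2 * j + 1 then nodeMass A D₀ P l j else 0 := by
    split_ifs <;> [exact hm; exact le_rfl]
  have h4 : 0 ≤ 4 * ε * nodeMass A D₀ P l j := by positivity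
  rcases hgood j l (by omega) hl' with h | h
  · rw [Node.leaf_of_next_eq_none h.1, one_mul, one_mul]
    cases hlab : (P (j + 1) (l + 1)).label with
    | false =>
      simp only [Bool.and_false, ind, Bool.false_eq_true, if_false, mul_zero, integral_zero]
      exact add_nonneg (add_nonneg h4 hc) hif
    | true =>
      simp only [Bool.and_true]
      change errorMass A D₀ f ev P l j _ ≤ _
      rcases h.2.2 hlab with h | h
      · linarith
      · rw [if_pos ⟨h.1, by omega⟩]
        have := errorMass_le_nodeMass (A := A) (D := D₀) (P := P) (k := l) (j := j) hev hf
          (P (j + 1) (l + 1)).hyps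
        linarith
  · obtain ⟨dq, hdq⟩ := Option.ne_none_iff_exists'.mp h.1
    simp only [Node.leaf, hdq, zero_mul, mul_zero, zero_add]
    exact add_nonneg hc hif

end Evaluation

section Boost

open Prog

variable {X : Type u} {H : Type v} [MeasurableSpace X] [MeasurableSpace H] {m n : ℕ}
  {A : Learner X H m n} [IsMarkovKernel A] {ev : H → X → Bool} {C : Set (X → Bool)} {ε δ c c₁ : ℝ}

/-- The walk has drift `γ = 10⁻⁵ / (m + n)`, which asks for `c ≥ 10 ^ 10`. The total error is then at
most `4 ε + ε + 2 ε`; the constant `100` is chosen to make the claim trivial for `ε > 1 / 100`. -/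
theorem isPQLearner_boost (hA : IsTDSLearner ev C A ε 0.01)
    (hev : Measurable (Function.uncurry ev)) (hC : ∀ f ∈ C, Measurable f) (hM : 1 ≤ m + n)
    (hε : 0 < ε) (hδ : 0 < δ) (hδ1 : δ < 1)
    (hc₁ : 1000 ≤ c₁) (hc : 10 ^ 10 ≤ c) (hcc : 2 * (c₁ + 1) ≤ c) :
    IsPQLearner A C (100 * ε) (100 * ε) δ (boost c c₁ ev ε δ) := by
  intro D₁ D₀ _ _ f hfC
  have hf := hC f hfC
  by_cases hε1 : ε ≤ 1 / 100
  swap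
    -- an error of more than `1` is no restriction
  · have h1 : (1 : ℝ≥0∞) ≤ ENNReal.ofReal (100 * ε) := by
      rw [← ENNReal.ofReal_one]
      exact ENNReal.ofReal_le_ofReal (by linarith)
    refine Whp.of_forall (fun o => by
      constructor <;>
      exact (lintegral_mono fun x => prob_le_one _ _).trans (by simpa using h1)) hδ.le
  have hM1 : (1 : ℝ) ≤ (m + n : ℕ) := by exact_mod_cast hM
  have hTc := le_numLevels' (c := c) (M := m + n) (by linarith) hε hε1
  have hTl := le_numLevels (c := c) (M := m + n) (ε := ε)
  have hl := one_le_log_inv hε hε1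
  set T := numLevels c (m + n) ε with hTdef
  have hT2 : (2 : ℝ) ≤ T := by nlinarith
  have hT0 : 2 ≤ T := by exact_mod_cast hT2
  set γ : ℝ := 1 / (10 ^ 5 * (m + n : ℕ)) with hγ
  have hγ0 : 0 ≤ γ := by positivity
  have hγ1 : γ ≤ 1 / 4 := one_div_le_one_div_of_le (by norm_num) (by linarith)
  have hs : √((1 - 4 * γ ^ 2) ^ (T - 1)) ≤ ε := by
    refine sqrt_pow_le hε (by nlinarith) ?_
    rw [Nat.cast_sub (by omega), Nat.cast_one]
    have e : γ ^ 2 * (c * ((m + n : ℕ) : ℝ) ^ 2 * Real.log (1 / ε)) =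
        c / 10 ^ 10 * Real.log (1 / ε) := by
      rw [hγ]
      field_simp
    have h1 := mul_le_mul_of_nonneg_left hTl (sq_nonneg γ)
    rw [e] at h1
    have h2 : 1 ≤ c / 10 ^ 10 := by rw [le_div_iff₀ (by norm_num)]; linarith
    have h3 : Real.log (1 / ε) ≤ c / 10 ^ 10 * Real.log (1 / ε) :=
      le_mul_of_one_le_left (by linarith) h2
    have h4 : 0 ≤ γ ^ 2 * (T - 2) := mul_nonneg (sq_nonneg γ) (by linarith)
    linarith
  change Whp A D₁ D₀ f (boost c c₁ ev ε δ) _ δ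
  unfold boost
  simp only [whp_steps_iff]
  refine Whp.mono ((whp_visitAll_nodes (D₁ := D₁) (D₀ := D₀) hA hev hfC hf hM hTc hε hε1 hδ hδ1 hc₁
    (by linarith) hcc).bind (b := 0) (fun P hP => ?_) hδ.le le_rfl) subset_rfl (add_zero δ).le
  refine Whp.ret (by
    refine ⟨?_, ?_⟩
    · refine (lintegral_misclassified_le (γ := γ) hP hev hf (by omega) hε.le hγ0 hγ1).trans ?_
      exact ENNReal.ofReal_le_ofReal (by linarith)
    · refine (lintegral_rejected_le (γ := γ) hP (by omega) hε.le hγ0 hγ1).trans ?_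
      exact ENNReal.ofReal_le_ofReal (by linarith)) le_rfl

end Boost

/-! ### The number of operations -/

namespace Prog

section Cost

variable {X : Type u} {H : Type v} {m n : ℕ} {α : Type w} {β : Type z}

/-- Every run of `p` performs at most `N` operations, of whatever kind. -/
def OpsLe (p : Prog X H m n α) (N : ℕ) : Prop := p.cost (fun _ => 1) ≤ N

theorem add_iSup_le_mul {γ : Type*} {a s : ℕ} (ha : a ≤ s) {F G : γ → ℕ∞} (h : ∀ x, F x ≤ s * G x) :
    (a : ℕ∞) + ⨆ x, F x ≤ s * ((1 : ℕ) + ⨆ x, G x) := by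
  rw [mul_add, Nat.cast_one, mul_one]
  refine add_le_add (by exact_mod_cast ha) (iSup_le fun x => (h x).trans ?_)
  exact mul_le_mul_right (le_iSup G x) _

theorem add_iSup_le_add {γ : Type*} {a b : ℕ∞} {F G : γ → ℕ∞} (h : ∀ x, F x ≤ G x + b) :
    a + ⨆ x, F x ≤ a + (⨆ x, G x) + b := by
  rw [add_assoc]
  exact add_le_add le_rfl (iSup_le fun x => (h x).trans (add_le_add (le_iSup G x) le_rfl))

/-- If no operation costs more than `s`, the cost is at most `s` times the number of operations. -/
theorem cost_le_mul {c : Op → ℕ} {s : ℕ} (hc : ∀ o, c o ≤ s) (p : Prog X H m n α) :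
    p.cost c ≤ s * p.cost fun _ => 1 := by
  induction p with
  | ret a => simp [cost]
  | step p ih =>
    simp only [cost]
    rw [mul_add, Nat.cast_one, mul_one]
    exact add_le_add (by exact_mod_cast hc _) ih
  | flip q k ih => exact add_iSup_le_mul (hc _) ih
  | train k ih => exact add_iSup_le_mul (hc _) ih
  | test k ih => exact add_iSup_le_mul (hc _) ih
  | call S U k ih => exact add_iSup_le_mul (hc _) ih

theorem OpsLe.cost_le {c : Op → ℕ} {s N : ℕ} {p : Prog X H m n α} (h : p.OpsLe N)
    (hc : ∀ o, c o ≤ s) : p.cost c ≤ (s * N : ℕ) := by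
  refine (cost_le_mul hc p).trans ?_
  push_cast
  exact mul_le_mul_right h _

theorem OpsLe.mono {p : Prog X H m n α} {N N' : ℕ} (h : p.OpsLe N) (hN : N ≤ N') : p.OpsLe N' :=
  le_trans h (by exact_mod_cast hN)

theorem opsLe_ret (a : α) (N : ℕ) : (ret a : Prog X H m n α).OpsLe N := by
  simp [OpsLe, cost]

theorem OpsLe.step {p : Prog X H m n α} {N : ℕ} (h : p.OpsLe N) : (Prog.step p).OpsLe (1 + N) := by
  unfold OpsLe at *
  push_cast
  exact add_le_add (by simp) h

theorem OpsLe.steps {p : Prog X H m n α} {N : ℕ} (h : p.OpsLe N) (k : ℕ) :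
    (Prog.steps k p).OpsLe (k + N) := by
  induction k with
  | zero => simpa [Prog.steps] using h
  | succ k ih => exact ih.step.mono (by omega)

theorem opsLe_flip {q : I} {k : Bool → Prog X H m n α} {N : ℕ} (h : ∀ b, (k b).OpsLe N) :
    (flip q k).OpsLe (1 + N) := by
  unfold OpsLe at *
  push_cast
  exact add_le_add (by simp) (iSup_le h)

theorem opsLe_train {k : X × Bool → Prog X H m n α} {N : ℕ} (h : ∀ b, (k b).OpsLe N) :
    (train k).OpsLe (1 + N) := by
  unfold OpsLe at *
  push_cast
  exact add_le_add (by simp) (iSup_le h)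

theorem opsLe_test {k : X → Prog X H m n α} {N : ℕ} (h : ∀ b, (k b).OpsLe N) :
    (test k).OpsLe (1 + N) := by
  unfold OpsLe at *
  push_cast
  exact add_le_add (by simp) (iSup_le h)

theorem opsLe_call {S : Fin m → X × Bool} {U : Fin n → X} {k : Answer H → Prog X H m n α} {N : ℕ}
    (h : ∀ b, (k b).OpsLe N) : (call S U k).OpsLe (1 + N) := by
  unfold OpsLe at *
  push_cast
  exact add_le_add (by simp) (iSup_le h)

theorem OpsLe.bind {p : Prog X H m n α} {g : α → Prog X H m n β} {N N' : ℕ} (hp : p.OpsLe N)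
    (hg : ∀ a, (g a).OpsLe N') : (p.bind g).OpsLe (N + N') := by
  have h : (p.bind g).cost (fun _ => 1) ≤ p.cost (fun _ => 1) + N' := by
    clear hp
    induction p with
    | ret a => simpa [Prog.bind, cost, OpsLe] using hg a
    | step p ih =>
      simp only [Prog.bind, cost]
      rw [add_assoc]
      exact add_le_add le_rfl ih
    | flip q k ih => exact add_iSup_le_add ih
    | train k ih => exact add_iSup_le_add ih
    | test k ih => exact add_iSup_le_add ih
    | call S U k ih => exact add_iSup_le_add ih
  refine h.trans ?_
  push_cast
  exact add_le_add hp le_rfl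

theorem opsLe_tuple {k : ℕ} {p : Fin k → Prog X H m n α} {N : ℕ} (h : ∀ j, (p j).OpsLe N) :
    (tuple k p).OpsLe (k * (1 + N)) := by
  induction k with
  | zero => exact opsLe_ret _ _
  | succ k ih =>
    exact ((h 0).bind fun a => (ih fun j => h j.succ).bind fun v => opsLe_ret _ 0).step.mono
      (by rw [Nat.succ_mul]; omega)

theorem opsLe_average {k : ℕ} {p : Prog X H m n ℝ} {N : ℕ} (h : p.OpsLe N) :
    (average k p).OpsLe (k * (1 + N) + (k + 1)) :=
  (opsLe_tuple fun _ => h).bind fun _ => (opsLe_ret _ 0).steps _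

theorem opsLe_estimate {γ δ : ℝ} {p : Prog X H m n Bool} {N K : ℕ} (h : p.OpsLe N)
    (hK : Real.log (2 / δ) / (2 * γ ^ 2) ≤ K) :
    (estimate γ δ p).OpsLe (K * (1 + (N + 1)) + (K + 1)) := by
  refine (opsLe_average (h.bind fun b => (opsLe_ret (ind b) 0).step)).mono ?_
  have := Nat.ceil_le.mpr hK
  gcongr

theorem opsLe_drawTrain : (drawTrain : Prog X H m n (X × Bool)).OpsLe 1 :=
  opsLe_train fun s => opsLe_ret s 0

theorem opsLe_drawTest : (drawTest : Prog X H m n X).OpsLe 1 := opsLe_test fun s => opsLe_ret s 0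

theorem opsLe_runA (S : Fin m → X × Bool) (U : Fin n → X) :
    (runA S U : Prog X H m n (Answer H)).OpsLe (m + n + 1) :=
  (opsLe_call fun r => opsLe_ret r 0).steps _

end Cost

end Prog

section AlgorithmCost

open Prog

variable {X : Type u} {H : Type v} {m n : ℕ} {draw₁ : Prog X H m n (X × Bool)}
  {draw₀ : Prog X H m n X} {N : ℕ}

theorem opsLe_run (d : WeakDist X m n) (x : X) :
    (d.run x : Prog X H m n Bool).OpsLe (m + n + 2) :=
  (opsLe_runA _ _).bind fun r => (opsLe_ret r.accepts 0).step

theorem opsLe_runOn (h₁ : draw₁.OpsLe N) (h₀ : draw₀.OpsLe N) :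
    (runOn draw₁ draw₀).OpsLe (m * (1 + N) + (n * (1 + N) + (m + n + 1))) :=
  (opsLe_tuple fun _ => h₁).bind fun S => (opsLe_tuple fun _ => h₀).bind fun U => opsLe_runA S U

theorem opsLe_sampleMixture (h₁ : draw₁.OpsLe N) (h₀ : draw₀.OpsLe N) :
    (sampleMixture draw₁ draw₀).OpsLe (1 + N) :=
  opsLe_flip fun b => by
    cases b
    · simpa using h₀
    · exact h₁.bind fun s => opsLe_ret _ 0

/-- A bound for the number of operations of `findTrainSet`, given a bound `N` for the samplers. -/
def findTrainSetOps (m n N r k : ℕ) : ℕ :=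
  k * (1 + (m * (1 + N) + (r * (1 + (n * (1 + N) + (n * (1 + N) + ((m + n + 1) + ((m + n + 1) + 1))))) +
    (r + 1))))

theorem opsLe_findTrainSet (h₁ : draw₁.OpsLe N) (h₀ : draw₀.OpsLe N) (r k : ℕ) :
    (findTrainSet draw₁ draw₀ r k).OpsLe (findTrainSetOps m n N r k) := by
  induction k with
  | zero => exact opsLe_ret _ _
  | succ k ih =>
    have h := fun S : Fin m → X × Bool => opsLe_average (k := r) <|
      (opsLe_tuple (k := n) (p := fun _ => draw₁.bind fun s => ret s.1)
        fun _ => h₁.bind fun s => opsLe_ret s.1 0).bind fun U₁ =>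
      (opsLe_tuple (k := n) (p := fun _ => draw₀) fun _ => h₀).bind fun U₀ =>
      (opsLe_runA S U₁).bind fun r₁ =>
      (opsLe_runA S U₀).bind fun r₀ =>
      (opsLe_ret (X := X) (H := H) (m := m) (n := n) (ind r₁.accepts - ind r₀.accepts) 0).step
    refine ((opsLe_tuple fun _ => h₁).bind fun S => (h S).bind (N' := findTrainSetOps m n N r k)
      fun p => ?_).step.mono ?_
    · split_ifs
      · exact opsLe_ret _ _
      · exact ih
    · unfold findTrainSetOps
      rw [Nat.succ_mul]
      simp only [Nat.add_zero]
      omega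

/-- A bound for the number of operations of `searchSlot`. -/
def searchSlotOps (m n N l k : ℕ) : ℕ :=
  k * (1 + (n * (1 + N) + (l * (1 + (N + (N + ((m + n + 2) + ((m + n + 2) + 1))))) + (l + 1))))

theorem opsLe_searchSlot (h₁ : draw₁.OpsLe N) (h₀ : draw₀.OpsLe N) (l : ℕ) (S : Fin m → X × Bool)
    (i : Fin n) (k : ℕ) :
    (searchSlot draw₁ draw₀ l S i k).OpsLe (searchSlotOps m n N l k) := by
  induction k with
  | zero => exact opsLe_ret _ _
  | succ k ih =>
    have h := fun c : Fin n → X => opsLe_average (k := l) <|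
      h₁.bind fun s => h₀.bind fun x =>
      (opsLe_run (H := H) (⟨S, c, i⟩ : WeakDist X m n) s.1).bind fun b₁ =>
      (opsLe_run (H := H) (⟨S, c, i⟩ : WeakDist X m n) x).bind fun b₀ =>
      (opsLe_ret (X := X) (H := H) (m := m) (n := n) (ind b₁ - ind b₀) 0).step
    refine ((opsLe_tuple (N := N) fun j => ?_).bind fun c => (h c).bind (N' := searchSlotOps m n N l k)
      fun p => ?_).step.mono ?_
    · split_ifs
      · exact h₀
      · exact h₁.bind fun s => opsLe_ret _ 0
    · split_ifs
      · exact opsLe_ret _ _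
      · exact ih
    · unfold searchSlotOps
      rw [Nat.succ_mul]
      simp only [Nat.add_zero]
      omega

theorem opsLe_searchSlots (h₁ : draw₁.OpsLe N) (h₀ : draw₀.OpsLe N) (l k : ℕ)
    (S : Fin m → X × Bool) (is : List (Fin n)) :
    (searchSlots draw₁ draw₀ l k S is).OpsLe (is.length * (1 + searchSlotOps m n N l k)) := by
  induction is with
  | nil => exact opsLe_ret _ _
  | cons i is ih =>
    refine ((opsLe_searchSlot h₁ h₀ l S i k).bind
      (N' := is.length * (1 + searchSlotOps m n N l k)) fun o => ?_).step.mono ?_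
    · cases o with
      | none => exact ih
      | some d => exact opsLe_ret _ _
    · rw [List.length_cons, Nat.succ_mul]
      omega

theorem findTrainSetOps_mono {r r' k k' : ℕ} (hr : r ≤ r') (hk : k ≤ k') :
    findTrainSetOps m n N r k ≤ findTrainSetOps m n N r' k' := by
  unfold findTrainSetOps
  gcongr

theorem searchSlotOps_mono {r r' k k' : ℕ} (hr : r ≤ r') (hk : k ≤ k') :
    searchSlotOps m n N r k ≤ searchSlotOps m n N r' k' := by
  unfold searchSlotOps
  gcongr

theorem opsLe_getWeakDistinguisher (h₁ : draw₁.OpsLe N) (h₀ : draw₀.OpsLe N) {c c₁ δ : ℝ}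
    {r₁ k₁ r₂ k₂ : ℕ} (hr₁ : c * Real.log (1 / δ) ≤ r₁) (hk₁ : c₁ * Real.log (1 / δ) ≤ k₁)
    (hr₂ : c * (n : ℝ) ^ 2 * Real.log (n / δ) ≤ r₂) (hk₂ : c₁ * n * Real.log (1 / δ) ≤ k₂) :
    (getWeakDistinguisher c c₁ draw₁ draw₀ δ).OpsLe
      (findTrainSetOps m n N r₁ k₁ + n * (1 + searchSlotOps m n N r₂ k₂)) := by
  refine ((opsLe_findTrainSet h₁ h₀ _ _).mono
    (findTrainSetOps_mono (Nat.ceil_le.mpr hr₁) (Nat.ceil_le.mpr hk₁))).bind fun o => ?_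
  cases o with
  | none => exact opsLe_ret _ _
  | some S =>
    refine (opsLe_searchSlots h₁ h₀ _ _ S _).mono ?_
    rw [List.length_finRange]
    have := searchSlotOps_mono (m := m) (n := n) (N := N) (Nat.ceil_le.mpr hr₂) (Nat.ceil_le.mpr hk₂)
    gcongr

theorem opsLe_walk (P : Branching X H m n) (x : X) (k : ℕ) (M : ℕ × ℕ) :
    (walk P x k M).OpsLe (k * (m + n + 8)) := by
  induction k generalizing M with
  | zero => exact opsLe_ret _ _
  | succ k ih =>
    rw [walk]
    refine OpsLe.mono (OpsLe.step (N := (m + n + 2) + (5 + k * (m + n + 8))) ?_)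
      (by rw [Nat.succ_mul]; omega)
    rcases (P M.1 M.2).next with _ | ⟨d, q⟩
    · exact opsLe_ret _ _
    · exact (opsLe_run d x).bind fun w =>
        OpsLe.bind (opsLe_flip (N := 4) fun ξ => (opsLe_ret _ 0).steps 4) fun b => ih _

theorem opsLe_reaches (P : Branching X H m n) (i t : ℕ) (x : X) :
    (reaches P i t x).OpsLe (t * (m + n + 8) + 2) :=
  ((opsLe_walk P x (t - 1) (1, 1)).bind fun N => (opsLe_ret _ 0).steps 2).mono (by
    have := Nat.mul_le_mul_right (m + n + 8) (Nat.sub_le t 1)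
    omega)

theorem opsLe_rejectionSample {α : Type u} {draw : Prog X H m n α} {V : α → Prog X H m n Bool}
    {N' : ℕ} (h : draw.OpsLe N) (hV : ∀ a, (V a).OpsLe N') (k : ℕ) :
    (rejectionSample draw V k).OpsLe (k * (1 + (N + N')) + N) := by
  induction k with
  | zero => simpa [rejectionSample] using h
  | succ k ih =>
    refine (h.bind fun a => (hV a).bind (N' := k * (1 + (N + N')) + N) fun b => ?_).step.mono
      (by rw [Nat.succ_mul]; omega)
    cases b
    · exact ih
    · exact opsLe_ret _ _

/-- A bound for the number of operations of the samplers at a node of level at most `T`, with at most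
`a` attempts. -/
def sampleOps (m n a T : ℕ) : ℕ := a * (1 + (1 + (T * (m + n + 8) + 2))) + 1

/-- A bound for the number of operations of a visit, given a bound `N` for the samplers, the numbers
`K₁`, `K₂`, `K₃` of trials of the estimates, the number `r` of runs for the majority vote, and the
parameters of the search for a weak distinguisher. -/
def visitOps (m n T N K₁ K₂ K₃ r r₁ k₁ r₂ k₂ : ℕ) : ℕ :=
  (K₁ * (1 + ((1 + (T * (m + n + 8) + 2)) + 1)) + (K₁ + 1)) +
  ((K₁ * (1 + ((1 + (T * (m + n + 8) + 2)) + 1)) + (K₁ + 1)) +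
  (3 + ((K₂ * (1 + (((m * (1 + N) + (n * (1 + N) + (m + n + 1))) + 0) + 1)) + (K₂ + 1)) +
  (1 + ((r * (1 + (m * (1 + N) + (n * (1 + N) + (m + n + 1)))) + (r + 1)) +
  (1 + ((findTrainSetOps m n N r₁ k₁ + n * (1 + searchSlotOps m n N r₂ k₂)) +
  ((K₃ * (1 + ((1 + N) + (m + n + 2) + 1)) + (K₃ + 1)) + 1))))))))

theorem opsLe_visit {c c₁ ε δ : ℝ} {T a K₁ K₂ K₃ r r₁ k₁ r₂ k₂ : ℕ}
    (ha : (numRuns c T ε δ : ℝ) / pMin T ε ≤ a)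
    (hK₁ : Real.log (2 / subDelta c T δ) / (2 * gammaOne T ε ^ 2) ≤ K₁)
    (hK₂ : Real.log (2 / subDelta c T δ) / (2 * 0.01 ^ 2) ≤ K₂)
    (hK₃ : Real.log (2 / subDelta c T δ) / (2 * gammaTwo c (m + n) ^ 2) ≤ K₃)
    (hr : c * Real.log (T / (ε * δ)) ≤ r)
    (hr₁ : c * Real.log (1 / subDelta c T δ) ≤ r₁) (hk₁ : c₁ * Real.log (1 / subDelta c T δ) ≤ k₁)
    (hr₂ : c * (n : ℝ) ^ 2 * Real.log (n / subDelta c T δ) ≤ r₂)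
    (hk₂ : c₁ * n * Real.log (1 / subDelta c T δ) ≤ k₂) {i t : ℕ} (ht : t ≤ T)
    (P : Branching X H m n) :
    (visit c c₁ ε δ T i t P).OpsLe
      (visitOps m n T (sampleOps m n a T) K₁ K₂ K₃ r r₁ k₁ r₂ k₂) := by
  have hreach : ∀ x, (reaches P i t x).OpsLe (T * (m + n + 8) + 2) := fun x =>
    (opsLe_reaches P i t x).mono (by gcongr)
  have hatt : numAttempts c T ε δ ≤ a := Nat.ceil_le.mpr ha
  have hruns : numRuns c T ε δ ≤ r := Nat.ceil_le.mpr hr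
  have hs : ∀ N', numAttempts c T ε δ * (1 + (1 + N')) + 1 ≤ a * (1 + (1 + N')) + 1 := fun N' => by
    gcongr
  have h₁ : (sampleTrain (numAttempts c T ε δ) P i t).OpsLe (sampleOps m n a T) :=
    (opsLe_rejectionSample opsLe_drawTrain (fun s => hreach s.1) _).mono (hs _)
  have h₀ : (sampleTest (numAttempts c T ε δ) P i t).OpsLe (sampleOps m n a T) :=
    (opsLe_rejectionSample opsLe_drawTest (fun x => hreach x) _).mono (hs _)
  unfold visit visitOps
  refine (opsLe_estimate (opsLe_drawTrain.bind fun s => hreach s.1) hK₁).bind fun p₁ => ?_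
  refine (opsLe_estimate (opsLe_drawTest.bind fun x => hreach x) hK₁).bind fun p₀ => ?_
  refine OpsLe.steps ?_ 3
  by_cases htest : (p₁ < pMin T ε ∨ p₀ < pMin T ε) ∧ t < T
  · rw [if_pos htest]
    exact (opsLe_ret _ 0).step.mono (by omega)
  · rw [if_neg htest]
    refine (opsLe_estimate ((opsLe_runOn h₁ h₀).bind fun a => opsLe_ret _ 0) hK₂).bind fun y => ?_
    refine OpsLe.step ?_
    by_cases hy : 0.95 ≤ y
    · rw [if_pos hy]
      refine OpsLe.mono ((opsLe_tuple fun _ => opsLe_runOn h₁ h₀).bind fun ans =>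
        (opsLe_ret _ 0).steps _) ?_
      exact (Nat.add_le_add (Nat.mul_le_mul_right _ hruns) (by omega)).trans (Nat.le_add_right _ _)
    · rw [if_neg hy]
      refine OpsLe.mono (OpsLe.step (N := (findTrainSetOps m n (sampleOps m n a T) r₁ k₁ +
        n * (1 + searchSlotOps m n (sampleOps m n a T) r₂ k₂)) + ((K₃ * (1 + ((1 + sampleOps m n a T) +
          (m + n + 2) + 1)) + (K₃ + 1)) + 1)) ?_) (Nat.le_add_left _ _)
      by_cases hlt : t < T
      · simp only [if_pos hlt]
        refine (opsLe_getWeakDistinguisher h₁ h₀ hr₁ hk₁ hr₂ hk₂).bind fun o => ?_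
        cases o with
        | none => exact opsLe_ret _ _
        | some d =>
          exact (opsLe_estimate ((opsLe_sampleMixture h₁ h₀).bind fun x => opsLe_run d x) hK₃).bind
            fun q => (opsLe_ret _ 0).step
      · simp only [if_neg hlt]
        exact opsLe_ret _ _

theorem opsLe_visitAll {c c₁ ε δ : ℝ} {T V : ℕ} (Ns : List (ℕ × ℕ))
    (hV : ∀ M ∈ Ns, ∀ P : Branching X H m n, (visit c c₁ ε δ T M.1 M.2 P).OpsLe V)
    (P : Branching X H m n) : (visitAll c c₁ ε δ T Ns P).OpsLe (Ns.length * (1 + V)) := by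
  induction Ns generalizing P with
  | nil => exact opsLe_ret _ _
  | cons M Ns ih =>
    refine ((hV M (by simp) P).bind fun Q => ih (fun M hM => hV M (by simp [hM])) Q).step.mono ?_
    rw [List.length_cons, Nat.succ_mul]
    omega

theorem opsLe_boost {c c₁ ε δ : ℝ} {V : ℕ} (ev : H → X → Bool)
    (hV : ∀ i t, t ≤ numLevels c (m + n) ε → ∀ P : Branching X H m n,
      (visit c c₁ ε δ (numLevels c (m + n) ε) i t P).OpsLe V) :
    (boost c c₁ ev ε δ : Prog X H m n _).OpsLe
      (numLevels c (m + n) ε * (numLevels c (m + n) ε + 1) +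
        numLevels c (m + n) ε ^ 2 * (1 + V)) := by
  refine OpsLe.steps ?_ _
  refine (OpsLe.bind (opsLe_visitAll _ (fun M hM P => ?_) _) fun P => opsLe_ret _ 0).mono
    (Nat.mul_le_mul_right (1 + V) (length_nodes_le (numLevels c (m + n) ε)))
  obtain ⟨j, k, rfl, hj, hk⟩ := exists_of_mem_nodes hM
  exact hV _ _ hk P

end AlgorithmCost

/-! ### Polynomial bounds -/

section Polynomial

variable {ι : Type*} {x : ι → Fin 3 → ℝ} {f g : ι → ℕ}

/-- The natural number `f i` is bounded by a polynomial in the three reals `x i`. -/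
def PolyDominated (x : ι → Fin 3 → ℝ) (f : ι → ℕ) : Prop :=
  ∃ P : MvPolynomial (Fin 3) ℝ, ∀ i, (f i : ℝ) ≤ MvPolynomial.eval (x i) P

theorem PolyDominated.mono (hg : PolyDominated x g) (h : ∀ i, f i ≤ g i) : PolyDominated x f := by
  obtain ⟨P, hP⟩ := hg
  exact ⟨P, fun i => le_trans (by exact_mod_cast h i) (hP i)⟩

theorem PolyDominated.const (k : ℕ) : PolyDominated x fun _ => k :=
  ⟨MvPolynomial.C (k : ℝ), fun i => by simp⟩

theorem PolyDominated.add (hf : PolyDominated x f) (hg : PolyDominated x g) :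
    PolyDominated x fun i => f i + g i := by
  obtain ⟨P, hP⟩ := hf
  obtain ⟨Q, hQ⟩ := hg
  exact ⟨P + Q, fun i => by push_cast; rw [map_add]; exact add_le_add (hP i) (hQ i)⟩

theorem PolyDominated.mul (hf : PolyDominated x f) (hg : PolyDominated x g) :
    PolyDominated x fun i => f i * g i := by
  obtain ⟨P, hP⟩ := hf
  obtain ⟨Q, hQ⟩ := hg
  refine ⟨P * Q, fun i => ?_⟩
  push_cast
  rw [map_mul]
  exact mul_le_mul (hP i) (hQ i) (Nat.cast_nonneg _) ((Nat.cast_nonneg _).trans (hP i))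

theorem PolyDominated.pow (hf : PolyDominated x f) (k : ℕ) :
    PolyDominated x fun i => f i ^ k := by
  induction k with
  | zero => simpa using PolyDominated.const 1
  | succ k ih => simpa only [pow_succ] using ih.mul hf

theorem PolyDominated.ceil (hx : ∀ i, 0 ≤ x i j) : PolyDominated x fun i => ⌈x i j⌉₊ :=
  ⟨MvPolynomial.X j + 1, fun i => by simpa using (Nat.ceil_lt_add_one (hx i)).le⟩

end Polynomial

section ParameterBounds

/-! The parameters of the algorithm are bounded by natural numbers that are polynomials in the
sample complexity, in `E ≥ 1 / ε` and in `L ≥ log (1 / δ)`. -/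

variable {c c₁ ε δ : ℝ} {M E L T B B₁ : ℕ} (hε : 0 < ε) (hδ : 0 < δ)
  (hE : 1 / ε ≤ E) (hL : Real.log (1 / δ) ≤ L) (hc : 0 < c) (hB : c ≤ B)

include hε hE hc hB in
theorem numLevels_le (hM : 1 ≤ M) : numLevels c M ε ≤ B * M ^ 2 * E := by
  refine Nat.ceil_le.mpr ?_
  push_cast
  have h1 : Real.log (1 / ε) ≤ E := (Real.log_le_self (by positivity)).trans hE
  have h2 : (0 : ℝ) ≤ E := Nat.cast_nonneg _
  refine (mul_le_mul_of_nonneg_left h1 (by positivity)).trans ?_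
  gcongr

include hδ hL hc hB in
theorem log_div_subDelta_le (hT : 0 < T) (k : ℕ) :
    Real.log (k / subDelta c T δ) ≤ (k * (B * T ^ 10) + L : ℕ) := by
  have hT0 : (0 : ℝ) < T := by exact_mod_cast hT
  rcases Nat.eq_zero_or_pos k with rfl | hk
  · simp
  have hk0 : (0 : ℝ) < k := by exact_mod_cast hk
  have e : (k : ℝ) / subDelta c T δ = k * (c * T ^ 10) * (1 / δ) := by
    unfold subDelta
    field_simp
  rw [e, Real.log_mul (by positivity) (by positivity)]
  push_cast
  refine add_le_add ((Real.log_le_self (by positivity)).trans ?_) hL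
  gcongr

include hε hδ hE hL hc hB in
theorem numRuns_le (hT : 0 < T) : c * Real.log (T / (ε * δ)) ≤ (B * (T * E + L) : ℕ) := by
  have hT0 : (0 : ℝ) < T := by exact_mod_cast hT
  have e : (T : ℝ) / (ε * δ) = T * (1 / ε) * (1 / δ) := by field_simp
  have h1 : Real.log (T / (ε * δ)) ≤ T * E + L := by
    rw [e, Real.log_mul (by positivity) (by positivity)]
    refine add_le_add ((Real.log_le_self (by positivity)).trans ?_) hL
    gcongr
  push_cast
  exact (mul_le_mul_of_nonneg_left h1 hc.le).trans (by gcongr)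

include hε hE in
theorem numAttempts_le (hT : 0 < T) {r R : ℕ} (hr : r ≤ R) :
    (r : ℝ) / pMin T ε ≤ (R * (4 * T * (T + 1) * E) : ℕ) := by
  have hT0 : (0 : ℝ) < T := by exact_mod_cast hT
  have e : (r : ℝ) / pMin T ε = r * (4 * T * (T + 1) * (1 / ε) / 3) := by
    unfold pMin
    field_simp
  rw [e]
  push_cast
  have h1 : (4 : ℝ) * T * (T + 1) * (1 / ε) / 3 ≤ 4 * T * (T + 1) * (1 / ε) :=
    div_le_self (by positivity) (by norm_num)
  refine mul_le_mul (by exact_mod_cast hr) (h1.trans ?_) (by positivity) (Nat.cast_nonneg _)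
  gcongr

include hδ hL hc hB in
/-- A bound for the number of trials of a `(γ, subDelta c T δ)`-estimate. -/
theorem numTrials_le (hT : 0 < T) {γ : ℝ} {K : ℕ} (hγ : 1 / γ ≤ K) (hγ0 : 0 < γ) :
    Real.log (2 / subDelta c T δ) / (2 * γ ^ 2) ≤ ((2 * (B * T ^ 10) + L) * K ^ 2 : ℕ) := by
  have h := log_div_subDelta_le hδ hL hc hB hT 2
  have e : Real.log (2 / subDelta c T δ) / (2 * γ ^ 2) =
      Real.log ((2 : ℕ) / subDelta c T δ) * (1 / γ) ^ 2 / 2 := by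
    push_cast
    field_simp
  rw [e]
  have hg : 0 ≤ 1 / γ := by positivity
  have h1 : Real.log ((2 : ℕ) / subDelta c T δ) * (1 / γ) ^ 2 ≤
      ((2 * (B * T ^ 10) + L : ℕ) : ℝ) * (1 / γ) ^ 2 := mul_le_mul_of_nonneg_right h (by positivity)
  have h2 : ((2 * (B * T ^ 10) + L : ℕ) : ℝ) * (1 / γ) ^ 2 ≤
      ((2 * (B * T ^ 10) + L : ℕ) : ℝ) * (K : ℝ) ^ 2 := by gcongr
  have h3 : 0 ≤ ((2 * (B * T ^ 10) + L : ℕ) : ℝ) * (K : ℝ) ^ 2 := by positivity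
  push_cast at h1 h2 h3 ⊢
  linarith

end ParameterBounds

section BoostCost

open Prog

/-- A polynomial bound for the number of operations of a visit, in terms of the number `T` of
levels, of `E ≥ 1 / ε`, of `L ≥ log (1 / δ)`, and of bounds `B`, `B₁` for the constants. -/
def visitBound (B B₁ m n T E L : ℕ) : ℕ :=
  visitOps m n T (sampleOps m n (B * (T * E + L) * (4 * T * (T + 1) * E)) T)
    ((2 * (B * T ^ 10) + L) * (4 * T * (T + 1) * E) ^ 2)
    ((2 * (B * T ^ 10) + L) * 100 ^ 2)
    ((2 * (B * T ^ 10) + L) * (B * (m + n)) ^ 2)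
    (B * (T * E + L))
    (B * (1 * (B * T ^ 10) + L)) (B₁ * (1 * (B * T ^ 10) + L))
    (B * n ^ 2 * (n * (B * T ^ 10) + L)) (B₁ * n * (1 * (B * T ^ 10) + L))

variable {X : Type u} {H : Type v} {m n : ℕ}

theorem opsLe_visit_visitBound {c c₁ ε δ : ℝ} {B B₁ T E L : ℕ} (hε : 0 < ε) (hδ : 0 < δ)
    (hE : 1 / ε ≤ E) (hL : Real.log (1 / δ) ≤ L) (hc : 0 < c) (hB : c ≤ B) (hc₁ : 0 ≤ c₁)
    (hB₁ : c₁ ≤ B₁) (hM : 1 ≤ m + n) (hT : 0 < T) {i t : ℕ} (ht : t ≤ T) (P : Branching X H m n) :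
    (visit c c₁ ε δ T i t P).OpsLe (visitBound B B₁ m n T E L) := by
  have hT0 : (0 : ℝ) < T := by exact_mod_cast hT
  have hM0 : (0 : ℝ) < (m + n : ℕ) := by exact_mod_cast hM
  have hr := numRuns_le hε hδ hE hL hc hB hT
  have h1 := log_div_subDelta_le hδ hL hc hB hT 1
  have hn := log_div_subDelta_le hδ hL hc hB hT n
  rw [Nat.cast_one] at h1
  have hmul : ∀ {a l : ℝ} {A N : ℕ}, 0 ≤ a → a ≤ A → l ≤ (N : ℕ) → a * l ≤ (A * N : ℕ) := by
    intro a l A N ha hA hl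
    push_cast
    exact (mul_le_mul_of_nonneg_left hl ha).trans
      (mul_le_mul_of_nonneg_right hA (Nat.cast_nonneg _))
  refine opsLe_visit (numAttempts_le hε hE hT (Nat.ceil_le.mpr hr)) ?_ ?_ ?_ hr
    (hmul hc.le hB h1) (hmul hc₁ hB₁ h1) (hmul (by positivity) ?_ hn) (hmul (by positivity) ?_ h1) ht P
  · refine numTrials_le hδ hL hc hB hT ?_ (by unfold gammaOne; positivity)
    have e : 1 / gammaOne T ε = 4 * T * (T + 1) * (1 / ε) := by
      unfold gammaOne
      field_simp
    rw [e]
    push_cast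
    gcongr
  · exact numTrials_le hδ hL hc hB hT (by norm_num) (by norm_num)
  · refine numTrials_le hδ hL hc hB hT ?_ (by unfold gammaTwo; positivity)
    unfold gammaTwo
    rw [one_div_one_div]
    push_cast
    gcongr
  · push_cast
    gcongr
  · push_cast
    gcongr

/-- The values of the parameters for which the bounds are claimed: `ε`, `δ`, `m` and `n`. -/
def Parameters : Type :=
  {z : ℝ × ℝ × ℕ × ℕ // 0 < z.1 ∧ z.1 < 1 ∧ 0 < z.2.1 ∧ z.2.1 < 1 ∧ 1 ≤ z.2.2.1 + z.2.2.2}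

theorem PolyDominated.visitBound {ι : Type*} {x : ι → Fin 3 → ℝ} {m n T E L : ι → ℕ} (B B₁ : ℕ)
    (hm : PolyDominated x m) (hn : PolyDominated x n) (hT : PolyDominated x T)
    (hE : PolyDominated x E) (hL : PolyDominated x L) :
    PolyDominated x fun i => visitBound B B₁ (m i) (n i) (T i) (E i) (L i) := by
  unfold TDS.visitBound visitOps findTrainSetOps searchSlotOps sampleOps
  repeat' with_reducible first
    | assumption
    | exact PolyDominated.const _
    | refine PolyDominated.add ?_ ?_
    | refine PolyDominated.mul ?_ ?_
    | refine PolyDominated.pow ?_ _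

/-- The number of operations of the algorithm is polynomially bounded. -/
theorem exists_opsLe_boost {c c₁ : ℝ} (hc : 0 < c) (hc₁ : 0 ≤ c₁) :
    ∃ Q : MvPolynomial (Fin 3) ℝ, ∀ (X : Type u) (H : Type v) (ev : H → X → Bool) (ε δ : ℝ),
      0 < ε → ε < 1 → 0 < δ → δ < 1 → ∀ m n : ℕ, 1 ≤ m + n → ∃ N : ℕ,
      (boost c c₁ ev ε δ : Prog X H m n _).OpsLe N ∧
        (N : ℝ) ≤ MvPolynomial.eval ![((m + n : ℕ) : ℝ), 1 / ε, Real.log (1 / δ)] Q := by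
  set B := ⌈c⌉₊
  set B₁ := ⌈c₁⌉₊
  let x : Parameters → Fin 3 → ℝ := fun z =>
    ![((z.1.2.2.1 + z.1.2.2.2 : ℕ) : ℝ), 1 / z.1.1, Real.log (1 / z.1.2.1)]
  have hx : ∀ z j, 0 ≤ x z j := fun z j => by
    obtain ⟨⟨ε, δ, m, n⟩, h1, h2, h3, h4, h5⟩ := z
    simp only at h1 h2 h3 h4
    fin_cases j
    · exact Nat.cast_nonneg _
    · exact (one_div_pos.mpr h1).le
    · exact Real.log_nonneg (by rw [le_div_iff₀ h3]; linarith)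
  have hm : PolyDominated x fun z => z.1.2.2.1 :=
    ⟨MvPolynomial.X 0, fun z => by simp [x]⟩
  have hn : PolyDominated x fun z => z.1.2.2.2 :=
    ⟨MvPolynomial.X 0, fun z => by simp [x]⟩
  have hE : PolyDominated x fun z => ⌈1 / z.1.1⌉₊ := PolyDominated.ceil (j := 1) fun z => hx z 1
  have hL : PolyDominated x fun z => ⌈Real.log (1 / z.1.2.1)⌉₊ :=
    PolyDominated.ceil (j := 2) fun z => hx z 2
  have hT : PolyDominated x fun z => numLevels c (z.1.2.2.1 + z.1.2.2.2) z.1.1 :=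
    (((PolyDominated.const B).mul ((hm.add hn).pow 2)).mul hE).mono fun z =>
      numLevels_le z.2.1 (Nat.le_ceil _) hc (Nat.le_ceil _) z.2.2.2.2.2
  have hall : PolyDominated x fun z =>
      numLevels c (z.1.2.2.1 + z.1.2.2.2) z.1.1 * (numLevels c (z.1.2.2.1 + z.1.2.2.2) z.1.1 + 1) +
        numLevels c (z.1.2.2.1 + z.1.2.2.2) z.1.1 ^ 2 *
          (1 + visitBound B B₁ z.1.2.2.1 z.1.2.2.2 (numLevels c (z.1.2.2.1 + z.1.2.2.2) z.1.1)
            ⌈1 / z.1.1⌉₊ ⌈Real.log (1 / z.1.2.1)⌉₊) :=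
    (hT.mul (hT.add (.const 1))).add
      ((hT.pow 2).mul ((PolyDominated.const 1).add (.visitBound B B₁ hm hn hT hE hL)))
  obtain ⟨Q, hQ⟩ := hall
  refine ⟨Q, fun X H ev ε δ hε hε1 hδ hδ1 m n hM => ⟨_, opsLe_boost ev fun i t ht P => ?_,
    hQ ⟨(ε, δ, m, n), hε, hε1, hδ, hδ1, hM⟩⟩⟩
  have hlev : 0 < numLevels c (m + n) ε := by
    refine Nat.ceil_pos.mpr ?_
    have h1 : 0 < Real.log (1 / ε) := Real.log_pos (by rw [lt_div_iff₀ hε]; linarith)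
    have h2 : (0 : ℝ) < (m + n : ℕ) := by exact_mod_cast hM
    positivity
  exact opsLe_visit_visitBound hε hδ (Nat.le_ceil _) (Nat.le_ceil _) hc (Nat.le_ceil _) hc₁
    (Nat.le_ceil _) hM hlev ht P

end BoostCost

end TDS

end

theorem theorem3p4 :
    -- the constant in `O(ε)` is absolute
    ∃ K : ℝ, 0 < K ∧
    -- `c₁` sufficiently large, and `c` sufficiently large depending on `c₁`
    ∃ a₁ : ℝ, ∀ c₁ : ℝ, a₁ ≤ c₁ → ∃ a : ℝ, ∀ c : ℝ, a ≤ c →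
    ∃ Pcalls Psamples Ptime : MvPolynomial (Fin 3) ℝ,
    ∀ (X : Type u) [MeasurableSpace X] (H : Type v) [MeasurableSpace H]
      (ev : H → X → Bool), Measurable (Function.uncurry ev) →
    ∀ C : Set (X → Bool), (∀ f ∈ C, Measurable f) →
    ∀ ε δ : ℝ, 0 < ε → ε < 1 → 0 < δ → δ < 1 →
    ∀ m n TA : ℕ, 1 ≤ m + n → 1 ≤ TA →
    ∀ (A : TDS.Learner X H m n) [ProbabilityTheory.IsMarkovKernel A],
      TDS.IsTDSLearner ev C A ε 0.01 →
      TDS.IsPQLearner A C (K * ε) (K * ε) δ (TDS.boost c c₁ ev ε δ) ∧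
      TDS.PolyBounded Pcalls (m + n) ε δ 1
        (TDS.boost c c₁ ev ε δ : TDS.Prog X H m n _).numCalls ∧
      TDS.PolyBounded Psamples (m + n) ε δ 1
        (TDS.boost c c₁ ev ε δ : TDS.Prog X H m n _).numSamples ∧
      TDS.PolyBounded Ptime (m + n) ε δ TA
        ((TDS.boost c c₁ ev ε δ : TDS.Prog X H m n _).time TA) := by
  refine ⟨100, by norm_num, 1000, fun c₁ hc₁ => ⟨max (10 ^ 10) (2 * (c₁ + 1)), fun c hc => ?_⟩⟩
  obtain ⟨hc, hcc⟩ := max_le_iff.mp hc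
  obtain ⟨Q, hQ⟩ := TDS.exists_opsLe_boost.{u, v} (c := c) (c₁ := c₁) (by linarith) (by linarith)
  refine ⟨Q, Q, Q, fun X _ H _ ev hev C hC ε δ hε hε1 hδ hδ1 m n TA hM hTA A _ hA => ?_⟩
  obtain ⟨N, hN, hNQ⟩ := hQ X H ev ε δ hε hε1 hδ hδ1 m n hM
  refine ⟨TDS.isPQLearner_boost hA hev hC hM hε hδ hδ1 hc₁ hc hcc, ⟨N, ?_, by simpa using hNQ⟩,
    ⟨N, ?_, by simpa using hNQ⟩, ⟨TA * N, ?_, ?_⟩⟩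
  · rw [← one_mul N]
    exact hN.cost_le fun o => by cases o <;> simp
  · rw [← one_mul N]
    exact hN.cost_le fun o => by cases o <;> simp
  · exact hN.cost_le fun o => by cases o <;> simp [hTA]
  · push_cast
    exact mul_le_mul_of_nonneg_left (by simpa using hNQ) (Nat.cast_nonneg _)
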